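/- Let $H$ be a complex Hilbert space, $A$ a positive injective bounded operator on $H$, and $1\le p\le\infty$. Let $\mathcal B_p(H)$ be the Schatten class with the norm $\|X\|_p=\mathrm{Tr}(|X|^p)^{1/p}$ (for $p=\infty$: the compact operators with the operator norm). Put $$\mathfrak g_p=\{X\in\mathcal B_p(H): X^*A=-AX\},\qquad i\mathfrak g_p=\{X\in\mathcal B_p(H): X^*A=AX\},$$ real normed spaces for $\|\cdot\|_p$, and let $\mathcal G_{p,A}$ be the group of invertible bounded operators $G$ on $H$ with $G^*AG=A$ and $G-1\in\mathcal B_p(H)$, with the metric $\|G-K\|_p$; it is a $C^\infty$ Lie group modelled on $\mathfrak g_p$ for which $\exp:\mathfrak g_p\to\mathcal G_{p,A}$ is a local diffeomorphism at $0$. Fix $Q_0$ with $Q_0^2=Q_0$, $Q_0^*A=AQ_0$, and let $$Gr_{res,p}=\{Q\in\mathcal B(H): Q^2=Q,\ Q^*A=AQ,\ Q-Q_0\in\mathcal B_p(H)\}\subset Q_0+i\mathfrak g_p,$$ with the metric $\|Q-R\|_p$. For $Q_1\in Gr_{res,p}$ let $(Gr_{res,p})_{Q_1}$ be the connected component of $Q_1$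 in $Gr_{res,p}$. Then, for every $Q_1\in Gr_{res,p}$, the component $(Gr_{res,p})_{Q_1}$ is a complemented $C^\infty$ submanifold of the affine space $Q_0+i\mathfrak g_p$ (locally straightened by $C^\infty$ diffeomorphisms to closed complemented subspaces of $i\mathfrak g_p$). For the induced manifold structure, whose inclusion in $Q_0+i\mathfrak g_p$ is a $C^\infty$ embedding, the map $$\mathcal G_{p,A}\to(Gr_{res,p})_{Q_1},\qquad G\mapsto GQ_1G^{-1},$$ is well defined and is a $C^\infty$ submersion (locally, in suitable charts, a projection of a direct product onto a factor). -/

import Mathlib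

open scoped ContDiff Manifold

universe u

namespace CompGr

noncomputable section

section Schatten

open scoped ENNReal NNReal InnerProductSpace

variable {H : Type*} [NormedAddCommGroup H] [InnerProductSpace ℂ H] [CompleteSpace H]

/-- The trace `∑ ⟨e i, T (e i)⟩` (in a Hilbert basis) of a positive operator, in `[0, ⊤]`. -/
def posTrace (T : H →L[ℂ] H) : ℝ≥0∞ :=
  ∑' i, ENNReal.ofReal (RCLike.re
    ⟪(exists_hilbertBasis ℂ H).choose_spec.choose i,
      T ((exists_hilbertBasis ℂ H).choose_spec.choose i)⟫_ℂ)

/-- `Tr (|X| ^ r)`, in `[0, ⊤]`. -/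
def traceAbsPow (r : ℝ) (X : H →L[ℂ] H) : ℝ≥0∞ := posTrace (CFC.abs X ^ r)

/-- Bessel families with bound one. -/
def IsSubON {ι : Type*} (u : ι → H) : Prop :=
  ∀ x : H, ∑' j, ‖⟪u j, x⟫_ℂ‖ₑ ^ 2 ≤ ‖x‖ₑ ^ 2

set_option linter.unusedSectionVars false in
lemma tsum_enorm_inner_sq {ι : Type*} (b : HilbertBasis ι ℂ H) (x : H) :
    ∑' i, ‖⟪b i, x⟫_ℂ‖ₑ ^ 2 = ‖x‖ₑ ^ 2 := by
  have h := b.hasSum_inner_mul_inner x x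
  have h2 : HasSum (fun i => ‖⟪b i, x⟫_ℂ‖ ^ 2) (‖x‖ ^ 2) := by
    have h3 := (RCLike.reCLM (K := ℂ)).hasSum h
    convert! h3 using 1
    · ext i
      have : ⟪x, b i⟫_ℂ * ⟪b i, x⟫_ℂ = ((‖⟪b i, x⟫_ℂ‖ ^ 2 : ℝ) : ℂ) := by
        rw [← inner_conj_symm x (b i), RCLike.conj_mul]; push_cast; rfl
      rw [this]
      exact (RCLike.ofReal_re (K := ℂ) _).symm
    · simp [← inner_self_eq_norm_sq (𝕜 := ℂ)]
  have h4 := ENNReal.ofReal_tsum_of_nonneg (fun i => by positivity) h2.summable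
  rw [h2.tsum_eq] at h4
  simp only [← ofReal_norm]
  simp_rw [← ENNReal.ofReal_pow (norm_nonneg _)]
  exact h4.symm

set_option linter.unusedSectionVars false in
lemma isSubON_of_orthonormal {ι : Type*} {u : ι → H} (hu : Orthonormal ℂ u) : IsSubON u := by
  intro x
  have h4 := ENNReal.ofReal_tsum_of_nonneg (fun i => by positivity) (hu.inner_products_summable x)
  simp only [← ofReal_norm]
  simp_rw [← ENNReal.ofReal_pow (norm_nonneg _)]
  rw [← h4]
  exact ENNReal.ofReal_le_ofReal (hu.tsum_inner_products_le x)

set_option linter.unusedSectionVars false in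
lemma IsSubON.enorm_le {ι : Type*} {u : ι → H} (hu : IsSubON u) (j : ι) : ‖u j‖ₑ ^ 2 ≤ 1 := by
  have h := (ENNReal.le_tsum j).trans (hu (u j))
  have h1 : ‖⟪u j, u j⟫_ℂ‖ = ‖u j‖ ^ 2 := by
    rw [inner_self_eq_norm_sq_to_K]; simp
  rw [← ofReal_norm, h1, ← ofReal_norm, ← ENNReal.ofReal_pow (norm_nonneg _),
    ← ENNReal.ofReal_pow (by positivity),
    ENNReal.ofReal_le_ofReal_iff (by positivity)] at h
  rw [← ofReal_norm, ← ENNReal.ofReal_pow (norm_nonneg _)]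
  rw [ENNReal.ofReal_le_one]
  by_contra! hc
  nlinarith

lemma IsSubON.map {ι : Type*} {u : ι → H} (hu : IsSubON u) (C : H →L[ℂ] H) (hC : ‖C‖ ≤ 1) :
    IsSubON (fun j => C (u j)) := by
  intro x
  have : ∀ j, ⟪C (u j), x⟫_ℂ = ⟪u j, C.adjoint x⟫_ℂ := fun j =>
    (ContinuousLinearMap.adjoint_inner_right C _ _).symm
  simp only [this]
  refine (hu _).trans ?_
  gcongr
  rw [← ofReal_norm, ← ofReal_norm]
  refine ENNReal.ofReal_le_ofReal ?_
  calc ‖C.adjoint x‖ ≤ ‖C.adjoint‖ * ‖x‖ := ContinuousLinearMap.le_opNorm _ _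
    _ ≤ 1 * ‖x‖ := by gcongr; simpa using hC
    _ = ‖x‖ := one_mul _

lemma cfc_apply_of_eigenvector {a : H →L[ℂ] H} (ha : IsSelfAdjoint a) {s : ℝ} {v : H}
    (hv : a v = (s : ℂ) • v) (hv0 : v ≠ 0) (f : ℝ → ℝ) (hf : ContinuousOn f (spectrum ℝ a)) :
    (cfc f a) v = ((f s : ℝ) : ℂ) • v := by
  have hs : s ∈ spectrum ℝ a := by
    rw [spectrum.mem_iff]
    intro hu
    apply hv0
    obtain ⟨w, hw⟩ := hu
    have h1 : (w : H →L[ℂ] H) v = 0 := by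
      rw [hw]
      simp [Algebra.algebraMap_eq_smul_one, hv]
    have h2 : ((↑w⁻¹ : H →L[ℂ] H) * (w : H →L[ℂ] H)) v = 0 := by
      rw [mul_apply_eq_comp, h1, map_zero]
    simpa using h2
  rw [cfc_apply f a ha hf]
  have key : ∀ g : C(spectrum ℝ a, ℝ), (cfcHom ha g) v = ((g ⟨s, hs⟩ : ℝ) : ℂ) • v := by
    intro g
    open scoped ContinuousFunctionalCalculus in
    induction g using ContinuousMap.induction_on_of_compact with
    | const r =>
      have : cfcHom ha (ContinuousMap.const _ r) = algebraMap ℝ (H →L[ℂ] H) r :=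
        AlgHomClass.commutes (cfcHom ha) r
      rw [this]
      simp [Algebra.algebraMap_eq_smul_one]
    | id => rw [cfcHom_id ha]; simpa using hv
    | star_id => rw [map_star, cfcHom_id, ha.star_eq]; simpa using hv
    | add f g hf hg => rw [map_add, add_apply, hf, hg]; simp [add_smul]
    | mul f g hf hg =>
      rw [map_mul, mul_apply_eq_comp, hg, map_smul, hf]
      rw [smul_smul, ContinuousMap.mul_apply, mul_comm (f _)]; push_cast; rfl
    | frequently g hg =>
      have hc : IsClosed {g : C(spectrum ℝ a, ℝ) |
          (cfcHom ha g) v = ((g ⟨s, hs⟩ : ℝ) : ℂ) • v} := by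
        refine isClosed_eq ?_ ?_
        · have h1 := cfcHom_continuous (R := ℝ) ha
          exact (ContinuousLinearMap.apply ℂ H v).continuous.comp h1
        · have : Continuous fun g : C(spectrum ℝ a, ℝ) => g ⟨s, hs⟩ :=
            continuous_eval_const _
          fun_prop
      have h2 := mem_closure_of_frequently_of_tendsto (s := {g : C(spectrum ℝ a, ℝ) |
          (cfcHom ha g) v = ((g ⟨s, hs⟩ : ℝ) : ℂ) • v}) hg Filter.tendsto_id
      rw [hc.closure_eq] at h2
      exact h2
  exact key _


/-- Diagonalization of a compact operator. -/
lemma exists_singular_basis {H : Type u} [NormedAddCommGroup H] [InnerProductSpace ℂ H]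
    [CompleteSpace H] {X : H →L[ℂ] H} (hX : IsCompactOperator X) :
    ∃ (ι : Type u) (f : HilbertBasis ι ℂ H) (g : ι → H), IsSubON g ∧
      (∀ k, X (f k) = ((‖X (f k)‖ : ℝ) : ℂ) • g k) ∧
      (∀ k, ⟪g k, X (f k)⟫_ℂ = ((‖X (f k)‖ : ℝ) : ℂ)) ∧
      (∀ k, CFC.abs X (f k) = ((‖X (f k)‖ : ℝ) : ℂ) • f k) := by
  classical
  set a : H →L[ℂ] H := X.adjoint * X with ha_def
  have haC : IsCompactOperator a := hX.clm_comp X.adjoint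
  have hasa : IsSelfAdjoint a := IsSelfAdjoint.star_mul_self X
  have hsym : a.toLinearMap.IsSymmetric := hasa.isSymmetric
  have hin : ∀ x y, ⟪x, a y⟫_ℂ = ⟪X x, X y⟫_ℂ := fun x y => by
    rw [ha_def, mul_apply_eq_comp, ContinuousLinearMap.adjoint_inner_right]
  let V : ℂ → Submodule ℂ H := fun μ => Module.End.eigenspace a.toLinearMap μ
  have hcl : ∀ μ, CompleteSpace (V μ) := fun μ => by
    have : IsClosed (V μ : Set H) := by
      have h1 : (V μ : Set H) = {x | a x = μ • x} := by
        ext x; simp [V]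
      rw [h1]
      exact isClosed_eq (by fun_prop) (by fun_prop)
    exact this.completeSpace_coe
  choose w b hb using fun μ => exists_hilbertBasis ℂ (V μ)
  let v : (Σ μ, w μ) → H := fun k => ((b k.1 k.2 : V k.1) : H)
  have hon : Orthonormal ℂ v :=
    (hsym.orthogonalFamily_eigenspaces).orthonormal_sigma_orthonormal
      (fun μ => (b μ).orthonormal)
  have hbot : (Submodule.span ℂ (Set.range v))ᗮ = ⊥ := by
    rw [eq_bot_iff, ← ContinuousLinearMap.orthogonalComplement_iSup_eigenspaces_eq_bot haC hsym]
    intro x hx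
    rw [Submodule.mem_orthogonal'] at hx
    rw [← Submodule.iInf_orthogonal, Submodule.mem_iInf]
    intro μ
    rw [Submodule.mem_orthogonal']
    intro y hy
    have h1 := ((b μ).hasSum_repr ⟨y, hy⟩).mapL ((innerSL ℂ x).comp (V μ).subtypeL)
    have h2 : ∀ i, ((innerSL ℂ x).comp (V μ).subtypeL) ((b μ).repr ⟨y, hy⟩ i • (b μ) i) = 0 := by
      intro i
      rw [map_smul]
      have : ⟪x, v ⟨μ, i⟩⟫_ℂ = 0 := hx _ (Submodule.subset_span ⟨_, rfl⟩)
      simp only [v] at this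
      simp [this]
    simp only [h2] at h1
    simpa using h1.unique hasSum_zero
  let f : HilbertBasis (Σ μ, w μ) ℂ H := HilbertBasis.mkOfOrthogonalEqBot hon hbot
  have hf : ∀ k, f k = v k := fun k => by
    simp only [f]; rw [HilbertBasis.coe_mkOfOrthogonalEqBot]
  have hfn : ∀ k, ‖f k‖ = 1 := fun k => f.orthonormal.1 k
  have haf : ∀ k, a (f k) = ((‖X (f k)‖ ^ 2 : ℝ) : ℂ) • f k := by
    intro k
    have h1 : a (f k) = k.1 • f k := by
      rw [hf]
      exact Module.End.mem_eigenspace_iff.1 (b k.1 k.2 : V k.1).2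
    have h2 := hin (f k) (f k)
    rw [h1, inner_smul_right, inner_self_eq_norm_sq_to_K, inner_self_eq_norm_sq_to_K, hfn] at h2
    simp only [map_one, one_pow, mul_one] at h2
    rw [h1, Complex.ofReal_pow]
    congr 1
  have habs : ∀ k, CFC.abs X (f k) = ((‖X (f k)‖ : ℝ) : ℂ) • f k := by
    intro k
    have hp : (CFC.abs X).IsPositive :=
      (ContinuousLinearMap.nonneg_iff_isPositive _).1 (CFC.abs_nonneg X)
    have hsq : CFC.abs X (CFC.abs X (f k)) = ((‖X (f k)‖ ^ 2 : ℝ) : ℂ) • f k := by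
      rw [← haf, ← mul_apply_eq_comp, CFC.abs_mul_abs]; rfl
    set s := ‖X (f k)‖ with hs
    rcases (norm_nonneg (X (f k))).eq_or_lt with h0 | h0
    · rw [← hs] at h0
      rw [← h0] at hsq ⊢
      have h3 : ⟪CFC.abs X (f k), CFC.abs X (f k)⟫_ℂ = 0 := by
        rw [hp.isSymmetric.apply_clm, hsq]; simp
      rw [inner_self_eq_zero.1 h3]; simp
    · rw [← hs] at h0
      set y := CFC.abs X (f k) - ((s : ℝ) : ℂ) • f k with hy
      have h4 : CFC.abs X y = -((s : ℝ) : ℂ) • y := by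
        rw [hy, map_sub, map_smul, hsq]
        push_cast
        module
      have h5 := hp.re_inner_nonneg_right y
      rw [h4, inner_smul_right, inner_self_eq_norm_sq_to_K] at h5
      have h6 : 0 ≤ - s * ‖y‖ ^ 2 := by
        convert h5 using 1
        have : (-(s : ℂ) * ((‖y‖ : ℝ) : ℂ) ^ 2) = ((-s * ‖y‖ ^ 2 : ℝ) : ℂ) := by push_cast; rfl
        exact (congrArg Complex.re this).symm
      have h7 : y = 0 := by
        by_contra hne
        have := norm_pos_iff.2 hne
        nlinarith [mul_pos h0 (pow_pos this 2)]
      exact sub_eq_zero.1 h7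
  refine ⟨_, f, fun k => ((‖X (f k)‖ : ℝ) : ℂ)⁻¹ • X (f k), ?_, ?_, ?_, habs⟩
  · intro x
    let S : Set (Σ μ, w μ) := {k | X (f k) ≠ 0}
    have hS : Orthonormal ℂ (fun k : S => ((‖X (f k)‖ : ℝ) : ℂ)⁻¹ • X (f k)) := by
      constructor
      · intro k
        have := norm_ne_zero_iff.2 k.2
        rw [norm_smul, norm_inv, Complex.norm_real, norm_norm, inv_mul_cancel₀ this]
      · intro k l hkl
        have : (k : Σ μ, w μ) ≠ l := fun h => hkl (Subtype.ext h)
        rw [inner_smul_left, inner_smul_right, ← hin, haf, inner_smul_right,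
          f.orthonormal.2 this]
        simp
    refine le_trans (le_of_eq ?_) (isSubON_of_orthonormal hS x)
    refine (tsum_subtype_eq_of_support_subset (s := S)
      (f := fun k => ‖⟪((‖X (f k)‖ : ℝ) : ℂ)⁻¹ • X (f k), x⟫_ℂ‖ₑ ^ 2) ?_).symm
    intro k hk hc
    apply hk
    simp [hc]
  · intro k
    rcases eq_or_ne (X (f k)) 0 with h | h
    · simp [h]
    · have := norm_ne_zero_iff.2 h
      rw [smul_smul, mul_inv_cancel₀ (by exact_mod_cast this), one_smul]
  · intro k
    rcases eq_or_ne (X (f k)) 0 with h | h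
    · simp [h]
    · have : ((‖X (f k)‖ : ℝ) : ℂ) ≠ 0 := by exact_mod_cast norm_ne_zero_iff.2 h
      rw [inner_smul_left, inner_self_eq_norm_sq_to_K, map_inv₀, Complex.conj_ofReal]
      field_simp
      rfl


lemma rpow_tsum_weight_le {κ : Type*} {r : ℝ} (hr : 1 ≤ r) (w s : κ → ℝ≥0∞)
    (hw : ∑' k, w k ≤ 1) : (∑' k, w k * s k) ^ r ≤ ∑' k, w k * s k ^ r := by
  have hr0 : 0 < r := by linarith
  rw [ENNReal.le_rpow_inv_iff hr0 |>.symm, ENNReal.tsum_eq_iSup_sum]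
  refine iSup_le fun t => ?_
  refine (ENNReal.inner_le_weight_mul_Lp_of_nonneg t hr w s).trans ?_
  calc _ ≤ (1 : ℝ≥0∞) ^ (1 - r⁻¹) * (∑' k, w k * s k ^ r) ^ r⁻¹ := by
        gcongr
        · have := inv_le_one_of_one_le₀ hr
          linarith
        · exact (ENNReal.sum_le_tsum t).trans hw
        · exact ENNReal.sum_le_tsum t
    _ = _ := by simp

lemma Lp_add_le_tsum {κ : Type*} {r : ℝ} (hr : 1 ≤ r) (a b : κ → ℝ≥0∞) :
    (∑' k, (a k + b k) ^ r) ^ (1 / r) ≤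
      (∑' k, a k ^ r) ^ (1 / r) + (∑' k, b k ^ r) ^ (1 / r) := by
  have hr0 : 0 < r := by linarith
  rw [one_div, ENNReal.rpow_inv_le_iff hr0, ENNReal.tsum_eq_iSup_sum]
  refine iSup_le fun t => ?_
  rw [← ENNReal.rpow_inv_le_iff hr0, ← one_div]
  refine (ENNReal.Lp_add_le t a b hr).trans ?_
  gcongr <;> exact ENNReal.sum_le_tsum t

lemma ennreal_mul_le (a b : ℝ≥0∞) : a * b ≤ (a ^ 2 + b ^ 2) / 2 := by
  rw [ENNReal.le_div_iff_mul_le (by simp) (by simp)]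
  rcases eq_or_ne a ⊤ with rfl | ha
  · simp
  rcases eq_or_ne b ⊤ with rfl | hb
  · simp
  lift a to ℝ≥0 using ha
  lift b to ℝ≥0 using hb
  norm_cast
  rw [← NNReal.coe_le_coe]
  push_cast
  nlinarith [sq_nonneg ((a : ℝ) - b)]

/-- `Tr |X| ^ r = ∑ ‖X (f k)‖ ^ r` for an eigenbasis `f` of `|X|`. -/
lemma traceAbsPow_eq {X : H →L[ℂ] H} {r : ℝ} (hr : 1 ≤ r) {ι : Type*} (f : HilbertBasis ι ℂ H)
    (hf : ∀ k, CFC.abs X (f k) = ((‖X (f k)‖ : ℝ) : ℂ) • f k) :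
    traceAbsPow r X = ∑' k, ‖X (f k)‖ₑ ^ r := by
  have hr0 : 0 < r := by linarith
  have hpos : (0 : H →L[ℂ] H) ≤ CFC.abs X ^ r := CFC.rpow_nonneg
  have hsa : (CFC.abs X ^ r).IsPositive := (ContinuousLinearMap.nonneg_iff_isPositive _).1 hpos
  have hP : ∀ k, (CFC.abs X ^ r) (f k) = ((‖X (f k)‖ ^ r : ℝ) : ℂ) • f k := by
    intro k
    rw [CFC.rpow_eq_cfc_real (CFC.abs_nonneg X)]
    have hk : f k ≠ 0 := f.orthonormal.ne_zero k
    exact cfc_apply_of_eigenvector (CFC.abs_nonneg X).isSelfAdjoint (hf k) hk (fun x => x ^ r)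
      (Real.continuous_rpow_const hr0.le).continuousOn
  set P := CFC.abs X ^ r with hPdef
  have hx : ∀ x : H, ENNReal.ofReal (RCLike.re ⟪x, P x⟫_ℂ) =
      ∑' k, ‖X (f k)‖ₑ ^ r * ‖⟪x, f k⟫_ℂ‖ₑ ^ 2 := by
    intro x
    have h := (RCLike.reCLM (K := ℂ)).hasSum (f.hasSum_inner_mul_inner x (P x))
    have h1 : ∀ k, RCLike.reCLM (K := ℂ) (⟪x, f k⟫_ℂ * ⟪f k, P x⟫_ℂ) =
        ‖X (f k)‖ ^ r * ‖⟪x, f k⟫_ℂ‖ ^ 2 := by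
      intro k
      have h2 : ⟪f k, P x⟫_ℂ = ((‖X (f k)‖ ^ r : ℝ) : ℂ) * ⟪f k, x⟫_ℂ := by
        have := hsa.isSymmetric (f k) x
        simp only [ContinuousLinearMap.coe_coe] at this
        rw [← this, hP, inner_smul_left, Complex.conj_ofReal]
      have h3 : ⟪x, f k⟫_ℂ * ⟪f k, P x⟫_ℂ = ((‖X (f k)‖ ^ r * ‖⟪x, f k⟫_ℂ‖ ^ 2 : ℝ) : ℂ) := by
        rw [h2, mul_left_comm, ← inner_conj_symm (f k) x, RCLike.mul_conj]; push_cast; rfl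
      rw [h3]
      exact RCLike.ofReal_re (K := ℂ) _
    have h4 : HasSum (fun k => ‖X (f k)‖ ^ r * ‖⟪x, f k⟫_ℂ‖ ^ 2) (RCLike.re ⟪x, P x⟫_ℂ) := by
      convert! h using 1
      exact funext fun k => (h1 k).symm
    rw [← h4.tsum_eq, ENNReal.ofReal_tsum_of_nonneg (fun k => by positivity) h4.summable]
    refine tsum_congr fun k => ?_
    rw [ENNReal.ofReal_mul (by positivity), ENNReal.ofReal_pow (by positivity), ofReal_norm,
      ← ENNReal.ofReal_rpow_of_nonneg (norm_nonneg _) hr0.le, ofReal_norm]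
  unfold traceAbsPow posTrace
  simp_rw [← hPdef, hx]
  rw [ENNReal.tsum_comm]
  refine tsum_congr fun k => ?_
  rw [ENNReal.tsum_mul_left, tsum_enorm_inner_sq, ← ofReal_norm (f k), f.orthonormal.1 k]
  simp

lemma exists_traceAbsPow_eq {H : Type u} [NormedAddCommGroup H] [InnerProductSpace ℂ H]
    [CompleteSpace H] {X : H →L[ℂ] H} (hX : IsCompactOperator X) {r : ℝ} (hr : 1 ≤ r) :
    ∃ (ι : Type u) (u v : ι → H), IsSubON u ∧ IsSubON v ∧
      traceAbsPow r X = ∑' k, ‖⟪v k, X (u k)⟫_ℂ‖ₑ ^ r := by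
  obtain ⟨ι, f, g, hg, -, h2, h3⟩ := exists_singular_basis hX
  refine ⟨ι, f, g, isSubON_of_orthonormal f.orthonormal, hg, ?_⟩
  rw [traceAbsPow_eq hr f h3]
  refine tsum_congr fun k => ?_
  rw [h2, ← ofReal_norm, ← ofReal_norm, Complex.norm_real, norm_norm]

lemma tsum_le_traceAbsPow {X : H →L[ℂ] H} (hX : IsCompactOperator X) {r : ℝ} (hr : 1 ≤ r)
    {ι : Type*} {u v : ι → H} (hu : IsSubON u) (hv : IsSubON v) :
    ∑' j, ‖⟪v j, X (u j)⟫_ℂ‖ₑ ^ r ≤ traceAbsPow r X := by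
  obtain ⟨κ, f, g, hg, h1, -, h3⟩ := exists_singular_basis hX
  rw [traceAbsPow_eq hr f h3]
  have hfs : IsSubON f := isSubON_of_orthonormal f.orthonormal
  have hcomm : ∀ x y : H, ‖⟪x, y⟫_ℂ‖ₑ = ‖⟪y, x⟫_ℂ‖ₑ := fun x y => by
    rw [← ofReal_norm, ← ofReal_norm, norm_inner_symm]
  let W : ι → κ → ℝ≥0∞ := fun j k => (‖⟪f k, u j⟫_ℂ‖ₑ ^ 2 + ‖⟪v j, g k⟫_ℂ‖ₑ ^ 2) / 2
  have hW1 : ∀ j, ∑' k, W j k ≤ 1 := by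
    intro j
    simp only [W, div_eq_mul_inv]
    rw [ENNReal.tsum_mul_right, ENNReal.tsum_add]
    simp_rw [hcomm (v j)]
    calc _ ≤ ((1 : ℝ≥0∞) + 1) * 2⁻¹ := by
          gcongr
          · exact (hfs _).trans (hu.enorm_le j)
          · exact (hg _).trans (hv.enorm_le j)
      _ = 1 := by rw [one_add_one_eq_two, ENNReal.mul_inv_cancel (by simp) (by simp)]
  have hW2 : ∀ k, ∑' j, W j k ≤ 1 := by
    intro k
    simp only [W, div_eq_mul_inv]
    rw [ENNReal.tsum_mul_right, ENNReal.tsum_add]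
    simp_rw [hcomm (f k)]
    calc _ ≤ ((1 : ℝ≥0∞) + 1) * 2⁻¹ := by
          gcongr
          · exact (hu _).trans (hfs.enorm_le k)
          · exact (hv _).trans (hg.enorm_le k)
      _ = 1 := by rw [one_add_one_eq_two, ENNReal.mul_inv_cancel (by simp) (by simp)]
  have hb : ∀ j, ‖⟪v j, X (u j)⟫_ℂ‖ₑ ≤ ∑' k, W j k * ‖X (f k)‖ₑ := by
    intro j
    have hs := ((f.hasSum_repr (u j)).mapL X).mapL (innerSL ℂ (v j))
    have he : ⟪v j, X (u j)⟫_ℂ = ∑' k, innerSL ℂ (v j) (X (f.repr (u j) k • f k)) :=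
      hs.tsum_eq.symm
    rw [he]
    refine enorm_tsum_le_tsum_enorm.trans (ENNReal.tsum_le_tsum fun k => ?_)
    have hk := congrArg (fun y => ⟪v j, y⟫_ℂ) (h1 k)
    simp only [inner_smul_right] at hk
    have hn : ‖((‖X (f k)‖ : ℝ) : ℂ)‖ₑ = ‖X (f k)‖ₑ := by
      rw [← ofReal_norm, ← ofReal_norm, Complex.norm_real, norm_norm]
    rw [map_smul, map_smul, f.repr_apply_apply, innerSL_apply_apply, hk, enorm_smul, enorm_mul,
      hn, mul_left_comm, mul_comm (W j k)]
    gcongr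
    exact ennreal_mul_le _ _
  calc ∑' j, ‖⟪v j, X (u j)⟫_ℂ‖ₑ ^ r
      ≤ ∑' j, (∑' k, W j k * ‖X (f k)‖ₑ) ^ r := by
        refine ENNReal.tsum_le_tsum fun j => ?_
        gcongr
        exact hb j
    _ ≤ ∑' j, ∑' k, W j k * ‖X (f k)‖ₑ ^ r :=
        ENNReal.tsum_le_tsum fun j => rpow_tsum_weight_le hr _ _ (hW1 j)
    _ = ∑' k, (∑' j, W j k) * ‖X (f k)‖ₑ ^ r := by
        rw [ENNReal.tsum_comm]
        simp_rw [ENNReal.tsum_mul_right]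
    _ ≤ ∑' k, 1 * ‖X (f k)‖ₑ ^ r := by
        refine ENNReal.tsum_le_tsum fun k => ?_
        gcongr
        exact hW2 k
    _ = _ := by simp


lemma traceAbsPow_smul_le {X : H →L[ℂ] H} (hX : IsCompactOperator X) {r : ℝ} (hr : 1 ≤ r) (c : ℂ) :
    traceAbsPow r (c • X) ≤ ‖c‖ₑ ^ r * traceAbsPow r X := by
  obtain ⟨ι, u, v, hu, hv, h⟩ := exists_traceAbsPow_eq (X := c • X) (hX.smul c) hr
  rw [h]
  calc _ = ∑' k, ‖c‖ₑ ^ r * ‖⟪v k, X (u k)⟫_ℂ‖ₑ ^ r := by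
        refine tsum_congr fun k => ?_
        rw [smul_apply, inner_smul_right, enorm_mul,
          ENNReal.mul_rpow_of_nonneg _ _ (by linarith)]
    _ ≤ _ := by
        rw [ENNReal.tsum_mul_left]
        gcongr
        exact tsum_le_traceAbsPow hX hr hu hv

lemma traceAbsPow_add_le {X Y : H →L[ℂ] H} (hX : IsCompactOperator X) (hY : IsCompactOperator Y)
    {r : ℝ} (hr : 1 ≤ r) :
    traceAbsPow r (X + Y) ^ (1 / r) ≤ traceAbsPow r X ^ (1 / r) + traceAbsPow r Y ^ (1 / r) := by
  obtain ⟨ι, u, v, hu, hv, h⟩ := exists_traceAbsPow_eq (X := X + Y) (hX.add hY) hr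
  rw [h]
  calc _ ≤ (∑' k, (‖⟪v k, X (u k)⟫_ℂ‖ₑ + ‖⟪v k, Y (u k)⟫_ℂ‖ₑ) ^ r) ^ (1 / r) := by
        gcongr with k
        rw [add_apply, inner_add_right]
        exact enorm_add_le _ _
    _ ≤ _ := Lp_add_le_tsum hr _ _
    _ ≤ _ := by
        gcongr
        · exact tsum_le_traceAbsPow hX hr hu hv
        · exact tsum_le_traceAbsPow hY hr hu hv

lemma traceAbsPow_comp_le {X : H →L[ℂ] H} (hX : IsCompactOperator X) {r : ℝ} (hr : 1 ≤ r)
    {B C : H →L[ℂ] H} (hB : ‖B‖ ≤ 1) (hC : ‖C‖ ≤ 1) :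
    traceAbsPow r (B * X * C) ≤ traceAbsPow r X := by
  obtain ⟨ι, u, v, hu, hv, h⟩ :=
    exists_traceAbsPow_eq (X := B * X * C) ((hX.clm_comp B).comp_clm C) hr
  rw [h]
  calc _ = ∑' k, ‖⟪B.adjoint (v k), X (C (u k))⟫_ℂ‖ₑ ^ r := by
        refine tsum_congr fun k => ?_
        rw [ContinuousLinearMap.adjoint_inner_left]; rfl
    _ ≤ _ := tsum_le_traceAbsPow hX hr (hu.map C hC) (hv.map B.adjoint (by simpa using hB))

lemma enorm_rpow_le_traceAbsPow {X : H →L[ℂ] H} (hX : IsCompactOperator X) {r : ℝ} (hr : 1 ≤ r) :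
    ‖X‖ₑ ^ r ≤ traceAbsPow r X := by
  have hr0 : 0 < r := by linarith
  rw [← ENNReal.le_rpow_inv_iff hr0]
  rcases eq_or_ne (traceAbsPow r X) ⊤ with ht | ht
  · simp [ht, ENNReal.top_rpow_of_pos (inv_pos.2 hr0)]
  have ht' : traceAbsPow r X ^ r⁻¹ ≠ ⊤ := ENNReal.rpow_ne_top_of_nonneg (by positivity) ht
  rw [← ENNReal.ofReal_toReal ht', ← ofReal_norm]
  refine ENNReal.ofReal_le_ofReal ?_
  refine ContinuousLinearMap.opNorm_le_of_unit_norm (𝕜 := ℂ) ENNReal.toReal_nonneg fun x hx => ?_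
  rw [← ENNReal.ofReal_le_iff_le_toReal ht', ENNReal.le_rpow_inv_iff hr0]
  rcases eq_or_ne (X x) 0 with h0 | h0
  · simp [h0, hr0]
  have hn : ((‖X x‖ : ℝ) : ℂ) ≠ 0 := by exact_mod_cast norm_ne_zero_iff.2 h0
  have hu : IsSubON (fun _ : Unit => x) :=
    isSubON_of_orthonormal ⟨fun _ => hx, fun i j hij => (hij rfl).elim⟩
  have hv : IsSubON (fun _ : Unit => ((‖X x‖ : ℝ) : ℂ)⁻¹ • X x) := by
    refine isSubON_of_orthonormal ⟨fun _ => ?_, fun i j hij => (hij rfl).elim⟩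
    rw [norm_smul, norm_inv, Complex.norm_real, norm_norm,
      inv_mul_cancel₀ (norm_ne_zero_iff.2 h0)]
  refine le_trans (le_of_eq ?_) (tsum_le_traceAbsPow hX hr hu hv)
  have h1 : ⟪((‖X x‖ : ℝ) : ℂ)⁻¹ • X x, X x⟫_ℂ = ((‖X x‖ : ℝ) : ℂ) := by
    rw [inner_smul_left, inner_self_eq_norm_sq_to_K, map_inv₀, Complex.conj_ofReal]
    field_simp
    rfl
  rw [tsum_fintype, Finset.univ_unique, Finset.sum_singleton, h1, ← ofReal_norm,
    Complex.norm_real, norm_norm]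

/-- Membership in the Schatten class: a compact operator `X`, with `Tr |X| ^ p < ⊤` if `p ≠ ⊤`. -/
def MemSchatten (p : ℝ≥0∞) (X : H →L[ℂ] H) : Prop :=
  IsCompactOperator X ∧ (p ≠ ⊤ → traceAbsPow p.toReal X ≠ ⊤)

open Classical in
/-- The Schatten norm: `(Tr |X| ^ p) ^ (1 / p)` if `p ≠ ⊤`, the operator norm if `p = ⊤`. -/
def schattenNorm (p : ℝ≥0∞) (X : H →L[ℂ] H) : ℝ :=
  if p = ⊤ then ‖X‖ else (traceAbsPow p.toReal X).toReal ^ (1 / p.toReal)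


lemma one_le_toReal {p : ℝ≥0∞} (hp : 1 ≤ p) (h : p ≠ ⊤) : 1 ≤ p.toReal := by
  rw [← ENNReal.toReal_one]
  exact (ENNReal.toReal_le_toReal (by simp) h).2 hp

lemma MemSchatten.smul {p : ℝ≥0∞} (hp : 1 ≤ p) {X : H →L[ℂ] H} (hX : MemSchatten p X) (c : ℂ) :
    MemSchatten p (c • X) := by
  refine ⟨hX.1.smul c, fun h => ?_⟩
  have hr := one_le_toReal hp h
  refine ne_top_of_le_ne_top (ENNReal.mul_ne_top ?_ (hX.2 h)) (traceAbsPow_smul_le hX.1 hr c)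
  exact ENNReal.rpow_ne_top_of_nonneg (by linarith) (by simp)

lemma MemSchatten.add {p : ℝ≥0∞} (hp : 1 ≤ p) {X Y : H →L[ℂ] H} (hX : MemSchatten p X)
    (hY : MemSchatten p Y) : MemSchatten p (X + Y) := by
  refine ⟨hX.1.add hY.1, fun h => ?_⟩
  have hr := one_le_toReal hp h
  have h1 := traceAbsPow_add_le hX.1 hY.1 hr
  have h0 : 0 ≤ 1 / p.toReal := by positivity
  have h2 := ne_top_of_le_ne_top (ENNReal.add_ne_top.2
    ⟨ENNReal.rpow_ne_top_of_nonneg h0 (hX.2 h), ENNReal.rpow_ne_top_of_nonneg h0 (hY.2 h)⟩) h1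
  intro ht
  exact h2 (by rw [ht, ENNReal.top_rpow_of_pos (by positivity)])

lemma memSchatten_zero {p : ℝ≥0∞} (hp : 1 ≤ p) : MemSchatten p (0 : H →L[ℂ] H) := by
  refine ⟨isCompactOperator_zero, fun h => ?_⟩
  have hr := one_le_toReal hp h
  have h0 : p.toReal ≠ 0 := by linarith
  have : CFC.abs (0 : H →L[ℂ] H) ^ p.toReal = 0 := by
    rw [CFC.abs_zero]; exact CFC.zero_rpow h0
  rw [traceAbsPow, this]
  simp [posTrace]

lemma MemSchatten.mul_mul {p : ℝ≥0∞} (hp : 1 ≤ p) {X : H →L[ℂ] H} (hX : MemSchatten p X)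
    (B C : H →L[ℂ] H) : MemSchatten p (B * X * C) := by
  have key : ∀ T : H →L[ℂ] H, ∃ (c : ℂ) (T' : H →L[ℂ] H), T = c • T' ∧ ‖T'‖ ≤ 1 := by
    intro T
    rcases eq_or_ne T 0 with rfl | h
    · exact ⟨0, 0, by simp, by simp⟩
    · have hn := norm_ne_zero_iff.2 h
      have hn' : ((‖T‖ : ℝ) : ℂ) ≠ 0 := by exact_mod_cast hn
      refine ⟨((‖T‖ : ℝ) : ℂ), ((‖T‖ : ℝ) : ℂ)⁻¹ • T, ?_, ?_⟩
      · rw [smul_smul, mul_inv_cancel₀ hn', one_smul]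
      · rw [norm_smul, norm_inv, Complex.norm_real, norm_norm, inv_mul_cancel₀ hn]
  obtain ⟨b, B', rfl, hB⟩ := key B
  obtain ⟨c, C', rfl, hC⟩ := key C
  have h1 : MemSchatten p (B' * X * C') :=
    ⟨(hX.1.clm_comp B').comp_clm C', fun h =>
      ne_top_of_le_ne_top (hX.2 h) (traceAbsPow_comp_le hX.1 (one_le_toReal hp h) hB hC)⟩
  have h2 : (b • B') * X * (c • C') = (b * c) • (B' * X * C') := by
    simp [smul_smul, mul_comm]
  rw [h2]
  exact h1.smul hp _

lemma MemSchatten.mul_left {p : ℝ≥0∞} (hp : 1 ≤ p) {X : H →L[ℂ] H} (hX : MemSchatten p X)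
    (B : H →L[ℂ] H) : MemSchatten p (B * X) := by
  simpa using hX.mul_mul hp B 1

variable (H) in
/-- The Schatten class `𝔅_p(H)`, as a subspace of the bounded operators. -/
def schattenSubmodule (p : ℝ≥0∞) [hp : Fact (1 ≤ p)] : Submodule ℂ (H →L[ℂ] H) where
  carrier := {X | MemSchatten p X}
  add_mem' hX hY := MemSchatten.add hp.out hX hY
  zero_mem' := memSchatten_zero hp.out
  smul_mem' c _ hX := MemSchatten.smul hp.out hX c

variable (H) in
/-- The Schatten class `𝔅_p(H)`; it carries the `p`-norm. -/
def SchattenClass (p : ℝ≥0∞) [Fact (1 ≤ p)] : Type _ := schattenSubmodule H p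

namespace SchattenClass

variable {p : ℝ≥0∞} [hp : Fact (1 ≤ p)]

instance : AddCommGroup (SchattenClass H p) := inferInstanceAs (AddCommGroup (schattenSubmodule H p))

instance : Module ℂ (SchattenClass H p) := inferInstanceAs (Module ℂ (schattenSubmodule H p))

/-- The inclusion of the Schatten class in the bounded operators. -/
def toCLM : SchattenClass H p →ₗ[ℂ] (H →L[ℂ] H) := (schattenSubmodule H p).subtype

lemma toCLM_injective : Function.Injective (toCLM : SchattenClass H p → (H →L[ℂ] H)) :=
  (schattenSubmodule H p).subtype_injective

lemma memSchatten (X : SchattenClass H p) : MemSchatten p (toCLM X) := X.2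

/-- An operator of the Schatten class as an element of it. -/
def mk (X : H →L[ℂ] H) (hX : MemSchatten p X) : SchattenClass H p := ⟨X, hX⟩

@[simp] lemma toCLM_mk (X : H →L[ℂ] H) (hX : MemSchatten p X) : toCLM (mk X hX) = X := rfl

instance : Norm (SchattenClass H p) := ⟨fun X => schattenNorm p (toCLM X)⟩

lemma norm_def (X : SchattenClass H p) : ‖X‖ = schattenNorm p (toCLM X) := rfl

lemma norm_smul_le' (c : ℂ) (X : SchattenClass H p) : ‖c • X‖ ≤ ‖c‖ * ‖X‖ := by
  rw [norm_def, norm_def, map_smul]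
  unfold schattenNorm
  split_ifs with h
  · exact (norm_smul _ _).le
  · have hr := one_le_toReal hp.out h
    have hr0 : 0 < p.toReal := by linarith
    have h1 := traceAbsPow_smul_le X.memSchatten.1 hr c
    have h2 : ‖c‖ₑ ^ p.toReal * traceAbsPow p.toReal (toCLM X) ≠ ⊤ :=
      ENNReal.mul_ne_top (ENNReal.rpow_ne_top_of_nonneg hr0.le (by simp)) (X.memSchatten.2 h)
    have h3 := ENNReal.toReal_mono h2 h1
    rw [ENNReal.toReal_mul, ← ENNReal.toReal_rpow, toReal_enorm] at h3
    calc _ ≤ (‖c‖ ^ p.toReal * (traceAbsPow p.toReal (toCLM X)).toReal) ^ (1 / p.toReal) := by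
          gcongr
      _ = _ := by
          rw [Real.mul_rpow (by positivity) (by positivity), ← Real.rpow_mul (by positivity),
            mul_one_div_cancel hr0.ne', Real.rpow_one]

lemma toCLM_norm_le (X : SchattenClass H p) : ‖toCLM X‖ ≤ ‖X‖ := by
  rw [norm_def]
  unfold schattenNorm
  split_ifs with h
  · exact le_rfl
  · have hr := one_le_toReal hp.out h
    have hr0 : 0 < p.toReal := by linarith
    have h1 := ENNReal.toReal_mono (X.memSchatten.2 h) (enorm_rpow_le_traceAbsPow X.memSchatten.1 hr)
    rw [← ENNReal.toReal_rpow, toReal_enorm] at h1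
    calc ‖toCLM X‖ = (‖toCLM X‖ ^ p.toReal) ^ (1 / p.toReal) := by
          rw [← Real.rpow_mul (by positivity), mul_one_div_cancel hr0.ne', Real.rpow_one]
      _ ≤ _ := by gcongr

lemma core : NormedSpace.Core ℂ (SchattenClass H p) where
  norm_nonneg X := (norm_nonneg _).trans (toCLM_norm_le X)
  norm_smul c X := by
    refine le_antisymm (norm_smul_le' c X) ?_
    rcases eq_or_ne c 0 with rfl | hc
    · rw [norm_zero, zero_mul]; exact (norm_nonneg _).trans (toCLM_norm_le _)
    · have h := norm_smul_le' c⁻¹ (c • X)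
      rw [smul_smul, inv_mul_cancel₀ hc, one_smul, norm_inv] at h
      rwa [← le_inv_mul_iff₀ (norm_pos_iff.2 hc)]
  norm_triangle X Y := by
    rw [norm_def, norm_def, norm_def, map_add]
    unfold schattenNorm
    split_ifs with h
    · exact norm_add_le _ _
    · have hr := one_le_toReal hp.out h
      have hr0 : 0 ≤ 1 / p.toReal := by positivity
      have hX := ENNReal.rpow_ne_top_of_nonneg hr0 (X.memSchatten.2 h)
      have hY := ENNReal.rpow_ne_top_of_nonneg hr0 (Y.memSchatten.2 h)
      have h1 := ENNReal.toReal_mono (ENNReal.add_ne_top.2 ⟨hX, hY⟩)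
        (traceAbsPow_add_le X.memSchatten.1 Y.memSchatten.1 hr)
      rwa [ENNReal.toReal_add hX hY, ← ENNReal.toReal_rpow, ← ENNReal.toReal_rpow,
        ← ENNReal.toReal_rpow] at h1
  norm_eq_zero_iff X := by
    constructor
    · intro h
      apply toCLM_injective
      have := toCLM_norm_le X
      rw [h] at this
      rw [norm_le_zero_iff.1 this, map_zero]
    · rintro rfl
      have h := norm_smul_le' 0 (0 : SchattenClass H p)
      rw [smul_zero, norm_zero, zero_mul] at h
      exact le_antisymm h ((norm_nonneg _).trans (toCLM_norm_le _))

instance : NormedAddCommGroup (SchattenClass H p) := NormedAddCommGroup.ofCore core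

instance : NormedSpace ℂ (SchattenClass H p) := NormedSpace.ofCore core

end SchattenClass

end Schatten

section Grassmannian

variable {H : Type*} [NormedAddCommGroup H] [InnerProductSpace ℂ H] [CompleteSpace H]

/-- `B` is symmetric for the inner product `[f, g] = ⟨A f, g⟩`, that is `B* A = A B`. -/
def IsASymm (A B : H →L[ℂ] H) : Prop := B.adjoint * A = A * B

/-- `B` is anti-symmetric for the inner product `[f, g] = ⟨A f, g⟩`, that is `B* A = -A B`. -/
def IsAAntisymm (A B : H →L[ℂ] H) : Prop := B.adjoint * A = -(A * B)

lemma IsASymm.sub {A B C : H →L[ℂ] H} (hB : IsASymm A B) (hC : IsASymm A C) :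
    IsASymm A (B - C) := by
  unfold IsASymm at *
  rw [map_sub, sub_mul, mul_sub, hB, hC]

/-- The compatible Grassmannian `Gr_A`: a compatible subspace is identified with the unique
`A`-symmetric idempotent of which it is the range. -/
def CompatibleGrassmannian (A : H →L[ℂ] H) : Type _ :=
  {Q : H →L[ℂ] H // Q * Q = Q ∧ IsASymm A Q}

/-- The idempotent of a point of the compatible Grassmannian. -/
def CompatibleGrassmannian.proj {A : H →L[ℂ] H} (Q : CompatibleGrassmannian A) : H →L[ℂ] H := Q.1

lemma adjoint_real_smul (c : ℝ) (X : H →L[ℂ] H) : (c • X).adjoint = c • X.adjoint := by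
  rw [← ContinuousLinearMap.star_eq_adjoint, ← ContinuousLinearMap.star_eq_adjoint, star_smul]
  simp

variable (A : H →L[ℂ] H) (p : ENNReal) [hp : Fact (1 ≤ p)]

/-- The real space `𝔤_p` of `A`-anti-symmetric operators of the Schatten class, with the
`p`-norm. -/
def antisymmSchatten : Submodule ℝ (SchattenClass H p) where
  carrier := {X | IsAAntisymm A (SchattenClass.toCLM X)}
  add_mem' {X Y} hX hY := by
    simp only [Set.mem_ofPred_eq, IsAAntisymm, map_add, add_mul, mul_add] at *
    rw [hX, hY, neg_add]
  zero_mem' := by simp [IsAAntisymm]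
  smul_mem' c X hX := by
    have h : SchattenClass.toCLM (c • X) = c • SchattenClass.toCLM X :=
      (SchattenClass.toCLM (H := H) (p := p)).map_smul_of_tower c X
    simp only [Set.mem_ofPred_eq, IsAAntisymm] at *
    rw [h, adjoint_real_smul, smul_mul_assoc, mul_smul_comm, hX, smul_neg]

/-- The real space `i 𝔤_p` of `A`-symmetric operators of the Schatten class, with the `p`-norm. -/
def symmSchatten : Submodule ℝ (SchattenClass H p) where
  carrier := {X | IsASymm A (SchattenClass.toCLM X)}
  add_mem' {X Y} hX hY := by
    simp only [Set.mem_ofPred_eq, IsASymm, map_add, add_mul, mul_add] at *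
    rw [hX, hY]
  zero_mem' := by simp [IsASymm]
  smul_mem' c X hX := by
    have h : SchattenClass.toCLM (c • X) = c • SchattenClass.toCLM X :=
      (SchattenClass.toCLM (H := H) (p := p)).map_smul_of_tower c X
    simp only [Set.mem_ofPred_eq, IsASymm] at *
    rw [h, adjoint_real_smul, smul_mul_assoc, mul_smul_comm, hX]

/-- `symmSchatten A p` is `i 𝔤_p`. -/
lemma I_smul_mem_symmSchatten_iff (X : SchattenClass H p) :
    Complex.I • X ∈ symmSchatten A p ↔ X ∈ antisymmSchatten A p := by
  change IsASymm A _ ↔ IsAAntisymm A _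
  unfold IsASymm IsAAntisymm
  rw [map_smul, ← ContinuousLinearMap.star_eq_adjoint, ← ContinuousLinearMap.star_eq_adjoint,
    star_smul, smul_mul_assoc, mul_smul_comm]
  have : star Complex.I = -Complex.I := Complex.conj_I
  rw [this, neg_smul, ← smul_neg, (IsUnit.mk0 _ Complex.I_ne_zero).smul_left_cancel, neg_eq_iff_eq_neg]

/-- The group `𝒢_A` of the invertible operators `G` with `G* A G = A`. -/
def aUnitaryGroup : Subgroup (H →L[ℂ] H)ˣ where
  carrier := {G | (G : H →L[ℂ] H).adjoint * A * (G : H →L[ℂ] H) = A}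
  mul_mem' {G K} hG hK := by
    simp only [Set.mem_ofPred_eq, ← ContinuousLinearMap.star_eq_adjoint] at *
    rw [Units.val_mul, star_mul]
    calc _ = star (K : H →L[ℂ] H) * (star (G : H →L[ℂ] H) * A * (G : H →L[ℂ] H)) * K := by
          simp only [mul_assoc]
      _ = A := by rw [hG, hK]
  one_mem' := by simp [← ContinuousLinearMap.star_eq_adjoint]
  inv_mem' {G} hG := by
    simp only [Set.mem_ofPred_eq, ← ContinuousLinearMap.star_eq_adjoint] at *
    calc _ = star (↑G⁻¹ : H →L[ℂ] H) * (star (G : H →L[ℂ] H) * A * (G : H →L[ℂ] H)) *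
          (↑G⁻¹ : H →L[ℂ] H) := by rw [hG]
      _ = star ((G : H →L[ℂ] H) * ↑G⁻¹) * A * ((G : H →L[ℂ] H) * ↑G⁻¹) := by
          rw [star_mul]; simp only [mul_assoc]
      _ = A := by simp

/-- The group `𝒢_{p,A}` of the `G ∈ 𝒢_A` with `G - 1` in the Schatten class, as a subgroup of the
group of invertible operators. -/
def restrictedSubgroup : Subgroup (H →L[ℂ] H)ˣ where
  carrier := {G | G ∈ aUnitaryGroup A ∧ MemSchatten p ((G : H →L[ℂ] H) - 1)}
  mul_mem' {G K} hG hK := by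
    refine ⟨mul_mem hG.1 hK.1, ?_⟩
    have h : ((G * K : (H →L[ℂ] H)ˣ) : H →L[ℂ] H) - 1 =
        (G : H →L[ℂ] H) * ((K : H →L[ℂ] H) - 1) + ((G : H →L[ℂ] H) - 1) := by
      rw [Units.val_mul, mul_sub, mul_one]; abel
    rw [h]
    exact (hK.2.mul_left hp.out _).add hp.out hG.2
  one_mem' := ⟨one_mem _, by simpa using memSchatten_zero hp.out⟩
  inv_mem' {G} hG := by
    refine ⟨inv_mem hG.1, ?_⟩
    have h : ((G⁻¹ : (H →L[ℂ] H)ˣ) : H →L[ℂ] H) - 1 =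
        (-(↑G⁻¹ : H →L[ℂ] H)) * ((G : H →L[ℂ] H) - 1) := by
      rw [mul_sub, neg_mul, Units.inv_mul, mul_one]; abel
    rw [h]
    exact hG.2.mul_left hp.out _

/-- The group `𝒢_{p,A}`; it carries the metric `‖G - K‖_p`. -/
def RestrictedGroup : Type _ := restrictedSubgroup A p

namespace RestrictedGroup

instance : Group (RestrictedGroup A p) := inferInstanceAs (Group (restrictedSubgroup A p))

variable {A p}

/-- The operator underlying an element of `𝒢_{p,A}`. -/
def toCLM (G : RestrictedGroup A p) : H →L[ℂ] H := ((G.1 : (H →L[ℂ] H)ˣ) : H →L[ℂ] H)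

@[simp] lemma toCLM_one : (1 : RestrictedGroup A p).toCLM = 1 := rfl

@[simp] lemma toCLM_mul (G K : RestrictedGroup A p) : (G * K).toCLM = G.toCLM * K.toCLM := rfl

lemma memSchatten (G : RestrictedGroup A p) : MemSchatten p (G.toCLM - 1) := G.2.2

/-- `G - 1`, as an element of the Schatten class. -/
def subOne (G : RestrictedGroup A p) : SchattenClass H p :=
  SchattenClass.mk (G.toCLM - 1) G.memSchatten

lemma subOne_injective : Function.Injective (subOne : RestrictedGroup A p → SchattenClass H p) := by
  intro G K h
  have h1 := congrArg SchattenClass.toCLM h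
  simp only [subOne, SchattenClass.toCLM_mk, sub_left_inj] at h1
  exact Subtype.ext (Units.ext h1)

instance : MetricSpace (RestrictedGroup A p) :=
  MetricSpace.induced subOne subOne_injective inferInstance

lemma dist_eq (G K : RestrictedGroup A p) : dist G K = schattenNorm p (G.toCLM - K.toCLM) := by
  have h : dist G K = ‖G.subOne - K.subOne‖ := dist_eq_norm G.subOne K.subOne
  rw [h, SchattenClass.norm_def, map_sub]
  simp [subOne]

end RestrictedGroup

/-- The restricted compatible Grassmannian `Gr_{res,p}` of the `Q ∈ Gr_A` with `Q - Q₀` in the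
Schatten class; it carries the metric `‖Q - R‖_p`. -/
def RestrictedGrassmannian (Q₀ : CompatibleGrassmannian A) : Type _ :=
  {Q : CompatibleGrassmannian A // MemSchatten p (Q.proj - Q₀.proj)}

namespace RestrictedGrassmannian

variable {A p} {Q₀ : CompatibleGrassmannian A}

/-- The idempotent of a point of the restricted compatible Grassmannian. -/
def proj (Q : RestrictedGrassmannian A p Q₀) : H →L[ℂ] H := Q.1.proj

lemma memSchatten (Q : RestrictedGrassmannian A p Q₀) : MemSchatten p (Q.proj - Q₀.proj) := Q.2

lemma isASymm_sub (Q : RestrictedGrassmannian A p Q₀) : IsASymm A (Q.proj - Q₀.proj) :=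
  Q.1.2.2.sub Q₀.2.2

/-- `Q - Q₀ ∈ i 𝔤_p`. This is the inclusion of `Gr_{res,p}` in the affine space `Q₀ + i 𝔤_p`, which
is identified with its translation space `i 𝔤_p`. -/
def sub (Q : RestrictedGrassmannian A p Q₀) : symmSchatten A p :=
  ⟨SchattenClass.mk (Q.proj - Q₀.proj) Q.memSchatten, Q.isASymm_sub⟩

lemma sub_injective :
    Function.Injective (sub : RestrictedGrassmannian A p Q₀ → symmSchatten A p) := by
  intro Q R h
  have h1 := congrArg (fun X : symmSchatten A p => SchattenClass.toCLM X.1) h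
  simp only [sub, SchattenClass.toCLM_mk, sub_left_inj] at h1
  exact Subtype.ext (Subtype.ext h1)

instance : MetricSpace (RestrictedGrassmannian A p Q₀) :=
  MetricSpace.induced sub sub_injective inferInstance

lemma dist_eq (Q R : RestrictedGrassmannian A p Q₀) :
    dist Q R = schattenNorm p (Q.proj - R.proj) := by
  have h : dist Q R = ‖Q.sub - R.sub‖ := dist_eq_norm Q.sub R.sub
  rw [h, Submodule.coe_norm, SchattenClass.norm_def, Submodule.coe_sub, map_sub]
  simp [sub]

end RestrictedGrassmannian

end Grassmannian

/-- A complemented `C^∞` submanifold of a real normed space: near each of its points there is a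
`C^∞` diffeomorphism between open sets of the space that straightens it to a closed complemented
linear subspace. -/
def IsComplementedSubmanifold {E : Type*} [NormedAddCommGroup E] [NormedSpace ℝ E] (M : Set E) :
    Prop :=
  ∀ x ∈ M, ∃ (F : Submodule ℝ E) (φ : OpenPartialHomeomorph E E),
    F.ClosedComplemented ∧ x ∈ φ.source ∧
    ContDiffOn ℝ ∞ φ φ.source ∧ ContDiffOn ℝ ∞ φ.symm φ.target ∧
    ∀ y ∈ φ.source, y ∈ M ↔ φ y ∈ F

end

end CompGr

namespace CompGr

noncomputable section

open scoped ENNReal NNReal InnerProductSpace Topology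
open Filter Set SchattenClass Topology RestrictedGroup

/-! ### Completeness of the Schatten classes and their bounded bimodule structure -/

section SchattenAnalysis

variable {H : Type u} [NormedAddCommGroup H] [InnerProductSpace ℂ H] [CompleteSpace H]

/-! The form ⟨A x, y⟩ is a positive definite inner product for which H need not be complete; 𝔤_p
consists of operators anti-symmetric for it, 𝒢_{p,A} of operators unitary for it. An anti-symmetric
X has no nonzero real eigenvalue: X x = c x gives 2 c ⟨A x, x⟩ = 0, hence x = 0. Schatten operators
are compact, so the Fredholm alternative makes 1 + X and 1 - X invertible for every X in 𝔤_p
(`isUnit_one_sub_of_isAAntisymm`). Hence the Cayley transform X ↦ (1 + X) (1 - X)⁻¹ is defined on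
all of 𝔤_p, and its inverse, translated from the left, gives an atlas of the group. In these charts
the maps are algebraic expressions with a Schatten factor in each term and bounded operators
elsewhere. They are smooth because multiplication of Schatten operators by bounded ones is bounded
bilinear and inversion of bounded operators is smooth.

The same transform straightens the Grassmannian near Q₁. Put ε = 2 Q₁ - 1, w = 2 (Q - Q₁) and X = w
(2 + ε w)⁻¹. Then Q is idempotent iff ε + w is an involution, iff ε X + X ε = 0
(`add_mul_self_eq_one_iff`). This is a linear condition, and X ↦ (X - ε X ε) / 2 projects onto its
solutions. For a solution X the operator ε X is anti-symmetric, so the inverse transform is defined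
on the whole solution space. The chart domain is therefore connected and lies in the component of
Q₁; so components are open, and each is locally cut out by the same linear condition.

The orbit map G ↦ G Q₁ G⁻¹ has differential Y ↦ Y ε - ε Y at 1, with bounded right inverse X ↦ X ε /
2. The inverse function theorem on 𝔤_p turns it into a projection near 1 (`exists_orbit_chart`), and
equivariance carries this to every G. Orbits are therefore open, hence clopen, so each contains the
component of its points. It stays inside that component because the group is connected
(`preconnectedSpace_restrictedGroup`): a G without eigenvalue -1 is a Cayley transform, and a
general G is joined to such an element by rotating its finite-dimensional eigenspace for -1. By
transitivity all charts of a component can be taken as translates of the one at Q₁, with a single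
model space. -/

lemma traceAbsPow_le_of_tendsto {X : ℕ → H →L[ℂ] H} {T : H →L[ℂ] H}
    (hX : ∀ n, IsCompactOperator (X n)) (hT : Tendsto X atTop (𝓝 T)) {r : ℝ} (hr : 1 ≤ r)
    {C : ℝ≥0∞} (hC : ∀ᶠ n in atTop, traceAbsPow r (X n) ≤ C) : traceAbsPow r T ≤ C := by
  have hTc : IsCompactOperator T := isCompactOperator_of_tendsto hT (Eventually.of_forall hX)
  -- These Bessel families attain the trace for the limit T and bound it from below for each `X n`.
  -- A finite partial sum is continuous in the operator norm, so the bound `C` passes to the limit.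
  obtain ⟨ι, u, v, hu, hv, h⟩ := exists_traceAbsPow_eq hTc hr
  rw [h, ENNReal.tsum_eq_iSup_sum]
  refine iSup_le fun t => ?_
  have hlim : Tendsto (fun n => ∑ k ∈ t, ‖⟪v k, X n (u k)⟫_ℂ‖ₑ ^ r) atTop
      (𝓝 (∑ k ∈ t, ‖⟪v k, T (u k)⟫_ℂ‖ₑ ^ r)) := by
    refine tendsto_finsetSum _ fun k _ => ?_
    have h1 : Continuous fun S : H →L[ℂ] H => ‖⟪v k, S (u k)⟫_ℂ‖ₑ ^ r :=
      ENNReal.continuous_rpow_const.comp (by fun_prop)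
    exact (h1.tendsto T).comp hT
  refine le_of_tendsto hlim ?_
  filter_upwards [hC] with n hn
  exact (ENNReal.sum_le_tsum t).trans ((tsum_le_traceAbsPow (hX n) hr hu hv).trans hn)

variable {p : ℝ≥0∞} [hp : Fact (1 ≤ p)]

namespace SchattenClass

lemma traceAbsPow_toCLM (h : p ≠ ⊤) (X : SchattenClass H p) :
    traceAbsPow p.toReal (toCLM X) = ENNReal.ofReal (‖X‖ ^ p.toReal) := by
  have hr := one_le_toReal hp.out h
  rw [norm_def, schattenNorm, if_neg h, ← Real.rpow_mul ENNReal.toReal_nonneg,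
    one_div_mul_cancel (by linarith), Real.rpow_one, ENNReal.ofReal_toReal (X.memSchatten.2 h)]

/-- The p-norm dominates the operator norm, so a Cauchy sequence has a compact limit T in operator
norm. Lower semicontinuity of the trace then gives both membership of T and convergence in the
p-norm. -/
instance : CompleteSpace (SchattenClass H p) := by
  refine Metric.complete_of_cauchySeq_tendsto fun X hX => ?_
  have hsub : ∀ m n, toCLM (X m - X n) = toCLM (X m) - toCLM (X n) := fun m n => map_sub _ _ _
  have hX' : CauchySeq fun n => toCLM (X n) := by
    refine Metric.cauchySeq_iff.2 fun ε hε => ?_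
    obtain ⟨N, hN⟩ := Metric.cauchySeq_iff.1 hX ε hε
    refine ⟨N, fun m hm n hn => ?_⟩
    rw [dist_eq_norm, ← hsub]
    exact (toCLM_norm_le _).trans_lt (by simpa [dist_eq_norm] using hN m hm n hn)
  obtain ⟨T, hT⟩ := cauchySeq_tendsto_of_complete hX'
  have hTc : IsCompactOperator T :=
    isCompactOperator_of_tendsto hT (Eventually.of_forall fun n => (X n).memSchatten.1)
  by_cases h : p = ⊤
  · have hmem : MemSchatten p T := ⟨hTc, fun h' => (h' h).elim⟩
    refine ⟨mk T hmem, ?_⟩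
    rw [tendsto_iff_norm_sub_tendsto_zero] at hT ⊢
    refine hT.congr fun n => ?_
    rw [norm_def, schattenNorm, if_pos h, map_sub, toCLM_mk]
  · have hr := one_le_toReal hp.out h
    have hr0 : 0 < p.toReal := by linarith
    -- The Cauchy estimate for X m - X n with n fixed, in the limit m → ∞.
    have key : ∀ ε > 0, ∃ N, ∀ n ≥ N,
        traceAbsPow p.toReal (T - toCLM (X n)) ≤ ENNReal.ofReal (ε ^ p.toReal) := by
      intro ε hε
      obtain ⟨N, hN⟩ := Metric.cauchySeq_iff.1 hX ε hε
      refine ⟨N, fun n hn => ?_⟩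
      refine traceAbsPow_le_of_tendsto (X := fun m => toCLM (X m) - toCLM (X n))
        (fun m => (X m).memSchatten.1.sub (X n).memSchatten.1) (hT.sub_const _) hr ?_
      filter_upwards [eventually_ge_atTop N] with m hm
      rw [← hsub, traceAbsPow_toCLM h]
      have h1 := hN m hm n hn
      rw [dist_eq_norm] at h1
      gcongr
    have hmem : MemSchatten p T := by
      obtain ⟨N, hN⟩ := key 1 one_pos
      have h1 : MemSchatten p (T - toCLM (X N)) :=
        ⟨hTc.sub (X N).memSchatten.1, fun _ => ne_top_of_le_ne_top (by simp) (hN N le_rfl)⟩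
      simpa using h1.add hp.out (X N).memSchatten
    refine ⟨mk T hmem, Metric.tendsto_atTop.2 fun ε hε => ?_⟩
    obtain ⟨N, hN⟩ := key (ε / 2) (half_pos hε)
    refine ⟨N, fun n hn => ?_⟩
    have h1 := hN n hn
    have h2 : T - toCLM (X n) = toCLM (mk T hmem - X n) := by rw [map_sub, toCLM_mk]
    rw [h2, traceAbsPow_toCLM h, ENNReal.ofReal_le_ofReal_iff (by positivity),
      Real.rpow_le_rpow_iff (norm_nonneg _) (by positivity) hr0] at h1
    rw [dist_comm, dist_eq_norm]
    linarith

lemma norm_mul_mul_le_of_le_one {B C : H →L[ℂ] H} (hB : ‖B‖ ≤ 1) (hC : ‖C‖ ≤ 1)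
    (X : SchattenClass H p) :
    ‖mk (B * toCLM X * C) (X.memSchatten.mul_mul hp.out B C)‖ ≤ ‖X‖ := by
  rw [norm_def, norm_def, toCLM_mk]
  unfold schattenNorm
  split_ifs with h
  · calc ‖B * toCLM X * C‖ ≤ ‖B‖ * ‖toCLM X‖ * ‖C‖ := by
          grw [norm_mul_le, norm_mul_le]
      _ ≤ 1 * ‖toCLM X‖ * 1 := by gcongr
      _ = _ := by simp
  · have hr := one_le_toReal hp.out h
    have h1 := ENNReal.toReal_mono (X.memSchatten.2 h) (traceAbsPow_comp_le X.memSchatten.1 hr hB hC)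
    gcongr

lemma norm_mul_mul_le (B C : H →L[ℂ] H) (X : SchattenClass H p) :
    ‖mk (B * toCLM X * C) (X.memSchatten.mul_mul hp.out B C)‖ ≤ ‖B‖ * ‖C‖ * ‖X‖ := by
  have key : ∀ T : H →L[ℂ] H, ∃ T' : H →L[ℂ] H, T = ((‖T‖ : ℝ) : ℂ) • T' ∧ ‖T'‖ ≤ 1 := by
    intro T
    rcases eq_or_ne T 0 with rfl | h
    · exact ⟨0, by simp, by simp⟩
    · have hn := norm_ne_zero_iff.2 h
      have hn' : ((‖T‖ : ℝ) : ℂ) ≠ 0 := by exact_mod_cast hn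
      refine ⟨((‖T‖ : ℝ) : ℂ)⁻¹ • T, ?_, ?_⟩
      · rw [smul_smul, mul_inv_cancel₀ hn', one_smul]
      · rw [norm_smul, norm_inv, Complex.norm_real, norm_norm, inv_mul_cancel₀ hn]
  obtain ⟨B', hB, hB'⟩ := key B
  obtain ⟨C', hC, hC'⟩ := key C
  have h : mk (B * toCLM X * C) (X.memSchatten.mul_mul hp.out B C) =
      (((‖B‖ : ℝ) : ℂ) * ((‖C‖ : ℝ) : ℂ)) •
        mk (B' * toCLM X * C') (X.memSchatten.mul_mul hp.out B' C') := by
    apply toCLM_injective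
    rw [map_smul, toCLM_mk, toCLM_mk]
    conv_lhs => rw [hB, hC]
    rw [smul_mul_assoc, smul_mul_assoc, mul_smul_comm, smul_smul]
  rw [h, norm_smul, norm_mul, Complex.norm_real, Complex.norm_real, norm_norm, norm_norm]
  gcongr
  exact norm_mul_mul_le_of_le_one hB' hC' X

lemma toCLM_real_smul (c : ℝ) (X : SchattenClass H p) : toCLM (c • X) = c • toCLM X :=
  (toCLM (H := H) (p := p)).map_smul_of_tower c X

variable (H p) in
/-- The inclusion of the Schatten class, as a continuous real-linear map. -/
def incl : SchattenClass H p →L[ℝ] (H →L[ℂ] H) :=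
  LinearMap.mkContinuous
    { toFun := fun X => toCLM X
      map_add' := fun X Y => map_add _ X Y
      map_smul' := fun c X => toCLM_real_smul c X } 1
    (fun X => by simpa using toCLM_norm_le X)

@[simp] lemma incl_apply (X : SchattenClass H p) : incl H p X = toCLM X := rfl

variable (H p) in
/-- Multiplication `(a, X) ↦ a X` of Schatten operators by bounded operators from the left. -/
def lmul : (H →L[ℂ] H) →L[ℝ] SchattenClass H p →L[ℝ] SchattenClass H p :=
  LinearMap.mkContinuous₂
    (LinearMap.mk₂ ℝ (fun a X => mk (a * toCLM X) (X.memSchatten.mul_left hp.out a))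
      (fun a b X => toCLM_injective (by simp [add_mul]))
      (fun c a X => toCLM_injective (by simp))
      (fun a X Y => toCLM_injective (by simp [mul_add]))
      (fun c a X => toCLM_injective (by simp))) 1
    (fun a X => by
      have h := norm_mul_mul_le a 1 X
      simp only [mul_one] at h
      have h1 : ‖(1 : H →L[ℂ] H)‖ ≤ 1 := ContinuousLinearMap.norm_id_le
      calc _ ≤ ‖a‖ * ‖(1 : H →L[ℂ] H)‖ * ‖X‖ := h
        _ ≤ ‖a‖ * 1 * ‖X‖ := by gcongr
        _ = _ := by ring)

@[simp] lemma toCLM_lmul (a : H →L[ℂ] H) (X : SchattenClass H p) :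
    toCLM (lmul H p a X) = a * toCLM X := rfl

lemma memSchatten_mul_right (X : SchattenClass H p) (a : H →L[ℂ] H) :
    MemSchatten p (toCLM X * a) := by
  simpa using X.memSchatten.mul_mul hp.out 1 a

variable (H p) in
/-- Multiplication `(a, X) ↦ X a` of Schatten operators by bounded operators from the right. -/
def rmul : (H →L[ℂ] H) →L[ℝ] SchattenClass H p →L[ℝ] SchattenClass H p :=
  LinearMap.mkContinuous₂
    (LinearMap.mk₂ ℝ (fun a X => mk (toCLM X * a) (X.memSchatten_mul_right a))
      (fun a b X => toCLM_injective (by simp [mul_add]))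
      (fun c a X => toCLM_injective (by simp))
      (fun a X Y => toCLM_injective (by simp [add_mul]))
      (fun c a X => toCLM_injective (by simp))) 1
    (fun a X => by
      have h := norm_mul_mul_le 1 a X
      simp only [one_mul] at h
      have h1 : ‖(1 : H →L[ℂ] H)‖ ≤ 1 := ContinuousLinearMap.norm_id_le
      calc _ ≤ ‖(1 : H →L[ℂ] H)‖ * ‖a‖ * ‖X‖ := h
        _ ≤ 1 * ‖a‖ * ‖X‖ := by gcongr
        _ = _ := by ring)

@[simp] lemma toCLM_rmul (a : H →L[ℂ] H) (X : SchattenClass H p) :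
    toCLM (rmul H p a X) = toCLM X * a := rfl

end SchattenClass

variable (A : H →L[ℂ] H)

lemma isClosed_antisymmSchatten : IsClosed (antisymmSchatten A p : Set (SchattenClass H p)) := by
  have h : Continuous fun X : SchattenClass H p => (toCLM X).adjoint * A :=
    (ContinuousLinearMap.adjoint.continuous.comp (incl H p).continuous).mul continuous_const
  have h' : Continuous fun X : SchattenClass H p => -(A * toCLM X) :=
    (continuous_const.mul (incl H p).continuous).neg
  exact isClosed_eq h h'

lemma isClosed_symmSchatten : IsClosed (symmSchatten A p : Set (SchattenClass H p)) := by
  have h : Continuous fun X : SchattenClass H p => (toCLM X).adjoint * A :=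
    (ContinuousLinearMap.adjoint.continuous.comp (incl H p).continuous).mul continuous_const
  have h' : Continuous fun X : SchattenClass H p => A * toCLM X :=
    continuous_const.mul (incl H p).continuous
  exact isClosed_eq h h'

instance : CompleteSpace (antisymmSchatten A p) :=
  (isClosed_antisymmSchatten A).completeSpace_coe

instance : CompleteSpace (symmSchatten A p) :=
  (isClosed_symmSchatten A).completeSpace_coe

end SchattenAnalysis

/-! ### Smoothness of maps into closed subspaces -/

section ClosedIsometry

variable {E V W : Type u} [NormedAddCommGroup E] [NormedSpace ℝ E]
  [NormedAddCommGroup V] [NormedSpace ℝ V] [NormedAddCommGroup W] [NormedSpace ℝ W]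

lemma hasFDerivAt_of_linearIsometry_comp (i : V →ₗᵢ[ℝ] W) {f : E → V} {f' : E →L[ℝ] V} {x : E}
    (h : HasFDerivAt (fun y => i (f y)) (i.toContinuousLinearMap.comp f') x) :
    HasFDerivAt f f' x := by
  rw [hasFDerivAt_iff_isLittleO] at h ⊢
  refine (h.norm_left.congr_left fun y => ?_).of_norm_left
  have h1 : i (f y) - i (f x) - (i.toContinuousLinearMap.comp f') (y - x) =
      i (f y - f x - f' (y - x)) := by simp
  rw [h1, i.norm_map]

/-- A directional derivative is a limit of difference quotients, which lie in the range of i.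
Completeness of V makes this range closed, so the derivative factors through i. -/
lemma HasFDerivAt.exists_of_linearIsometry_comp [CompleteSpace V] (i : V →ₗᵢ[ℝ] W) {f : E → V}
    {g' : E →L[ℝ] W} {x : E} (h : HasFDerivAt (fun y => i (f y)) g' x) :
    ∃ f' : E →L[ℝ] V, i.toContinuousLinearMap.comp f' = g' := by
  have hcl : IsClosed (range i) := i.isometry.isClosedEmbedding.isClosed_range
  have hmem : ∀ v, g' v ∈ range i := by
    intro v
    have hd : HasDerivAt (fun t : ℝ => i (f (x + t • v))) (g' v) 0 := by
      have h1 : HasDerivAt (fun t : ℝ => x + t • v) v 0 := by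
        simpa using ((hasDerivAt_id (0 : ℝ)).smul_const v).const_add x
      have h2 : HasFDerivAt (fun y => i (f y)) g' (x + (0 : ℝ) • v) := by simpa using h
      exact h2.comp_hasDerivAt (0 : ℝ) h1
    have h3 := range_deriv_subset_closure_span_image (fun t : ℝ => i (f (x + t • v)))
      (dense_univ (X := ℝ)) (mem_range_self (0 : ℝ))
    rw [hd.deriv] at h3
    have hspan : (Submodule.span ℝ ((fun t : ℝ => i (f (x + t • v))) '' univ) : Set W) ⊆
        range i := by
      have : Submodule.span ℝ ((fun t : ℝ => i (f (x + t • v))) '' univ) ≤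
          LinearMap.range i.toLinearMap := by
        rw [Submodule.span_le]
        rintro _ ⟨t, -, rfl⟩
        exact ⟨_, rfl⟩
      exact this
    exact hcl.closure_subset_iff.2 hspan h3
  let e := i.equivRange
  let R : Submodule ℝ W := LinearMap.range i.toLinearMap
  refine ⟨(e.symm.toContinuousLinearEquiv : _ →L[ℝ] V).comp (g'.codRestrict R hmem), ?_⟩
  ext v
  exact congrArg Subtype.val (e.apply_symm_apply ⟨g' v, hmem v⟩)

/-- The induction runs over all V, W and i at once, since the inductive step passes to the
derivative, a map into `E →L[ℝ] V`, on which composition with i is again a linear isometry. A common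
universe keeps these spaces within the quantifier. -/
lemma contDiffOn_nat_of_linearIsometry_comp {s : Set E} (hs : IsOpen s) (n : ℕ) :
    ∀ (V W : Type u) [NormedAddCommGroup V] [NormedSpace ℝ V] [CompleteSpace V]
      [NormedAddCommGroup W] [NormedSpace ℝ W] (i : V →ₗᵢ[ℝ] W) (f : E → V),
      ContDiffOn ℝ n (fun y => i (f y)) s → ContDiffOn ℝ n f s := by
  induction n with
  | zero =>
    intro V W _ _ _ _ _ i f h
    simp only [Nat.cast_zero, contDiffOn_zero] at h ⊢
    exact i.isometry.isEmbedding.continuousOn_iff.2 h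
  | succ n ih =>
    intro V W _ _ _ _ _ i f h
    push_cast at h ⊢
    rw [contDiffOn_succ_iff_fderiv_of_isOpen hs] at h ⊢
    have key : ∀ x ∈ s, HasFDerivAt f (fderiv ℝ f x) x := by
      intro x hx
      have h1 := ((h.1 x hx).differentiableAt (hs.mem_nhds hx)).hasFDerivAt
      obtain ⟨f', hf'⟩ := HasFDerivAt.exists_of_linearIsometry_comp i h1
      rw [← hf'] at h1
      exact (hasFDerivAt_of_linearIsometry_comp i h1).differentiableAt.hasFDerivAt
    refine ⟨fun x hx => (key x hx).differentiableAt.differentiableWithinAt, by simp, ?_⟩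
    refine ih _ _ (i.postcomp (E := E)) _ (h.2.2.congr fun x hx => ?_)
    exact (i.toContinuousLinearMap.hasFDerivAt.comp x (key x hx)).fderiv.symm

/-- Smoothness of a map into a complete subspace can be tested in the ambient space. -/
lemma contDiffOn_of_linearIsometry_comp [CompleteSpace V] (i : V →ₗᵢ[ℝ] W) {s : Set E}
    (hs : IsOpen s) {f : E → V} (h : ContDiffOn ℝ ∞ (fun y => i (f y)) s) : ContDiffOn ℝ ∞ f s := by
  rw [contDiffOn_infty] at h ⊢
  exact fun n => contDiffOn_nat_of_linearIsometry_comp hs n V W i f (h n)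

lemma contMDiffOn_of_linearIsometry_comp [CompleteSpace V] (i : V →ₗᵢ[ℝ] W)
    {H' : Type*} [TopologicalSpace H'] {I' : ModelWithCorners ℝ E H'} [I'.Boundaryless]
    {N : Type*} [TopologicalSpace N] [ChartedSpace H' N] [IsManifold I' ∞ N] {s : Set N}
    (hs : IsOpen s) {f : N → V} (h : ContMDiffOn I' 𝓘(ℝ, W) ∞ (fun y => i (f y)) s) :
    ContMDiffOn I' 𝓘(ℝ, V) ∞ f s := by
  intro x hx
  refine ContMDiffAt.contMDiffWithinAt ?_
  let e := extChartAt I' x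
  have hS : IsOpen (e.target ∩ e.symm ⁻¹' s) :=
    (continuousOn_extChartAt_symm x).isOpen_inter_preimage (isOpen_extChartAt_target x) hs
  have h1 : ContMDiffOn 𝓘(ℝ, E) 𝓘(ℝ, W) ∞ (fun y => i (f (e.symm y)))
      (e.target ∩ e.symm ⁻¹' s) :=
    h.comp ((contMDiffOn_extChartAt_symm x).mono inter_subset_left) fun y hy => hy.2
  have h2 := contDiffOn_of_linearIsometry_comp i (f := fun y => f (e.symm y)) hS h1.contDiffOn
  have hex : e x ∈ e.target ∩ e.symm ⁻¹' s := by
    refine ⟨mem_extChartAt_target x, ?_⟩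
    rw [mem_preimage, extChartAt_to_inv]
    exact hx
  have h3 : ContMDiffAt I' 𝓘(ℝ, V) ∞ (fun y => f (e.symm (e y))) x :=
    ((h2.contDiffAt (hS.mem_nhds hex)).contMDiffAt).comp x contMDiffAt_extChartAt
  refine h3.congr_of_eventuallyEq ?_
  filter_upwards [extChartAt_source_mem_nhds (I := I') x] with y hy
  rw [e.left_inv hy]

end ClosedIsometry

/-! ### A smooth inverse function theorem -/

section InverseFunction

variable {E F : Type*} [NormedAddCommGroup E] [NormedSpace ℝ E] [CompleteSpace E]
  [NormedAddCommGroup F] [NormedSpace ℝ F]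

/-- The inverse function theorem, with smoothness on the whole domain of the local inverse. -/
lemma exists_smooth_openPartialHomeomorph {f : E → F} {U : Set E} (hU : IsOpen U) {a : E}
    (ha : a ∈ U) (hf : ContDiffOn ℝ ∞ f U) {f' : E ≃L[ℝ] F}
    (hf' : HasFDerivAt f (f' : E →L[ℝ] F) a) :
    ∃ φ : OpenPartialHomeomorph E F, a ∈ φ.source ∧ φ.source ⊆ U ∧ (∀ x, φ x = f x) ∧
      ContDiffOn ℝ ∞ φ φ.source ∧ ContDiffOn ℝ ∞ φ.symm φ.target := by
  have hfa : ContDiffAt ℝ ∞ f a := hf.contDiffAt (hU.mem_nhds ha)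
  let φ₀ := hfa.toOpenPartialHomeomorph f hf' (by simp)
  -- The local inverse is cut down to the open set where the derivative is invertible; there it is
  -- smooth at every point of its domain and not only at `f a`.
  have hS : IsOpen (U ∩ fderiv ℝ f ⁻¹' range ((↑) : (E ≃L[ℝ] F) → E →L[ℝ] F)) :=
    (hf.continuousOn_fderiv_of_isOpen hU (by simp)).isOpen_inter_preimage hU
      ContinuousLinearEquiv.isOpen
  have hsub : (φ₀.restrOpen _ hS).source ⊆
      U ∩ fderiv ℝ f ⁻¹' range ((↑) : (E ≃L[ℝ] F) → E →L[ℝ] F) := fun x hx => hx.2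
  have hfφ : ContDiffOn ℝ ∞ (φ₀.restrOpen _ hS) (φ₀.restrOpen _ hS).source :=
    hf.mono fun x hx => (hsub hx).1
  refine ⟨φ₀.restrOpen _ hS, ⟨hfa.mem_toOpenPartialHomeomorph_source hf' (by simp), ha, ?_⟩,
    fun x hx => (hsub hx).1, fun x => rfl, hfφ, fun y hy => ?_⟩
  · rw [mem_preimage, hf'.fderiv]
    exact mem_range_self f'
  · have hx := (φ₀.restrOpen _ hS).map_target hy
    obtain ⟨g', hg'⟩ := (hsub hx).2
    refine (OpenPartialHomeomorph.contDiffAt_symm _ (f₀' := g') hy ?_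
      (hfφ.contDiffAt ((φ₀.restrOpen _ hS).open_source.mem_nhds hx))).contDiffWithinAt
    rw [hg']
    exact ((hf.contDiffAt (hU.mem_nhds (hsub hx).1)).differentiableAt (by simp)).hasFDerivAt

end InverseFunction

/-! ### Manifold structures given by charts that are smooth in an ambient space -/

section EmbeddedCharts

variable {M : Type*} [TopologicalSpace M] {W : Type u} [NormedAddCommGroup W] [NormedSpace ℝ W]
  (ι : M → W) (E : Submodule ℝ W)

/-- A chart of `M` with values in a subspace `E` of `W` that is smooth, with smooth inverse, for
the map `ι` of `M` to `W`. -/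
structure IsEmbeddedChart (c : OpenPartialHomeomorph M E) : Prop where
  contDiffOn_symm : ContDiffOn ℝ ∞ (fun y => ι (c.symm y)) c.target
  -- The extension r makes sense of smoothness of the chart before M has any smooth structure: a
  -- transition map from c to c' is r' ∘ ι ∘ c⁻¹.
  exists_ambient : ∃ (r : W → W) (U : Set W), IsOpen U ∧ ContDiffOn ℝ ∞ r U ∧
    ∀ x ∈ c.source, ι x ∈ U ∧ (c x : W) = r (ι x)

/-- The manifold structure of a space that is covered by embedded charts. -/
abbrev chartedSpaceOfEmbeddedCharts
    (h : ∀ x, ∃ c : OpenPartialHomeomorph M E, x ∈ c.source ∧ IsEmbeddedChart ι E c) :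
    ChartedSpace E M where
  atlas := {c | IsEmbeddedChart ι E c}
  chartAt x := (h x).choose
  mem_chart_source x := (h x).choose_spec.1
  chart_mem_atlas x := (h x).choose_spec.2

variable {ι E}

/-- Allows one chart to be moved around by a group whose elements act on M by restrictions of smooth
ambient maps; b extends the inverse of T, a extends T. -/
lemma IsEmbeddedChart.comp_homeomorph {c : OpenPartialHomeomorph M E} (hc : IsEmbeddedChart ι E c)
    (T : M ≃ₜ M) {a b : W → W} (ha : ContDiff ℝ ∞ a) (hb : ContDiff ℝ ∞ b)
    (hTa : ∀ x, ι (T x) = a (ι x)) (hTb : ∀ x, ι (T.symm x) = b (ι x)) :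
    IsEmbeddedChart ι E (T.toOpenPartialHomeomorph.trans c) := by
  obtain ⟨r, U, hU, hr, hrU⟩ := hc.exists_ambient
  constructor
  · refine (hb.comp_contDiffOn (hc.contDiffOn_symm.mono (s := c.target) subset_rfl)).mono ?_ |>.congr
      fun y _ => hTb _
    intro y hy
    exact hy.1
  · refine ⟨r ∘ a, a ⁻¹' U, hU.preimage ha.continuous, hr.comp ha.contDiffOn fun x hx => hx,
      fun x hx => ?_⟩
    have hx' : T x ∈ c.source := by simpa using hx
    obtain ⟨h1, h2⟩ := hrU _ hx'
    rw [hTa] at h1 h2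
    exact ⟨h1, h2⟩

variable [CompleteSpace E]

lemma IsEmbeddedChart.contDiffOn_trans {c c' : OpenPartialHomeomorph M E}
    (hc : IsEmbeddedChart ι E c) (hc' : IsEmbeddedChart ι E c') :
    ContDiffOn ℝ ∞ (c.symm.trans c') (c.symm.trans c').source := by
  obtain ⟨r, U, hU, hr, hrU⟩ := hc'.exists_ambient
  refine contDiffOn_of_linearIsometry_comp E.subtypeₗᵢ (c.symm.trans c').open_source ?_
  refine ContDiffOn.congr (f := fun y => r (ι (c.symm y))) ?_ ?_
  · refine hr.comp (hc.contDiffOn_symm.mono ?_) ?_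
    · intro y hy
      simp only [OpenPartialHomeomorph.trans_source, OpenPartialHomeomorph.symm_source] at hy
      exact hy.1
    · intro y hy
      simp only [OpenPartialHomeomorph.trans_source, OpenPartialHomeomorph.symm_source] at hy
      exact (hrU _ hy.2).1
  · intro y hy
    simp only [OpenPartialHomeomorph.trans_source, OpenPartialHomeomorph.symm_source] at hy
    exact (hrU _ hy.2).2

variable [ChartedSpace E M]

lemma isManifold_of_isEmbeddedChart (hat : ∀ c ∈ atlas E M, IsEmbeddedChart ι E c) :
    IsManifold 𝓘(ℝ, E) ∞ M := by
  refine isManifold_of_contDiffOn _ _ _ fun c c' hc hc' => ?_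
  simpa using (hat c hc).contDiffOn_trans (hat c' hc')

lemma mem_contDiffGroupoid_of_contDiffOn {E : Type*} [NormedAddCommGroup E] [NormedSpace ℝ E]
    {φ : OpenPartialHomeomorph E E} (h : ContDiffOn ℝ ∞ φ φ.source)
    (h' : ContDiffOn ℝ ∞ φ.symm φ.target) : φ ∈ contDiffGroupoid ∞ 𝓘(ℝ, E) := by
  rw [contDiffGroupoid, mem_groupoid_of_pregroupoid]
  simp [contDiffPregroupoid, h, h']

lemma IsEmbeddedChart.mem_maximalAtlas (hat : ∀ c ∈ atlas E M, IsEmbeddedChart ι E c)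
    {c : OpenPartialHomeomorph M E} (hc : IsEmbeddedChart ι E c) :
    c ∈ IsManifold.maximalAtlas 𝓘(ℝ, E) ∞ M := by
  have key : ∀ {c c' : OpenPartialHomeomorph M E}, IsEmbeddedChart ι E c →
      IsEmbeddedChart ι E c' → c.symm.trans c' ∈ contDiffGroupoid ∞ 𝓘(ℝ, E) := by
    intro c c' hc hc'
    refine mem_contDiffGroupoid_of_contDiffOn (hc.contDiffOn_trans hc') ?_
    have := hc'.contDiffOn_trans hc
    simpa using this
  exact fun c' hc' => ⟨key hc (hat c' hc'), key (hat c' hc') hc⟩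

omit [CompleteSpace E] in
lemma trans_mem_maximalAtlas {c : OpenPartialHomeomorph M E}
    (hc : c ∈ IsManifold.maximalAtlas 𝓘(ℝ, E) ∞ M) {φ : OpenPartialHomeomorph E E}
    (h : ContDiffOn ℝ ∞ φ φ.source) (h' : ContDiffOn ℝ ∞ φ.symm φ.target) :
    c.trans φ ∈ IsManifold.maximalAtlas 𝓘(ℝ, E) ∞ M := by
  have hφ := mem_contDiffGroupoid_of_contDiffOn h h'
  intro e he
  obtain ⟨h1, h2⟩ := hc e he
  refine ⟨?_, ?_⟩
  · rw [OpenPartialHomeomorph.trans_symm_eq_symm_trans_symm, OpenPartialHomeomorph.trans_assoc]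
    exact StructureGroupoid.trans _ (StructureGroupoid.symm _ hφ) h1
  · rw [← OpenPartialHomeomorph.trans_assoc]
    exact StructureGroupoid.trans _ h2 hφ

lemma contMDiff_of_isEmbeddedChart (hat : ∀ c ∈ atlas E M, IsEmbeddedChart ι E c) :
    ContMDiff 𝓘(ℝ, E) 𝓘(ℝ, W) ∞ ι := by
  have := isManifold_of_isEmbeddedChart hat
  intro x
  let c := chartAt E x
  have hc : IsEmbeddedChart ι E c := hat c (chart_mem_atlas E x)
  have hx : x ∈ c.source := mem_chart_source E x
  have h1 : ContMDiffOn 𝓘(ℝ, E) 𝓘(ℝ, W) ∞ (fun y => ι (c.symm (c y))) c.source :=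
    hc.contDiffOn_symm.contMDiffOn.comp (contMDiffOn_of_mem_maximalAtlas (hc.mem_maximalAtlas hat))
      fun y hy => c.map_source hy
  refine ((h1 x hx).congr_of_mem (fun y hy => ?_) hx).contMDiffAt (c.open_source.mem_nhds hx)
  rw [c.left_inv hy]

/-- A continuous map to a space with embedded charts is smooth if its composition with the map to
the ambient space is. -/
lemma contMDiff_of_comp (hat : ∀ c ∈ atlas E M, IsEmbeddedChart ι E c)
    {E' : Type u} [NormedAddCommGroup E'] [NormedSpace ℝ E']
    {H' : Type*} [TopologicalSpace H'] {I' : ModelWithCorners ℝ E' H'} [I'.Boundaryless]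
    {N : Type*} [TopologicalSpace N] [ChartedSpace H' N] [IsManifold I' ∞ N]
    {f : N → M} (hf : Continuous f) (h : ContMDiff I' 𝓘(ℝ, W) ∞ (fun y => ι (f y))) :
    ContMDiff I' 𝓘(ℝ, E) ∞ f := by
  have := isManifold_of_isEmbeddedChart hat
  intro x
  let c := chartAt E (f x)
  have hc : IsEmbeddedChart ι E c := hat c (chart_mem_atlas E (f x))
  have hx : f x ∈ c.source := mem_chart_source E (f x)
  have hO : IsOpen (f ⁻¹' c.source) := c.open_source.preimage hf
  obtain ⟨r, U, hU, hr, hrU⟩ := hc.exists_ambient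
  have h1 : ContMDiffOn I' 𝓘(ℝ, E) ∞ (fun y => c (f y)) (f ⁻¹' c.source) := by
    refine contMDiffOn_of_linearIsometry_comp E.subtypeₗᵢ hO ?_
    refine (hr.contMDiffOn.comp h.contMDiffOn fun y hy => (hrU _ hy).1).congr fun y hy => ?_
    exact (hrU _ hy).2
  have h2 : ContMDiffOn I' 𝓘(ℝ, E) ∞ (fun y => c.symm (c (f y))) (f ⁻¹' c.source) :=
    (contMDiffOn_symm_of_mem_maximalAtlas (hc.mem_maximalAtlas hat)).comp h1
      fun y hy => c.map_source hy
  refine ((h2 x hx).congr_of_mem (fun y hy => ?_) hx).contMDiffAt (hO.mem_nhds hx)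
  rw [c.left_inv hy]

end EmbeddedCharts

/-! ### Invertibility of 1 ± X for anti-symmetric compact X -/

section Invertibility

variable {H : Type u} [NormedAddCommGroup H] [InnerProductSpace ℂ H] [CompleteSpace H]

/-- Fredholm alternative: the nonzero number -c is an eigenvalue of K or lies in its resolvent set.
-/
lemma isUnit_smul_one_add_of_compact {K : H →L[ℂ] H} (hK : IsCompactOperator K) {c : ℂ}
    (hc : c ≠ 0) (h : ∀ x, c • x + K x = 0 → x = 0) : IsUnit (c • (1 : H →L[ℂ] H) + K) := by
  rcases IsCompactOperator.hasEigenvalue_or_mem_resolventSet hK (neg_ne_zero.2 hc) with h1 | h1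
  · obtain ⟨x, hx, hx0⟩ := h1.exists_hasEigenvector
    refine (hx0 (h x ?_)).elim
    have : K x = -c • x := Module.End.mem_eigenspace_iff.1 hx
    rw [this]
    module
  · rw [spectrum.mem_resolventSet_iff] at h1
    have h2 : c • (1 : H →L[ℂ] H) + K = -(algebraMap ℂ (H →L[ℂ] H) (-c) - K) := by
      rw [Algebra.algebraMap_eq_smul_one]
      module
    rw [h2]
    exact h1.neg

/-- With A = B* B the hypothesis reads ‖B x‖² = 0, so A x = B* (B x) = 0 and injectivity applies. -/
lemma eq_zero_of_inner_eq_zero {A : H →L[ℂ] H} (hA : A.IsPositive)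
    (hinj : Function.Injective A) {x : H} (h : ⟪A x, x⟫_ℂ = 0) : x = 0 := by
  have hA0 : (0 : H →L[ℂ] H) ≤ A := (ContinuousLinearMap.nonneg_iff_isPositive _).2 hA
  obtain ⟨B, hB⟩ := CStarAlgebra.nonneg_iff_eq_star_mul_self.1 hA0
  have hBx : B x = 0 := by
    rw [hB, ContinuousLinearMap.star_eq_adjoint, mul_apply_eq_comp,
      ContinuousLinearMap.adjoint_inner_left] at h
    exact inner_self_eq_zero.1 h
  apply hinj
  rw [map_zero, hB, mul_apply_eq_comp, hBx, map_zero]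

/-- Anti-symmetry gives c ⟨A x, x⟩ = -c ⟨A x, x⟩; reality of c is what makes both factors equal c.
-/
lemma inner_eq_zero_of_isAAntisymm {A X : H →L[ℂ] H} (hX : IsAAntisymm A X)
    {x : H} {c : ℝ} (hx : X x = (c : ℂ) • x) (hc : c ≠ 0) : ⟪A x, x⟫_ℂ = 0 := by
  have h1 : ⟪A x, X x⟫_ℂ = -⟪A (X x), x⟫_ℂ := by
    rw [← ContinuousLinearMap.adjoint_inner_left, ← mul_apply_eq_comp, hX]
    simp
  rw [hx, map_smul, inner_smul_left, inner_smul_right, Complex.conj_ofReal] at h1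
  have h2 : (2 * c : ℂ) * ⟪A x, x⟫_ℂ = 0 := by linear_combination h1
  rcases mul_eq_zero.1 h2 with h3 | h3
  · exact (hc (by simpa using h3)).elim
  · exact h3

/-- The source of all global statements below: it puts every element of 𝔤_p in the domain of the
Cayley transform, and every tangent vector of the Grassmannian in the range of a chart. -/
lemma isUnit_one_sub_of_isAAntisymm {A X : H →L[ℂ] H} (hA : A.IsPositive)
    (hinj : Function.Injective A) (hX : IsAAntisymm A X) (hc : IsCompactOperator X) :
    IsUnit (1 - X) := by
  have h := isUnit_smul_one_add_of_compact (K := -X) hc.neg (c := 1) one_ne_zero fun x hx => by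
    refine eq_zero_of_inner_eq_zero hA hinj (inner_eq_zero_of_isAAntisymm hX (c := 1) ?_
      one_ne_zero)
    rw [one_smul, neg_apply, add_neg_eq_zero] at hx
    simpa using hx.symm
  rwa [one_smul, ← sub_eq_add_neg] at h

lemma IsAAntisymm.neg {A X : H →L[ℂ] H} (hX : IsAAntisymm A X) : IsAAntisymm A (-X) := by
  unfold IsAAntisymm at *
  rw [map_neg, neg_mul, hX, mul_neg]

lemma isUnit_one_add_of_isAAntisymm {A X : H →L[ℂ] H} (hA : A.IsPositive)
    (hinj : Function.Injective A) (hX : IsAAntisymm A X) (hc : IsCompactOperator X) :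
    IsUnit (1 + X) := by
  simpa using isUnit_one_sub_of_isAAntisymm hA hinj hX.neg hc.neg

end Invertibility

/-! ### The Cayley transform on the Schatten class -/

section Smoothness

variable {H : Type u} [NormedAddCommGroup H] [InnerProductSpace ℂ H] [CompleteSpace H]
  {p : ℝ≥0∞} [hp : Fact (1 ≤ p)]

lemma contDiffOn_inverse : ContDiffOn ℝ ∞ (Ring.inverse : (H →L[ℂ] H) → (H →L[ℂ] H))
    {x | IsUnit x} := by
  rintro _ ⟨x, rfl⟩
  exact (contDiffAt_ringInverse ℝ x).contDiffWithinAt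

lemma contDiffOn_rmul {E : Type*} [NormedAddCommGroup E] [NormedSpace ℝ E]
    {f : E → H →L[ℂ] H} {h : E → SchattenClass H p} {s : Set E} (hf : ContDiffOn ℝ ∞ f s)
    (hh : ContDiffOn ℝ ∞ h s) : ContDiffOn ℝ ∞ (fun x => rmul H p (f x) (h x)) s :=
  ((rmul H p).contDiff.comp_contDiffOn hf).clm_apply hh

lemma contDiffOn_lmul {E : Type*} [NormedAddCommGroup E] [NormedSpace ℝ E]
    {f : E → H →L[ℂ] H} {h : E → SchattenClass H p} {s : Set E} (hf : ContDiffOn ℝ ∞ f s)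
    (hh : ContDiffOn ℝ ∞ h s) : ContDiffOn ℝ ∞ (fun x => lmul H p (f x) (h x)) s :=
  ((lmul H p).contDiff.comp_contDiffOn hf).clm_apply hh

lemma contDiffOn_rmul_inverse {E : Type*} [NormedAddCommGroup E] [NormedSpace ℝ E]
    {f : E → H →L[ℂ] H} {h : E → SchattenClass H p} (hf : ContDiff ℝ ∞ f)
    (hh : ContDiff ℝ ∞ h) :
    ContDiffOn ℝ ∞ (fun x => rmul H p (Ring.inverse (f x)) (h x)) {x | IsUnit (f x)} :=
  contDiffOn_rmul (contDiffOn_inverse.comp hf.contDiffOn fun _ hx => hx) hh.contDiffOn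

lemma isOpen_setOf_isUnit {E : Type*} [TopologicalSpace E] {f : E → H →L[ℂ] H}
    (hf : Continuous f) : IsOpen {x | IsUnit (f x)} :=
  Units.isOpen.preimage hf

/-- In the product rule the term with the derivative of f carries the factor h x = 0, so that
derivative never has to be computed. -/
lemma hasFDerivAt_rmul_zero {E : Type*} [NormedAddCommGroup E] [NormedSpace ℝ E]
    {f : E → H →L[ℂ] H} {h : E → SchattenClass H p} {h' : E →L[ℝ] SchattenClass H p} {x : E}
    (hf : DifferentiableAt ℝ f x) (hh : HasFDerivAt h h' x) (hx : h x = 0) :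
    HasFDerivAt (fun y => rmul H p (f y) (h y)) ((rmul H p (f x)).comp h') x := by
  have h1 : HasFDerivAt (fun y => rmul H p (f y)) ((rmul H p).comp (fderiv ℝ f x)) x :=
    (rmul H p).hasFDerivAt.comp x hf.hasFDerivAt
  refine (h1.clm_apply hh).congr_fderiv ?_
  ext v
  simp [hx]

/-- The Cayley transform `X ↦ (1 + X) (1 - X)⁻¹ - 1`. -/
def cayley (X : SchattenClass H p) : SchattenClass H p :=
  -- The form 2 X (1 - X)⁻¹ shows that the result is again a Schatten operator.
  rmul H p (Ring.inverse (1 - toCLM X)) ((2 : ℝ) • X)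

/-- The inverse `g ↦ g (2 + g)⁻¹` of the Cayley transform. -/
def cayleyInv (g : SchattenClass H p) : SchattenClass H p :=
  rmul H p (Ring.inverse (2 + toCLM g)) g

lemma contDiffOn_cayley :
    ContDiffOn ℝ ∞ (cayley : SchattenClass H p → _) {X | IsUnit (1 - toCLM X)} :=
  contDiffOn_rmul_inverse (contDiff_const.sub (incl H p).contDiff) (contDiff_const_smul _)

lemma contDiffOn_cayleyInv :
    ContDiffOn ℝ ∞ (cayleyInv : SchattenClass H p → _) {g | IsUnit (2 + toCLM g)} :=
  contDiffOn_rmul_inverse (contDiff_const.add (incl H p).contDiff) contDiff_id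

lemma isOpen_cayley_source : IsOpen {X : SchattenClass H p | IsUnit (1 - toCLM X)} :=
  isOpen_setOf_isUnit (continuous_const.sub (incl H p).continuous)

lemma isOpen_cayleyInv_source : IsOpen {g : SchattenClass H p | IsUnit (2 + toCLM g)} :=
  isOpen_setOf_isUnit (continuous_const.add (incl H p).continuous)

lemma one_add_toCLM_cayley {X : SchattenClass H p} (hX : IsUnit (1 - toCLM X)) :
    1 + toCLM (cayley X) = (1 + toCLM X) * Ring.inverse (1 - toCLM X) := by
  apply hX.mul_right_cancel
  rw [cayley, toCLM_rmul, toCLM_real_smul, two_smul, add_mul, mul_assoc, mul_assoc,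
    Ring.inverse_mul_cancel _ hX]
  noncomm_ring

lemma two_add_toCLM_cayley {X : SchattenClass H p} (hX : IsUnit (1 - toCLM X)) :
    2 + toCLM (cayley X) = 2 * Ring.inverse (1 - toCLM X) := by
  apply hX.mul_right_cancel
  rw [← one_add_one_eq_two, add_assoc, one_add_toCLM_cayley hX, add_mul, mul_assoc, mul_assoc,
    Ring.inverse_mul_cancel _ hX]
  noncomm_ring

omit [CompleteSpace H] in
lemma isUnit_two : IsUnit (2 : H →L[ℂ] H) := by
  have h : (2 : H →L[ℂ] H) = algebraMap ℂ _ 2 := (map_ofNat _ 2).symm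
  rw [h]
  exact (IsUnit.mk0 _ two_ne_zero).map _

lemma isUnit_two_add_cayley {X : SchattenClass H p} (hX : IsUnit (1 - toCLM X)) :
    IsUnit (2 + toCLM (cayley X)) := by
  rw [two_add_toCLM_cayley hX]
  exact isUnit_two.mul hX.ringInverse

lemma cayleyInv_cayley {X : SchattenClass H p} (hX : IsUnit (1 - toCLM X)) :
    cayleyInv (cayley X) = X := by
  have hu := isUnit_two_add_cayley hX
  apply toCLM_injective
  rw [cayleyInv, toCLM_rmul]
  apply hu.mul_right_cancel
  rw [mul_assoc, Ring.inverse_mul_cancel _ hu, mul_one, two_add_toCLM_cayley hX, cayley,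
    toCLM_rmul, toCLM_real_smul, two_smul, two_mul, mul_add, add_mul]

lemma one_sub_toCLM_cayleyInv {g : SchattenClass H p} (hg : IsUnit (2 + toCLM g)) :
    1 - toCLM (cayleyInv g) = 2 * Ring.inverse (2 + toCLM g) := by
  apply hg.mul_right_cancel
  rw [cayleyInv, toCLM_rmul, sub_mul, mul_assoc, mul_assoc, Ring.inverse_mul_cancel _ hg]
  noncomm_ring

lemma isUnit_one_sub_cayleyInv {g : SchattenClass H p} (hg : IsUnit (2 + toCLM g)) :
    IsUnit (1 - toCLM (cayleyInv g)) := by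
  rw [one_sub_toCLM_cayleyInv hg]
  exact isUnit_two.mul hg.ringInverse

lemma cayley_cayleyInv {g : SchattenClass H p} (hg : IsUnit (2 + toCLM g)) :
    cayley (cayleyInv g) = g := by
  have hu := isUnit_one_sub_cayleyInv hg
  apply toCLM_injective
  rw [cayley, toCLM_rmul]
  apply hu.mul_right_cancel
  rw [mul_assoc, Ring.inverse_mul_cancel _ hu, mul_one, one_sub_toCLM_cayleyInv hg, cayleyInv,
    toCLM_real_smul, toCLM_rmul, two_smul, two_mul, mul_add]

lemma hasFDerivAt_cayley_zero :
    HasFDerivAt (cayley : SchattenClass H p → _) ((2 : ℝ) • ContinuousLinearMap.id ℝ _) 0 := by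
  have hd : DifferentiableAt ℝ (fun X : SchattenClass H p => Ring.inverse (1 - toCLM X)) 0 := by
    have h0 : IsUnit (1 - toCLM (0 : SchattenClass H p)) := by simp
    have h1 : ContDiffOn ℝ ∞ (fun X : SchattenClass H p => Ring.inverse (1 - toCLM X))
        {X | IsUnit (1 - toCLM X)} :=
      contDiffOn_inverse.comp (contDiff_const.sub (incl H p).contDiff).contDiffOn fun _ hx => hx
    exact (h1.contDiffAt (isOpen_cayley_source.mem_nhds h0)).differentiableAt (by simp)
  have h2 : HasFDerivAt (fun X : SchattenClass H p => (2 : ℝ) • X)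
      ((2 : ℝ) • ContinuousLinearMap.id ℝ _) 0 := (hasFDerivAt_id _).const_smul _
  refine (hasFDerivAt_rmul_zero hd h2 (by simp)).congr_fderiv ?_
  ext v
  apply toCLM_injective
  simp

lemma hasFDerivAt_cayleyInv_zero :
    HasFDerivAt (cayleyInv : SchattenClass H p → _) ((1 / 2 : ℝ) • ContinuousLinearMap.id ℝ _)
      0 := by
  have hd : DifferentiableAt ℝ (fun X : SchattenClass H p => Ring.inverse (2 + toCLM X)) 0 := by
    have h0 : IsUnit (2 + toCLM (0 : SchattenClass H p)) := by simpa using isUnit_two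
    have h1 : ContDiffOn ℝ ∞ (fun X : SchattenClass H p => Ring.inverse (2 + toCLM X))
        {X | IsUnit (2 + toCLM X)} :=
      contDiffOn_inverse.comp (contDiff_const.add (incl H p).contDiff).contDiffOn fun _ hx => hx
    exact (h1.contDiffAt (isOpen_cayleyInv_source.mem_nhds h0)).differentiableAt (by simp)
  refine (hasFDerivAt_rmul_zero hd (hasFDerivAt_id _) (by simp)).congr_fderiv ?_
  ext v
  apply toCLM_injective
  apply isUnit_two.mul_right_cancel
  have : toCLM v * Ring.inverse (2 : H →L[ℂ] H) * 2 = toCLM v := by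
    rw [mul_assoc, Ring.inverse_mul_cancel _ isUnit_two, mul_one]
  simp only [map_zero, add_zero, ContinuousLinearMap.comp_apply, ContinuousLinearMap.id_apply,
    toCLM_rmul, this, smul_apply, toCLM_real_smul]
  rw [smul_mul_assoc, mul_two, ← two_smul ℝ (toCLM v), smul_smul]
  norm_num

end Smoothness

/-! ### The Lie group structure of 𝒢_{p,A} -/

section Group

variable {H : Type u} [NormedAddCommGroup H] [InnerProductSpace ℂ H] [CompleteSpace H]
  {A : H →L[ℂ] H} {p : ℝ≥0∞} [hp : Fact (1 ≤ p)]

namespace RestrictedGroup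

lemma toCLM_injective : Function.Injective (toCLM : RestrictedGroup A p → (H →L[ℂ] H)) :=
  fun _ _ h => Subtype.ext (Units.ext h)

@[simp] lemma toCLM_mul_inv (G : RestrictedGroup A p) : G.toCLM * (G⁻¹).toCLM = 1 := by
  rw [← toCLM_mul, mul_inv_cancel, toCLM_one]

@[simp] lemma toCLM_inv_mul (G : RestrictedGroup A p) : (G⁻¹).toCLM * G.toCLM = 1 := by
  rw [← toCLM_mul, inv_mul_cancel, toCLM_one]

lemma adjoint_mul_mul (G : RestrictedGroup A p) : G.toCLM.adjoint * A * G.toCLM = A := G.2.1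

lemma adjoint_mul_eq (G : RestrictedGroup A p) : G.toCLM.adjoint * A = A * (G⁻¹).toCLM := by
  have h := congrArg (· * (G⁻¹).toCLM) G.adjoint_mul_mul
  simpa only [mul_assoc, toCLM_mul_inv, mul_one] using h

@[simp] lemma toCLM_subOne (G : RestrictedGroup A p) :
    SchattenClass.toCLM G.subOne = G.toCLM - 1 := rfl

@[simp] lemma subOne_one : (1 : RestrictedGroup A p).subOne = 0 := by
  apply SchattenClass.toCLM_injective
  simp

/-- The element of `𝒢_{p,A}` with a given operator and its inverse. -/
def ofInverse (a b : H →L[ℂ] H) (hab : a * b = 1) (hba : b * a = 1)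
    (hA : a.adjoint * A * a = A) (ha : MemSchatten p (a - 1)) : RestrictedGroup A p :=
  ⟨⟨a, b, hab, hba⟩, hA, ha⟩

@[simp] lemma toCLM_ofInverse (a b : H →L[ℂ] H) (hab : a * b = 1) (hba : b * a = 1)
    (hA : a.adjoint * A * a = A) (ha : MemSchatten p (a - 1)) :
    (ofInverse a b hab hba hA ha).toCLM = a := rfl

lemma isInducing_subOne : IsInducing (subOne : RestrictedGroup A p → SchattenClass H p) := ⟨rfl⟩

lemma continuous_subOne : Continuous (subOne : RestrictedGroup A p → SchattenClass H p) :=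
  isInducing_subOne.continuous

lemma continuous_toCLM : Continuous (toCLM : RestrictedGroup A p → (H →L[ℂ] H)) := by
  have h : (toCLM : RestrictedGroup A p → (H →L[ℂ] H)) = fun G => incl H p G.subOne + 1 := by
    ext1 G
    simp
  rw [h]
  exact ((incl H p).continuous.comp continuous_subOne).add continuous_const

/-- A polynomial in the two ambient coordinates, which gives continuity and smoothness of the
multiplication. -/
lemma subOne_mul (G K : RestrictedGroup A p) :
    (G * K).subOne = lmul H p (SchattenClass.toCLM G.subOne) K.subOne + G.subOne + K.subOne := by
  apply SchattenClass.toCLM_injective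
  simp
  noncomm_ring

/-- For fixed G this is affine in K - 1: left translation extends to a smooth map of the whole
Schatten class, as `IsEmbeddedChart.comp_homeomorph` requires. -/
lemma subOne_mul' (G K : RestrictedGroup A p) :
    (G * K).subOne = lmul H p G.toCLM K.subOne + G.subOne := by
  apply SchattenClass.toCLM_injective
  simp
  noncomm_ring

lemma inverse_toCLM (G : RestrictedGroup A p) : Ring.inverse G.toCLM = (G⁻¹).toCLM :=
  Ring.inverse_unit G.1

lemma subOne_inv (G : RestrictedGroup A p) :
    (G⁻¹).subOne = -rmul H p (Ring.inverse (1 + SchattenClass.toCLM G.subOne)) G.subOne := by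
  apply SchattenClass.toCLM_injective
  rw [toCLM_subOne, toCLM_subOne, add_sub_cancel, inverse_toCLM, map_neg, toCLM_rmul, toCLM_subOne,
    sub_mul, toCLM_mul_inv]
  noncomm_ring

lemma isUnit_toCLM (G : RestrictedGroup A p) : IsUnit G.toCLM := ⟨G.1, rfl⟩

lemma contDiff_subOne_mul : ContDiff ℝ ∞ fun x : SchattenClass H p × SchattenClass H p =>
    lmul H p (SchattenClass.toCLM x.1) x.2 + x.1 + x.2 :=
  ((contDiffOn_univ.1 (contDiffOn_lmul
    ((incl H p).contDiff.comp contDiff_fst).contDiffOn contDiff_snd.contDiffOn)).add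
      contDiff_fst).add contDiff_snd

lemma contDiffOn_subOne_inv : ContDiffOn ℝ ∞ (fun g : SchattenClass H p =>
    -rmul H p (Ring.inverse (1 + SchattenClass.toCLM g)) g)
    {g | IsUnit (1 + SchattenClass.toCLM g)} :=
  (contDiffOn_rmul_inverse (contDiff_const.add (incl H p).contDiff) contDiff_id).neg

lemma isUnit_one_add_subOne (G : RestrictedGroup A p) :
    IsUnit (1 + SchattenClass.toCLM G.subOne) := by
  rw [toCLM_subOne, add_sub_cancel]
  exact G.isUnit_toCLM

instance : IsTopologicalGroup (RestrictedGroup A p) where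
  continuous_mul := by
    rw [isInducing_subOne.continuous_iff]
    refine (contDiff_subOne_mul.continuous.comp
      (continuous_subOne.prodMap continuous_subOne)).congr fun x => ?_
    exact (subOne_mul _ _).symm
  continuous_inv := by
    rw [isInducing_subOne.continuous_iff]
    refine (contDiffOn_subOne_inv.continuousOn.comp_continuous continuous_subOne
      isUnit_one_add_subOne).congr fun x => ?_
    exact (subOne_inv _).symm

lemma two_add_subOne (G : RestrictedGroup A p) :
    2 + SchattenClass.toCLM G.subOne = G.toCLM + 1 := by
  rw [toCLM_subOne, ← one_add_one_eq_two]
  abel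

lemma isAAntisymm_cayleyInv (G : RestrictedGroup A p) :
    IsAAntisymm A (SchattenClass.toCLM (cayleyInv G.subOne)) := by
  rw [cayleyInv, toCLM_rmul, two_add_subOne, toCLM_subOne]
  by_cases hu : IsUnit (G.toCLM + 1)
  · set y := (G.toCLM - 1) * Ring.inverse (G.toCLM + 1) with hy
    have hyu : y * (G.toCLM + 1) = G.toCLM - 1 := by
      rw [hy, mul_assoc, Ring.inverse_mul_cancel _ hu, mul_one]
    have hyu' : star (G.toCLM + 1) * star y = star (G.toCLM - 1) := by rw [← star_mul, hyu]
    have hG : star G.toCLM * A * G.toCLM = A := G.adjoint_mul_mul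
    unfold IsAAntisymm
    rw [← ContinuousLinearMap.star_eq_adjoint]
    -- Multiplying by (G + 1)* on the left and G + 1 on the right clears the inverse. By G* A G = A,
    -- both sides become G* A - A G.
    apply hu.star.mul_left_cancel
    apply hu.mul_right_cancel
    calc star (G.toCLM + 1) * (star y * A) * (G.toCLM + 1)
        = star (G.toCLM - 1) * A * (G.toCLM + 1) := by
          rw [← mul_assoc, hyu']
      _ = -(star (G.toCLM + 1) * A * (G.toCLM - 1)) := by
          simp only [star_sub, star_add, star_one, sub_mul, add_mul, mul_sub, mul_add, hG, one_mul,
            mul_one]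
          abel
      _ = star (G.toCLM + 1) * -(A * y) * (G.toCLM + 1) := by
          rw [← hyu]
          noncomm_ring
  -- If G + 1 is not invertible, `Ring.inverse` is 0 by convention. The chart map is thereby defined
  -- on the whole group with values in 𝔤_p.
  · simp [Ring.inverse_non_unit _ hu, IsAAntisymm]

/-- The chart `G ↦ (G - 1) (G + 1)⁻¹` of `𝒢_{p,A}`, as a map. -/
def toLie (G : RestrictedGroup A p) : antisymmSchatten A p :=
  ⟨cayleyInv G.subOne, G.isAAntisymm_cayleyInv⟩

lemma coe_toLie (G : RestrictedGroup A p) : (G.toLie : SchattenClass H p) = cayleyInv G.subOne :=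
  rfl

end RestrictedGroup

lemma isAAntisymm (X : antisymmSchatten A p) : IsAAntisymm A (SchattenClass.toCLM X.1) := X.2

lemma isCompactOperator (X : SchattenClass H p) : IsCompactOperator (SchattenClass.toCLM X) :=
  X.memSchatten.1

/-- The element `(1 + X) (1 - X)⁻¹` of `𝒢_{p,A}`. -/
def cayleyGroup (hA : A.IsPositive) (hinj : Function.Injective A) (X : antisymmSchatten A p) :
    RestrictedGroup A p :=
  have hm := isUnit_one_sub_of_isAAntisymm hA hinj (isAAntisymm X) (isCompactOperator X.1)
  have hp := isUnit_one_add_of_isAAntisymm hA hinj (isAAntisymm X) (isCompactOperator X.1)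
  ofInverse (1 + SchattenClass.toCLM (cayley X.1))
    ((1 - SchattenClass.toCLM X.1) * Ring.inverse (1 + SchattenClass.toCLM X.1))
    (by
      rw [one_add_toCLM_cayley hm, mul_assoc, ← mul_assoc (Ring.inverse _),
        Ring.inverse_mul_cancel _ hm, one_mul, Ring.mul_inverse_cancel _ hp])
    (by
      rw [one_add_toCLM_cayley hm, mul_assoc, ← mul_assoc (Ring.inverse _),
        Ring.inverse_mul_cancel _ hp, one_mul, Ring.mul_inverse_cancel _ hm])
    (by
      rw [one_add_toCLM_cayley hm, ← ContinuousLinearMap.star_eq_adjoint, star_mul]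
      set x := SchattenClass.toCLM X.1
      set u := Ring.inverse (1 - x)
      have hu : (1 - x) * u = 1 := Ring.mul_inverse_cancel _ hm
      have hu' : star u * star (1 - x) = 1 := by rw [← star_mul, hu, star_one]
      have hx : star x * A = -(A * x) := isAAntisymm X
      -- The linear terms cancel since x* A = -A x, and both sides equal A + x* A x.
      have h1 : star (1 + x) * A * (1 + x) = star (1 - x) * A * (1 - x) := by
        simp only [star_sub, star_add, star_one, sub_mul, add_mul, mul_sub, mul_add, hx, one_mul,
          mul_one]
        abel
      calc star u * star (1 + x) * A * ((1 + x) * u)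
          = star u * (star (1 + x) * A * (1 + x)) * u := by simp only [mul_assoc]
        _ = (star u * star (1 - x)) * A * ((1 - x) * u) := by rw [h1]; simp only [mul_assoc]
        _ = A := by rw [hu, hu', one_mul, mul_one])
    (by rw [add_sub_cancel_left]; exact (cayley X.1).memSchatten)

variable (hA : A.IsPositive) (hinj : Function.Injective A)

lemma isUnit_one_sub_toCLM (hA : A.IsPositive) (hinj : Function.Injective A)
    (X : antisymmSchatten A p) : IsUnit (1 - SchattenClass.toCLM X.1) :=
  isUnit_one_sub_of_isAAntisymm hA hinj (isAAntisymm X) (isCompactOperator X.1)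

@[simp] lemma subOne_cayleyGroup (X : antisymmSchatten A p) :
    (cayleyGroup hA hinj X).subOne = cayley X.1 := by
  apply SchattenClass.toCLM_injective
  rw [toCLM_subOne, cayleyGroup, toCLM_ofInverse, add_sub_cancel_left]

lemma toLie_cayleyGroup (X : antisymmSchatten A p) : (cayleyGroup hA hinj X).toLie = X := by
  apply Subtype.ext
  rw [coe_toLie, subOne_cayleyGroup]
  exact cayleyInv_cayley (isUnit_one_sub_toCLM hA hinj X)

lemma cayleyGroup_toLie {G : RestrictedGroup A p} (hG : IsUnit (G.toCLM + 1)) :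
    cayleyGroup hA hinj G.toLie = G := by
  apply subOne_injective
  rw [subOne_cayleyGroup]
  exact cayley_cayleyInv (by rwa [two_add_subOne])

@[simp] lemma cayleyGroup_zero : cayleyGroup (p := p) hA hinj 0 = 1 := by
  apply subOne_injective
  rw [subOne_cayleyGroup, subOne_one]
  simp [cayley]

lemma isUnit_cayleyGroup_add_one (X : antisymmSchatten A p) :
    IsUnit ((cayleyGroup hA hinj X).toCLM + 1) := by
  rw [← two_add_subOne, subOne_cayleyGroup]
  exact isUnit_two_add_cayley (isUnit_one_sub_toCLM hA hinj X)

lemma continuous_cayleyGroup : Continuous (cayleyGroup (p := p) hA hinj) := by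
  rw [isInducing_subOne.continuous_iff]
  refine (contDiffOn_cayley.continuousOn.comp_continuous continuous_subtype_val
    (isUnit_one_sub_toCLM hA hinj)).congr fun X => ?_
  exact (subOne_cayleyGroup hA hinj X).symm

/-- The Cayley chart of `𝒢_{p,A}` at `1`. -/
def cayleyChart (hA : A.IsPositive) (hinj : Function.Injective A) :
    OpenPartialHomeomorph (RestrictedGroup A p) (antisymmSchatten A p) where
  toFun := toLie
  invFun := cayleyGroup hA hinj
  source := {G | IsUnit (G.toCLM + 1)}
  -- The chart is onto 𝔤_p, because 1 - X is invertible for every X in 𝔤_p.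
  target := univ
  map_source' _ _ := mem_univ _
  map_target' X _ := isUnit_cayleyGroup_add_one hA hinj X
  left_inv' _ hG := cayleyGroup_toLie hA hinj hG
  right_inv' X _ := toLie_cayleyGroup hA hinj X
  open_source := isOpen_setOf_isUnit (continuous_toCLM.add continuous_const)
  open_target := isOpen_univ
  continuousOn_toFun := by
    rw [IsInducing.subtypeVal.continuousOn_iff]
    refine contDiffOn_cayleyInv.continuousOn.comp continuous_subOne.continuousOn fun G hG => ?_
    rwa [mem_ofPred, two_add_subOne]
  continuousOn_invFun := (continuous_cayleyGroup hA hinj).continuousOn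

lemma isEmbeddedChart_cayleyChart :
    IsEmbeddedChart subOne (antisymmSchatten A p) (cayleyChart hA hinj) where
  contDiffOn_symm := by
    refine (contDiffOn_cayley.comp (antisymmSchatten A p).subtypeL.contDiff.contDiffOn (s := univ)
      fun X _ => isUnit_one_sub_toCLM hA hinj X).congr fun X _ => ?_
    exact subOne_cayleyGroup hA hinj X
  exists_ambient := by
    refine ⟨cayleyInv, _, isOpen_cayleyInv_source, contDiffOn_cayleyInv, fun G hG => ⟨?_, rfl⟩⟩
    rw [mem_ofPred, two_add_subOne]
    exact hG

/-- The left translates of the Cayley chart. -/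
def translatedChart (hA : A.IsPositive) (hinj : Function.Injective A) (G : RestrictedGroup A p) :
    OpenPartialHomeomorph (RestrictedGroup A p) (antisymmSchatten A p) :=
  (Homeomorph.mulLeft G⁻¹).toOpenPartialHomeomorph.trans (cayleyChart hA hinj)

lemma isEmbeddedChart_translatedChart (G : RestrictedGroup A p) :
    IsEmbeddedChart subOne (antisymmSchatten A p) (translatedChart hA hinj G) := by
  refine (isEmbeddedChart_cayleyChart hA hinj).comp_homeomorph _
    (a := fun g => lmul H p (G⁻¹).toCLM g + (G⁻¹).subOne)
    (b := fun g => lmul H p G.toCLM g + G.subOne) ?_ ?_ (fun K => ?_) (fun K => ?_)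
  · exact (lmul H p _).contDiff.add contDiff_const
  · exact (lmul H p _).contDiff.add contDiff_const
  · exact subOne_mul' _ _
  · rw [← subOne_mul', Homeomorph.mulLeft_symm, inv_inv]
    rfl

lemma mem_translatedChart_source (G : RestrictedGroup A p) :
    G ∈ (translatedChart hA hinj G).source := by
  have h : IsUnit ((G⁻¹ * G).toCLM + 1) := by
    rw [inv_mul_cancel, toCLM_one, one_add_one_eq_two]
    exact isUnit_two
  simpa [translatedChart, cayleyChart] using h

/-- The group operations are continuous, so by `contMDiff_of_comp` it suffices that they are
polynomial and rational expressions in the coordinates G - 1. -/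
lemma lieGroup_of_isEmbeddedChart [ChartedSpace (antisymmSchatten A p) (RestrictedGroup A p)]
    (hat : ∀ c ∈ atlas (antisymmSchatten A p) (RestrictedGroup A p),
      IsEmbeddedChart subOne (antisymmSchatten A p) c) :
    LieGroup 𝓘(ℝ, antisymmSchatten A p) ∞ (RestrictedGroup A p) := by
  have hM := isManifold_of_isEmbeddedChart hat
  have hι := contMDiff_of_isEmbeddedChart hat
  refine { hM with contMDiff_mul := ?_, contMDiff_inv := ?_ }
  · refine contMDiff_of_comp hat continuous_mul ?_
    have h1 := contDiff_subOne_mul.contMDiff.comp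
      (ContMDiff.prodMk_space (hι.comp contMDiff_fst) (hι.comp contMDiff_snd))
    exact h1.congr fun x => subOne_mul x.1 x.2
  · refine contMDiff_of_comp hat continuous_inv ?_
    have h1 : ContMDiff 𝓘(ℝ, antisymmSchatten A p) 𝓘(ℝ, SchattenClass H p) ∞ _ :=
      contMDiffOn_univ.1 (contDiffOn_subOne_inv.contMDiffOn.comp hι.contMDiffOn
        fun G _ => isUnit_one_add_subOne G)
    exact h1.congr fun x => subOne_inv x

end Group

/-! ### The entire function (exp x - 1) / x of an operator -/

section Exponential

variable {H : Type u} [NormedAddCommGroup H] [InnerProductSpace ℂ H] [CompleteSpace H]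

open scoped Nat in
/-- The entire function `(exp x - 1) / x`. -/
def expSubOneDiv (x : H →L[ℂ] H) : H →L[ℂ] H :=
  FormalMultilinearSeries.ofScalarsSum (fun n : ℕ => (((n + 1) ! : ℕ) : ℝ)⁻¹) x

open scoped Nat in
lemma radius_expSubOneDiv : (FormalMultilinearSeries.ofScalars (H →L[ℂ] H)
    (fun n : ℕ => (((n + 1) ! : ℕ) : ℝ)⁻¹)).radius = ⊤ := by
  refine FormalMultilinearSeries.ofScalars_radius_eq_top_of_tendsto _ _ ?_ ?_
  · exact Eventually.of_forall fun n => by positivity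
  · have h : ∀ n : ℕ, ‖(((n.succ + 1) ! : ℕ) : ℝ)⁻¹‖ / ‖(((n + 1) ! : ℕ) : ℝ)⁻¹‖ =
        1 / ((n + 1 : ℕ) + 1 : ℝ) := by
      intro n
      have h1 : (((n + 1) ! : ℕ) : ℝ) ≠ 0 := by positivity
      have h2 : ((n : ℝ) + 1 + 1) ≠ 0 := by positivity
      rw [Nat.succ_eq_add_one, Nat.factorial_succ (n + 1), norm_inv, norm_inv, Real.norm_natCast,
        Real.norm_natCast]
      push_cast
      field_simp
    simp_rw [h]
    exact (tendsto_add_atTop_iff_nat (f := fun n : ℕ => 1 / ((n : ℝ) + 1)) 1).2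
      tendsto_one_div_add_atTop_nhds_zero_nat

open scoped Nat in
lemma contDiff_expSubOneDiv : ContDiff ℝ ∞ (expSubOneDiv : (H →L[ℂ] H) → _) := by
  have h := FormalMultilinearSeries.hasFPowerSeriesOnBall
    (FormalMultilinearSeries.ofScalars (H →L[ℂ] H) (fun n : ℕ => (((n + 1) ! : ℕ) : ℝ)⁻¹))
    (by rw [radius_expSubOneDiv]; simp)
  have h1 := h.analyticOnNhd
  rw [radius_expSubOneDiv, Metric.eball_top] at h1
  rw [← contDiffOn_univ]
  exact h1.contDiffOn uniqueDiffOn_univ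

lemma expSubOneDiv_zero : expSubOneDiv (0 : H →L[ℂ] H) = 1 := by
  rw [expSubOneDiv, FormalMultilinearSeries.ofScalarsSum_zero]
  simp

/-- Splitting off one factor x puts exp x - 1 in the Schatten class and makes it smooth in the
p-norm, while the power series itself is only needed for the operator norm. -/
lemma mul_expSubOneDiv (x : H →L[ℂ] H) : x * expSubOneDiv x = NormedSpace.exp x - 1 := by
  have h1 := (NormedSpace.exp_series_hasSum_exp' (𝕂 := ℝ) x)
  have h2 := (hasSum_nat_add_iff' 1).2 h1
  have h3 : Summable fun n : ℕ => ((((n + 1).factorial : ℕ) : ℝ)⁻¹) • x ^ n := by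
    have h := FormalMultilinearSeries.hasFPowerSeriesOnBall
      (FormalMultilinearSeries.ofScalars (H →L[ℂ] H)
        (fun n : ℕ => (((n + 1).factorial : ℕ) : ℝ)⁻¹))
      (by rw [radius_expSubOneDiv]; simp)
    have h' := h.hasSum (y := x) (by rw [radius_expSubOneDiv]; simp)
    simp only [FormalMultilinearSeries.ofScalars_apply_eq] at h'
    exact h'.summable
  have h4 := h3.hasSum.mul_left x
  rw [← FormalMultilinearSeries.ofScalars_sum_eq] at h4
  refine h4.unique ?_
  convert! h2 using 2 with n
  · rw [mul_smul_comm, pow_succ']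
  · simp

end Exponential

/-! ### The exponential map as a local diffeomorphism at 0 -/

section ExpGroup

variable {H : Type u} [NormedAddCommGroup H] [InnerProductSpace ℂ H] [CompleteSpace H]
  {A : H →L[ℂ] H} {p : ℝ≥0∞} [hp : Fact (1 ≤ p)]

lemma toCLM_rmul_expSubOneDiv (X : SchattenClass H p) :
    toCLM (rmul H p (expSubOneDiv (toCLM X)) X) = NormedSpace.exp (toCLM X) - 1 := by
  rw [toCLM_rmul, mul_expSubOneDiv]

/-- The exponential map `𝔤_p → 𝒢_{p,A}`. -/
def expGroup (X : antisymmSchatten A p) : RestrictedGroup A p :=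
  letI := NormedAlgebra.restrictScalars ℚ ℂ (H →L[ℂ] H)
  ofInverse (NormedSpace.exp (toCLM X.1)) (NormedSpace.exp (-toCLM X.1))
    (by rw [← NormedSpace.exp_add_of_commute (Commute.neg_right rfl), add_neg_cancel,
      NormedSpace.exp_zero])
    (by rw [← NormedSpace.exp_add_of_commute (Commute.neg_left rfl), neg_add_cancel,
      NormedSpace.exp_zero])
    (by
      -- Anti-symmetry says that A intertwines X and -X*; hence it intertwines their exponentials,
      -- which is exp(X)* A exp(X) = A.
      have h : SemiconjBy A (toCLM X.1) (-star (toCLM X.1)) := by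
        have := isAAntisymm X
        unfold IsAAntisymm at this
        rw [SemiconjBy, neg_mul, ContinuousLinearMap.star_eq_adjoint, this, neg_neg]
      have h1 := h.exp_neg_mul_mul_exp_eq_self
      rwa [neg_neg, ← NormedSpace.star_exp] at h1)
    (by rw [← toCLM_rmul_expSubOneDiv]; exact SchattenClass.memSchatten _)

lemma toCLM_expGroup (X : antisymmSchatten A p) :
    (expGroup X).toCLM = NormedSpace.exp (toCLM X.1) := rfl

lemma subOne_expGroup (X : antisymmSchatten A p) :
    (expGroup X).subOne = rmul H p (expSubOneDiv (toCLM X.1)) X.1 := by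
  apply SchattenClass.toCLM_injective
  rw [toCLM_subOne, toCLM_expGroup, toCLM_rmul_expSubOneDiv]

lemma contDiff_rmul_expSubOneDiv :
    ContDiff ℝ ∞ fun X : SchattenClass H p => rmul H p (expSubOneDiv (toCLM X)) X :=
  contDiffOn_univ.1 (contDiffOn_rmul
    (contDiff_expSubOneDiv.comp (incl H p).contDiff).contDiffOn contDiff_id.contDiffOn)

lemma isOpen_isUnit_expGroup_add_one :
    IsOpen {X : antisymmSchatten A p | IsUnit ((expGroup X).toCLM + 1)} := by
  simp_rw [← two_add_subOne, subOne_expGroup]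
  exact isOpen_cayleyInv_source.preimage
    (contDiff_rmul_expSubOneDiv.continuous.comp continuous_subtype_val)

lemma contDiffOn_toLie_expGroup : ContDiffOn ℝ ∞ (fun X : antisymmSchatten A p =>
    (expGroup X).toLie) {X | IsUnit ((expGroup X).toCLM + 1)} := by
  refine contDiffOn_of_linearIsometry_comp (antisymmSchatten A p).subtypeₗᵢ
    isOpen_isUnit_expGroup_add_one ?_
  refine (contDiffOn_cayleyInv.comp (contDiff_rmul_expSubOneDiv.comp
    (antisymmSchatten A p).subtypeL.contDiff).contDiffOn fun X hX => ?_).congr fun X _ => ?_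
  · rw [mem_ofPred, ← two_add_subOne, subOne_expGroup] at hX
    exact hX
  · exact congrArg cayleyInv (subOne_expGroup X)

lemma hasFDerivAt_rmul_expSubOneDiv_zero :
    HasFDerivAt (fun X : SchattenClass H p => rmul H p (expSubOneDiv (toCLM X)) X)
      (ContinuousLinearMap.id ℝ (SchattenClass H p)) 0 := by
  have hd : DifferentiableAt ℝ (fun X : SchattenClass H p => expSubOneDiv (toCLM X)) 0 :=
    (contDiff_expSubOneDiv.comp (incl H p).contDiff).differentiable (by simp) 0
  refine (hasFDerivAt_rmul_zero hd (hasFDerivAt_id (0 : SchattenClass H p)) rfl).congr_fderiv ?_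
  rw [map_zero, expSubOneDiv_zero]
  ext v
  apply SchattenClass.toCLM_injective
  simp only [ContinuousLinearMap.comp_apply, ContinuousLinearMap.id_apply, toCLM_rmul, mul_one]

/-- The map X ↦ exp X - 1 has derivative 1 at 0, and the inverse Cayley transform contributes 1 / 2.
Invertibility of this factor is all that the inverse function theorem needs. -/
lemma hasFDerivAt_toLie_expGroup : HasFDerivAt (fun X : antisymmSchatten A p => (expGroup X).toLie)
    ((1 / 2 : ℝ) • ContinuousLinearMap.id ℝ (antisymmSchatten A p)) 0 := by
  refine hasFDerivAt_of_linearIsometry_comp (antisymmSchatten A p).subtypeₗᵢ ?_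
  let F : SchattenClass H p → SchattenClass H p := fun X => rmul H p (expSubOneDiv (toCLM X)) X
  have hF : F 0 = 0 := map_zero _
  have h1 : HasFDerivAt (cayleyInv ∘ F) (((1 / 2 : ℝ) • ContinuousLinearMap.id ℝ _).comp
      (ContinuousLinearMap.id ℝ (SchattenClass H p))) 0 :=
    HasFDerivAt.comp (0 : SchattenClass H p) (by rw [hF]; exact hasFDerivAt_cayleyInv_zero)
      hasFDerivAt_rmul_expSubOneDiv_zero
  have h2 : HasFDerivAt ((cayleyInv ∘ F) ∘ (antisymmSchatten A p).subtypeL) _ 0 :=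
    HasFDerivAt.comp (0 : antisymmSchatten A p) (by rw [map_zero]; exact h1)
      (antisymmSchatten A p).subtypeL.hasFDerivAt
  have h3 : (fun X : antisymmSchatten A p =>
      (antisymmSchatten A p).subtypeₗᵢ (expGroup X).toLie) =
        (cayleyInv ∘ F) ∘ (antisymmSchatten A p).subtypeL :=
    funext fun X => congrArg cayleyInv (subOne_expGroup X)
  rw [h3]
  exact h2

lemma expGroup_zero : expGroup (0 : antisymmSchatten A p) = 1 := by
  apply RestrictedGroup.toCLM_injective
  rw [toCLM_expGroup, toCLM_one]
  simp [NormedSpace.exp_zero]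

lemma isLocalDiffeomorphAt_expGroup (hA : A.IsPositive) (hinj : Function.Injective A)
    [ChartedSpace (antisymmSchatten A p) (RestrictedGroup A p)]
    (hat : ∀ c ∈ atlas (antisymmSchatten A p) (RestrictedGroup A p),
      IsEmbeddedChart subOne (antisymmSchatten A p) c) :
    IsLocalDiffeomorphAt 𝓘(ℝ, antisymmSchatten A p) 𝓘(ℝ, antisymmSchatten A p) ∞
      (expGroup : antisymmSchatten A p → RestrictedGroup A p) 0 := by
  have hM := isManifold_of_isEmbeddedChart hat
  have h0 : IsUnit ((expGroup (0 : antisymmSchatten A p)).toCLM + 1) := by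
    rw [expGroup_zero, toCLM_one, one_add_one_eq_two]
    exact isUnit_two
  let f' : antisymmSchatten A p ≃L[ℝ] antisymmSchatten A p :=
    ContinuousLinearEquiv.smulLeft (Units.mk0 (1 / 2 : ℝ) (by norm_num))
  obtain ⟨τ, hτ0, hτU, hτ, hτs, hτs'⟩ := exists_smooth_openPartialHomeomorph
    isOpen_isUnit_expGroup_add_one h0 contDiffOn_toLie_expGroup (f' := f')
    hasFDerivAt_toLie_expGroup
  have hc := (isEmbeddedChart_cayleyChart (p := p) hA hinj).mem_maximalAtlas hat
  let φ := τ.trans (cayleyChart hA hinj).symm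
  have hφt : φ.target ⊆ (cayleyChart hA hinj).source ∩ cayleyChart hA hinj ⁻¹' τ.target := by
    intro G hG
    simpa [φ, OpenPartialHomeomorph.trans_target] using hG
  refine ⟨⟨φ.toPartialEquiv, φ.open_source, φ.open_target, ?_, ?_⟩, ?_, ?_⟩
  · exact (contMDiffOn_symm_of_mem_maximalAtlas hc).comp (hτs.contMDiffOn.mono fun x hx => hx.1)
      fun x _ => mem_univ _
  · exact hτs'.contMDiffOn.comp ((contMDiffOn_of_mem_maximalAtlas hc).mono fun x hx => (hφt hx).1)
      fun x hx => (hφt hx).2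
  · exact ⟨hτ0, mem_univ _⟩
  · intro X hX
    refine ((cayleyGroup_toLie hA hinj (hτU hX.1)).symm).trans ?_
    exact congrArg (cayleyGroup hA hinj) (hτ X).symm

end ExpGroup

/-! ### Connectedness of 𝒢_{p,A} -/

section Connected

variable {H : Type u} [NormedAddCommGroup H] [InnerProductSpace ℂ H] [CompleteSpace H]
  {A : H →L[ℂ] H} {p : ℝ≥0∞} [hp : Fact (1 ≤ p)]

/-- The orthogonal projection to a finite-dimensional subspace for `⟨A x, y⟩`. -/
lemma exists_isASymm_projection (hA : A.IsPositive) (hinj : Function.Injective A)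
    (N : Submodule ℂ H) [FiniteDimensional ℂ N] :
    ∃ P : H →L[ℂ] H, (∀ x, P x ∈ N) ∧ (∀ x ∈ N, P x = x) ∧ IsASymm A P := by
  -- Since H need not be complete for ⟨A x, y⟩, the projection is built by hand: the compression C
  -- of A to N is injective, hence invertible in finite dimension, and P = C⁻¹ J* A with J the
  -- inclusion of N.
  let C : N →L[ℂ] N := N.subtypeL.adjoint ∘L A ∘L N.subtypeL
  have hC : Function.Injective C.toLinearMap := by
    rw [← LinearMap.ker_eq_bot, LinearMap.ker_eq_bot']
    intro x hx
    have h1 : ⟪C x, x⟫_ℂ = 0 := by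
      rw [show C x = 0 from hx, inner_zero_left]
    rw [ContinuousLinearMap.comp_apply, ContinuousLinearMap.adjoint_inner_left] at h1
    exact Subtype.ext (eq_zero_of_inner_eq_zero hA hinj h1)
  let e := LinearEquiv.ofInjectiveEndo C.toLinearMap hC
  let P : H →L[ℂ] H :=
    N.subtypeL ∘L e.symm.toLinearMap.toContinuousLinearMap ∘L N.subtypeL.adjoint ∘L A
  have hPC : ∀ x, C (e.symm (N.subtypeL.adjoint (A x))) = N.subtypeL.adjoint (A x) :=
    fun x => e.apply_symm_apply _
  have hPN : ∀ x, P x ∈ N := fun x => (e.symm (N.subtypeL.adjoint (A x))).2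
  -- That is, x - P x is orthogonal to N for the form; symmetry of P follows.
  have horth : ∀ x y, ⟪A (P x), P y⟫_ℂ = ⟪A x, P y⟫_ℂ := by
    intro x y
    have h1 := congrArg (fun z : N => ⟪z, (⟨P y, hPN y⟩ : N)⟫_ℂ) (hPC x)
    simp only [C, ContinuousLinearMap.comp_apply, ContinuousLinearMap.adjoint_inner_left] at h1
    exact h1
  have hAs : ∀ x y, ⟪A x, y⟫_ℂ = ⟪x, A y⟫_ℂ := fun x y => hA.isSymmetric x y
  refine ⟨P, hPN, fun x hx => ?_, ?_⟩
  · have : e.symm (N.subtypeL.adjoint (A x)) = ⟨x, hx⟩ := by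
      rw [LinearEquiv.symm_apply_eq]
      rfl
    exact congrArg Subtype.val this
  · unfold IsASymm
    ext x
    refine ext_inner_right ℂ fun y => ?_
    rw [mul_apply_eq_comp, mul_apply_eq_comp, ContinuousLinearMap.adjoint_inner_left, ← horth,
      hAs, ← inner_conj_symm, horth, inner_conj_symm, hAs]

/-- On this kernel the compact operator G - 1 is multiplication by -2. The identity of the kernel is
thus compact, and Riesz's theorem applies. -/
lemma finiteDimensional_ker_add_one (G : RestrictedGroup A p) :
    FiniteDimensional ℂ (LinearMap.ker (G.toCLM + 1).toLinearMap) := by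
  set N := LinearMap.ker (G.toCLM + 1).toLinearMap with hN
  have hcl : IsClosed (N : Set H) := (G.toCLM + 1).isClosed_ker
  have : CompleteSpace N := hcl.completeSpace_coe
  have hx : ∀ x ∈ N, (G.toCLM - 1) x = (-2 : ℂ) • x := by
    intro x hx
    have h1 : G.toCLM x + x = 0 := hx
    rw [sub_apply, eq_neg_of_add_eq_zero_left h1, one_apply_eq_self]
    module
  have hmap : ∀ x ∈ N, (G.toCLM - 1).toLinearMap x ∈ N := fun x hxN => by
    rw [ContinuousLinearMap.coe_coe, hx x hxN]
    exact N.smul_mem _ hxN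
  have hc : IsCompactOperator ((G.toCLM - 1).toLinearMap.restrict hmap) :=
    IsCompactOperator.restrict' (f := (G.toCLM - 1).toLinearMap) G.memSchatten.1 hmap
  have h1 : (id : N → N) = (-1 / 2 : ℂ) • ((G.toCLM - 1).toLinearMap.restrict hmap : N → N) := by
    ext x
    have h2 := hx x x.2
    simp only [id, Pi.smul_apply, Submodule.coe_smul, LinearMap.coe_restrict_apply,
      ContinuousLinearMap.coe_coe, h2, smul_smul]
    norm_num
  refine FiniteDimensional.of_isCompactOperator_id (𝕜 := ℂ) ?_
  rw [h1]
  exact hc.smul _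

/-- The element `1 + c P` of `𝒢_{p,A}`, for `|1 + c| = 1` and an `A`-symmetric idempotent `P`. -/
def rotation {P : H →L[ℂ] H} (hP : P * P = P) (hPA : IsASymm A P) (hPS : MemSchatten p P) {c : ℂ}
    (hc : c + star c + star c * c = 0) : RestrictedGroup A p :=
  have key : ∀ a b : ℂ, a + b + b * a = 0 → (1 + b • P) * (1 + a • P) = 1 := by
    intro a b h
    have : (1 + b • P) * (1 + a • P) = 1 + (a + b + b * a) • P := by
      simp only [add_mul, mul_add, one_mul, mul_one, smul_mul_smul_comm, hP, add_smul]
      abel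
    rw [this, h, zero_smul, add_zero]
  ofInverse (1 + c • P) (1 + star c • P) (key _ _ (by linear_combination hc)) (key _ _ hc)
    (by
      have hPA' : star P * A = A * P := hPA
      have h : star (1 + c • P) * A = A * (1 + star c • P) := by
        rw [star_add, star_one, star_smul, add_mul, one_mul, smul_mul_assoc, hPA', mul_add, mul_one,
          mul_smul_comm]
      rw [← ContinuousLinearMap.star_eq_adjoint, h, mul_assoc, key _ _ hc, mul_one])
    (by rw [add_sub_cancel_left]; exact hPS.smul hp.out c)

lemma toCLM_rotation {P : H →L[ℂ] H} (hP : P * P = P) (hPA : IsASymm A P) (hPS : MemSchatten p P)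
    {c : ℂ} (hc : c + star c + star c * c = 0) :
    (rotation hP hPA hPS hc).toCLM = 1 + c • P := rfl

lemma exp_mul_I_sub_one (t : ℝ) : (Complex.exp (t * Complex.I) - 1) +
    star (Complex.exp (t * Complex.I) - 1) +
    star (Complex.exp (t * Complex.I) - 1) * (Complex.exp (t * Complex.I) - 1) = 0 := by
  have h : star (Complex.exp (t * Complex.I)) * Complex.exp (t * Complex.I) = 1 := by
    have := Complex.conj_mul' (Complex.exp (t * Complex.I))
    rw [Complex.norm_exp_ofReal_mul_I] at this
    simpa using this
  rw [star_sub, star_one]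
  linear_combination h

lemma continuous_rotation {P : H →L[ℂ] H} (hP : P * P = P) (hPA : IsASymm A P)
    (hPS : MemSchatten p P) :
    Continuous fun t : ℝ => rotation hP hPA hPS (exp_mul_I_sub_one t) := by
  rw [isInducing_subOne.continuous_iff]
  have h : Continuous fun t : ℝ => (Complex.exp (t * Complex.I) - 1) • SchattenClass.mk P hPS := by
    fun_prop
  refine h.congr fun t => ?_
  apply SchattenClass.toCLM_injective
  rw [Function.comp_apply, toCLM_subOne, toCLM_rotation, add_sub_cancel_left, map_smul, toCLM_mk]

/-- The image of the Cayley transform is connected and contains 1. An element G is joined to it by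
the path G (1 + (e^{it} - 1) P), where P projects onto the eigenspace N of G for -1: at t = π the
eigenvalue -1 on N has turned into 1. -/
theorem preconnectedSpace_restrictedGroup (hA : A.IsPositive) (hinj : Function.Injective A) :
    PreconnectedSpace (RestrictedGroup A p) := by
  have hrange : IsPreconnected (range (cayleyGroup (p := p) hA hinj)) := by
    rw [← image_univ]
    exact isPreconnected_univ.image _ (continuous_cayleyGroup hA hinj).continuousOn
  have h1 : (1 : RestrictedGroup A p) ∈ range (cayleyGroup (p := p) hA hinj) :=
    ⟨0, cayleyGroup_zero _ _⟩
  have key : ∀ G : RestrictedGroup A p, G ∈ connectedComponent 1 := by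
    intro G
    set N := LinearMap.ker (G.toCLM + 1).toLinearMap with hN
    have := finiteDimensional_ker_add_one G
    have hNmem : ∀ x, x ∈ N ↔ G.toCLM x = -x := fun x => by
      rw [hN, LinearMap.mem_ker, ← add_eq_zero_iff_eq_neg]
      rfl
    obtain ⟨P, hPN, hPx, hPA⟩ := exists_isASymm_projection hA hinj N
    have hP : P * P = P := by
      ext x
      exact hPx _ (hPN x)
    have hGP : ∀ x, G.toCLM (P x) = -P x := fun x => (hNmem _).1 (hPN x)
    have hPS : MemSchatten p P := by
      have h2 : P = (-1 / 2 : ℂ) • (SchattenClass.toCLM G.subOne * P) := by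
        ext x
        rw [toCLM_subOne, smul_apply, mul_apply_eq_comp, sub_apply, hGP, one_apply_eq_self]
        module
      rw [h2]
      exact (memSchatten_mul_right _ _).smul hp.out _
    -- The identity G P = -P is passed to adjoints for the form: A (P + P G) = P* (G + 1)* A G = 0,
    -- and injectivity of A removes the factor A.
    have hPG : P * G.toCLM = -P := by
      have h2 : (G.toCLM + 1) * P = 0 := by
        ext x
        rw [mul_apply_eq_comp, add_apply, hGP, one_apply_eq_self, neg_add_cancel]
        rfl
      have h3 : star P * star (G.toCLM + 1) = 0 := by rw [← star_mul, h2, star_zero]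
      have hG : star G.toCLM * A * G.toCLM = A := G.adjoint_mul_mul
      have hPA' : star P * A = A * P := hPA
      have h4 : A * (P + P * G.toCLM) = 0 := by
        calc A * (P + P * G.toCLM) = star P * A + star P * A * G.toCLM := by
              rw [hPA', mul_add, mul_assoc]
          _ = star P * (star G.toCLM * A * G.toCLM) + star P * A * G.toCLM := by rw [hG]
          _ = star P * star (G.toCLM + 1) * A * G.toCLM := by
              rw [star_add, star_one]
              noncomm_ring
          _ = 0 := by rw [h3, zero_mul, zero_mul]
      have h5 : P + P * G.toCLM = 0 := by
        ext x
        apply hinj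
        have := congrArg (fun T : H →L[ℂ] H => T x) h4
        simpa using this
      exact eq_neg_of_add_eq_zero_right h5
    let γ : ℝ → RestrictedGroup A p := fun t => G * rotation hP hPA hPS (exp_mul_I_sub_one t)
    have hγ : IsPreconnected (range γ) := by
      rw [← image_univ]
      exact isPreconnected_univ.image _
        (continuous_const.mul (continuous_rotation hP hPA hPS)).continuousOn
    have hγ0 : γ 0 = G := by
      apply RestrictedGroup.toCLM_injective
      simp [γ, toCLM_rotation]
    -- At π the path is at G (1 - 2 P), and it remains to exclude the eigenvalue -1. If G (x - 2 P
    -- x) = -x, applying P gives P x = -P x, so P x = 0. Then G x = -x, that is x ∈ N, and x = P x =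
    -- 0.
    have hγπ : γ Real.pi ∈ range (cayleyGroup (p := p) hA hinj) := by
      refine ⟨_, cayleyGroup_toLie _ _ ?_⟩
      have h2 : (γ Real.pi).toCLM + 1 =
          (2 : ℂ) • (1 : H →L[ℂ] H) + SchattenClass.toCLM (γ Real.pi).subOne := by
        rw [toCLM_subOne, two_smul]
        abel
      rw [h2]
      refine isUnit_smul_one_add_of_compact (isCompactOperator _) two_ne_zero fun x hx => ?_
      have h3 : G.toCLM (x - (2 : ℂ) • P x) = -x := by
        have h4 : (γ Real.pi).toCLM x = G.toCLM (x - (2 : ℂ) • P x) := by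
          simp only [γ, toCLM_mul, toCLM_rotation, Complex.exp_pi_mul_I, mul_apply_eq_comp]
          congr 1
          rw [add_apply, smul_apply, one_apply_eq_self]
          module
        rw [← h4]
        rw [toCLM_subOne, sub_apply, one_apply_eq_self] at hx
        have : x + (γ Real.pi).toCLM x = 0 := by
          rw [← hx]
          module
        exact eq_neg_of_add_eq_zero_right this
      have h5 := congrArg P h3
      have h6 : P (G.toCLM (x - (2 : ℂ) • P x)) = P x := by
        rw [← mul_apply_eq_comp, hPG, neg_apply, map_sub, map_smul, hPx _ (hPN x)]
        module
      rw [h6, map_neg, eq_neg_iff_add_eq_zero, ← two_smul ℂ, smul_eq_zero_iff_right two_ne_zero] at h5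
      rw [h5, smul_zero, sub_zero] at h3
      rw [← hPx x ((hNmem x).2 h3), h5]
    have h2 : γ Real.pi ∈ connectedComponent (1 : RestrictedGroup A p) :=
      hrange.subset_connectedComponent h1 hγπ
    rw [connectedComponent_eq h2, ← hγ0]
    exact hγ.subset_connectedComponent (mem_range_self _) (mem_range_self _)
  refine ⟨?_⟩
  have : (univ : Set (RestrictedGroup A p)) = connectedComponent 1 :=
    (eq_univ_of_forall key).symm
  rw [this]
  exact isPreconnected_connectedComponent

end Connected

/-! ### The action of 𝒢_{p,A} on the restricted Grassmannian -/

section Grassmannian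

variable {H : Type u} [NormedAddCommGroup H] [InnerProductSpace ℂ H] [CompleteSpace H]
  {A : H →L[ℂ] H} {p : ℝ≥0∞} [hp : Fact (1 ≤ p)] {Q₀ : CompatibleGrassmannian A}

/-- Clearing the inverse on both sides leaves w* A (c + s w) = (c + s w)* A w, where both sides are
A (c w + w s w). The straightening uses c = 2, s = ε, and its inverse c = 1, s = -ε. -/
lemma isASymm_mul_inverse {w c s : H →L[ℂ] H} (hw : IsASymm A w) (hc : IsASymm A c)
    (hs : IsASymm A s) (hcw : Commute c w) : IsASymm A (w * Ring.inverse (c + s * w)) := by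
  by_cases hu : IsUnit (c + s * w)
  · unfold IsASymm at *
    rw [← ContinuousLinearMap.star_eq_adjoint] at *
    set y := w * Ring.inverse (c + s * w) with hy
    have hyu : y * (c + s * w) = w := by
      rw [hy, mul_assoc, Ring.inverse_mul_cancel _ hu, mul_one]
    have hyu' : star (c + s * w) * star y = star w := by rw [← star_mul, hyu]
    apply hu.star.mul_left_cancel
    apply hu.mul_right_cancel
    calc star (c + s * w) * (star y * A) * (c + s * w)
        = star w * A * (c + s * w) := by rw [← mul_assoc, hyu']
      _ = star (c + s * w) * A * w := by
          rw [star_add, star_mul, add_mul, add_mul, hc, mul_add]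
          congr 1
          · rw [hw, mul_assoc, ← hcw.eq, ← mul_assoc]
          · rw [mul_assoc (star w) (star s) A, hs]
            simp only [mul_assoc]
      _ = star (c + s * w) * A * (y * (c + s * w)) := by rw [hyu]
      _ = star (c + s * w) * (A * y) * (c + s * w) := by simp only [mul_assoc]
  · simp [Ring.inverse_non_unit _ hu, IsASymm]

lemma isASymm_one : IsASymm A 1 := by
  simp [IsASymm, ← ContinuousLinearMap.star_eq_adjoint]

lemma IsASymm.add {B C : H →L[ℂ] H} (hB : IsASymm A B) (hC : IsASymm A C) :
    IsASymm A (B + C) := by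
  unfold IsASymm at *
  rw [map_add, add_mul, mul_add, hB, hC]

lemma IsASymm.neg {B : H →L[ℂ] H} (hB : IsASymm A B) : IsASymm A (-B) := by
  unfold IsASymm at *
  rw [map_neg, neg_mul, mul_neg, hB]

lemma isASymm_two : IsASymm A 2 := by
  rw [← one_add_one_eq_two]
  exact isASymm_one.add isASymm_one

lemma isASymm_toCLM (X : symmSchatten A p) : IsASymm A (toCLM X.1) := X.2

namespace RestrictedGrassmannian

omit hp in
lemma proj_mul_self (Q : RestrictedGrassmannian A p Q₀) : Q.proj * Q.proj = Q.proj := Q.1.2.1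

omit hp in
lemma isASymm_proj (Q : RestrictedGrassmannian A p Q₀) : IsASymm A Q.proj := Q.1.2.2

omit hp in
lemma proj_injective : Function.Injective (proj : RestrictedGrassmannian A p Q₀ → H →L[ℂ] H) :=
  fun _ _ h => Subtype.ext (Subtype.ext h)

lemma toCLM_sub (Q : RestrictedGrassmannian A p Q₀) : toCLM Q.sub.1 = Q.proj - Q₀.proj := rfl

lemma isInducing_sub :
    IsInducing (sub : RestrictedGrassmannian A p Q₀ → symmSchatten A p) := ⟨rfl⟩

/-- The symmetry `2 Q - 1`. -/
def reflection (Q : RestrictedGrassmannian A p Q₀) : H →L[ℂ] H := Q.proj + Q.proj - 1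

omit hp in
@[simp] lemma reflection_mul_self (Q : RestrictedGrassmannian A p Q₀) :
    Q.reflection * Q.reflection = 1 := by
  simp only [reflection, mul_sub, sub_mul, mul_add, add_mul, Q.proj_mul_self, one_mul, mul_one]
  abel

omit hp in
@[simp] lemma reflection_mul_reflection_mul (Q : RestrictedGrassmannian A p Q₀) (B : H →L[ℂ] H) :
    Q.reflection * (Q.reflection * B) = B := by
  rw [← mul_assoc, reflection_mul_self, one_mul]

omit hp in
@[simp] lemma mul_reflection_mul_reflection (Q : RestrictedGrassmannian A p Q₀) (B : H →L[ℂ] H) :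
    B * Q.reflection * Q.reflection = B := by
  rw [mul_assoc, reflection_mul_self, mul_one]

omit hp in
lemma isASymm_reflection (Q : RestrictedGrassmannian A p Q₀) : IsASymm A Q.reflection :=
  (Q.isASymm_proj.add Q.isASymm_proj).sub isASymm_one

/-- The point of the restricted Grassmannian with a given idempotent. -/
def ofIdempotent (Z : symmSchatten A p)
    (hZ : (Q₀.proj + toCLM Z.1) * (Q₀.proj + toCLM Z.1) = Q₀.proj + toCLM Z.1) :
    RestrictedGrassmannian A p Q₀ :=
  ⟨⟨Q₀.proj + toCLM Z.1, hZ, Q₀.2.2.add (isASymm_toCLM Z)⟩, by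
    change MemSchatten p (Q₀.proj + toCLM Z.1 - Q₀.proj)
    rw [add_sub_cancel_left]
    exact SchattenClass.memSchatten _⟩

lemma sub_ofIdempotent (Z : symmSchatten A p)
    (hZ : (Q₀.proj + toCLM Z.1) * (Q₀.proj + toCLM Z.1) = Q₀.proj + toCLM Z.1) :
    (ofIdempotent Z hZ).sub = Z := by
  apply Subtype.ext
  apply SchattenClass.toCLM_injective
  exact add_sub_cancel_left _ _

lemma exists_sub_eq_iff (Z : symmSchatten A p) :
    (∃ Q : RestrictedGrassmannian A p Q₀, Q.sub = Z) ↔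
      (Q₀.proj + toCLM Z.1) * (Q₀.proj + toCLM Z.1) = Q₀.proj + toCLM Z.1 := by
  constructor
  · rintro ⟨Q, rfl⟩
    rw [toCLM_sub, add_sub_cancel, Q.proj_mul_self]
  · exact fun h => ⟨ofIdempotent Z h, sub_ofIdempotent Z h⟩

/-- The point `Q₀`. -/
def base (Q₀ : CompatibleGrassmannian A) : RestrictedGrassmannian A p Q₀ :=
  ⟨Q₀, by rw [sub_self]; exact memSchatten_zero hp.out⟩

lemma isASymm_conj (G : RestrictedGroup A p) {B : H →L[ℂ] H} (hB : IsASymm A B) :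
    IsASymm A (G.toCLM * B * (G⁻¹).toCLM) := by
  unfold IsASymm at *
  have h1 := G.adjoint_mul_eq
  have h2 := (G⁻¹).adjoint_mul_eq
  rw [inv_inv] at h2
  rw [← ContinuousLinearMap.star_eq_adjoint] at *
  rw [star_mul, star_mul, mul_assoc, mul_assoc, h1, ← mul_assoc (star B), hB, ← mul_assoc,
    ← mul_assoc, h2]
  simp only [mul_assoc]

lemma memSchatten_conj_sub (G : RestrictedGroup A p) (B : H →L[ℂ] H) :
    MemSchatten p (G.toCLM * B * (G⁻¹).toCLM - B) := by
  have h : G.toCLM * B * (G⁻¹).toCLM - B =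
      toCLM (rmul H p (B * (G⁻¹).toCLM) G.subOne + lmul H p B (G⁻¹).subOne) := by
    rw [map_add, toCLM_rmul, toCLM_lmul, toCLM_subOne, toCLM_subOne]
    noncomm_ring
  rw [h]
  exact SchattenClass.memSchatten _

/-- The action `Q ↦ G Q G⁻¹` of `𝒢_{p,A}`. -/
def conj (G : RestrictedGroup A p) (Q : RestrictedGrassmannian A p Q₀) :
    RestrictedGrassmannian A p Q₀ :=
  ⟨⟨G.toCLM * Q.proj * (G⁻¹).toCLM, by
      calc G.toCLM * Q.proj * (G⁻¹).toCLM * (G.toCLM * Q.proj * (G⁻¹).toCLM)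
          = G.toCLM * Q.proj * ((G⁻¹).toCLM * G.toCLM) * Q.proj * (G⁻¹).toCLM := by
            simp only [mul_assoc]
        _ = G.toCLM * (Q.proj * Q.proj) * (G⁻¹).toCLM := by
            rw [RestrictedGroup.toCLM_inv_mul, mul_one]; simp only [mul_assoc]
        _ = G.toCLM * Q.proj * (G⁻¹).toCLM := by rw [Q.proj_mul_self],
      isASymm_conj G Q.isASymm_proj⟩, by
    have h := (memSchatten_conj_sub G Q.proj).add hp.out Q.memSchatten
    rw [sub_add_sub_cancel] at h
    exact h⟩

lemma proj_conj (G : RestrictedGroup A p) (Q : RestrictedGrassmannian A p Q₀) :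
    (conj G Q).proj = G.toCLM * Q.proj * (G⁻¹).toCLM := rfl

lemma conj_one (Q : RestrictedGrassmannian A p Q₀) : conj 1 Q = Q := by
  apply proj_injective
  rw [proj_conj, inv_one, toCLM_one, one_mul, mul_one]

lemma conj_mul (G K : RestrictedGroup A p) (Q : RestrictedGrassmannian A p Q₀) :
    conj (G * K) Q = conj G (conj K Q) := by
  apply proj_injective
  rw [proj_conj, proj_conj, proj_conj, mul_inv_rev, toCLM_mul, toCLM_mul]
  simp only [mul_assoc]

lemma conj_inv_conj (G : RestrictedGroup A p) (Q : RestrictedGrassmannian A p Q₀) :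
    conj G⁻¹ (conj G Q) = Q := by
  rw [← conj_mul, inv_mul_cancel, conj_one]

lemma conj_conj_inv (G : RestrictedGroup A p) (Q : RestrictedGrassmannian A p Q₀) :
    conj G (conj G⁻¹ Q) = Q := by
  rw [← conj_mul, mul_inv_cancel, conj_one]

/-- `X ↦ G X G⁻¹` on `i 𝔤_p`. -/
def conjLinear (G : RestrictedGroup A p) : symmSchatten A p →L[ℝ] symmSchatten A p :=
  (((lmul H p G.toCLM).comp (rmul H p (G⁻¹).toCLM)).comp (symmSchatten A p).subtypeL).codRestrict
    (symmSchatten A p) fun X => by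
      change IsASymm A (G.toCLM * (toCLM X.1 * (G⁻¹).toCLM))
      rw [← mul_assoc]
      exact isASymm_conj G (isASymm_toCLM X)

/-- The action of `𝒢_{p,A}` on the affine space `Q₀ + i 𝔤_p`. -/
def conjAffine (Q₀ : CompatibleGrassmannian A) (G : RestrictedGroup A p) (Z : symmSchatten A p) :
    symmSchatten A p :=
  conjLinear G Z + (conj G (base Q₀)).sub

lemma contDiff_conjAffine (G : RestrictedGroup A p) : ContDiff ℝ ∞ (conjAffine Q₀ G) :=
  (conjLinear G).contDiff.add contDiff_const

lemma toCLM_conjAffine (G : RestrictedGroup A p) (Z : symmSchatten A p) :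
    Q₀.proj + toCLM (conjAffine Q₀ G Z).1 =
      G.toCLM * (Q₀.proj + toCLM Z.1) * (G⁻¹).toCLM := by
  have h : toCLM (conjAffine Q₀ G Z).1 = G.toCLM * (toCLM Z.1 * (G⁻¹).toCLM) +
      (G.toCLM * Q₀.proj * (G⁻¹).toCLM - Q₀.proj) := rfl
  rw [h]
  noncomm_ring

/-- Conjugation is the restriction of a smooth affine map of i 𝔤_p, so charts and straightenings at
Q₁ can both be transported along its orbit. -/
lemma sub_conj (G : RestrictedGroup A p) (Q : RestrictedGrassmannian A p Q₀) :
    (conj G Q).sub = conjAffine Q₀ G Q.sub := by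
  apply Subtype.ext
  apply SchattenClass.toCLM_injective
  have h := toCLM_conjAffine (Q₀ := Q₀) G Q.sub
  rw [toCLM_sub, add_sub_cancel] at h
  rw [toCLM_sub, proj_conj, ← h, add_sub_cancel_left]

lemma conjAffine_inv_conjAffine (G : RestrictedGroup A p) (Z : symmSchatten A p) :
    conjAffine Q₀ G⁻¹ (conjAffine Q₀ G Z) = Z := by
  apply Subtype.ext
  apply SchattenClass.toCLM_injective
  have h := toCLM_conjAffine (Q₀ := Q₀) G⁻¹ (conjAffine Q₀ G Z)
  rw [inv_inv, toCLM_conjAffine G Z] at h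
  have h1 : (G⁻¹).toCLM * (G.toCLM * (Q₀.proj + toCLM Z.1) * (G⁻¹).toCLM) * G.toCLM =
      ((G⁻¹).toCLM * G.toCLM) * (Q₀.proj + toCLM Z.1) * ((G⁻¹).toCLM * G.toCLM) := by
    simp only [mul_assoc]
  rw [h1, RestrictedGroup.toCLM_inv_mul, one_mul, mul_one] at h
  exact add_left_cancel h

lemma continuous_conj (G : RestrictedGroup A p) :
    Continuous (conj G : RestrictedGrassmannian A p Q₀ → _) := by
  rw [isInducing_sub.continuous_iff]
  refine ((contDiff_conjAffine (Q₀ := Q₀) G).continuous.comp isInducing_sub.continuous).congr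
    fun Q => ?_
  exact (sub_conj G Q).symm

variable (Q₁ : RestrictedGrassmannian A p Q₀)

/-- `V (2 Q₁ - 1) V⁻¹ - (2 Q₁ - 1)`, as a function of `V - 1`. -/
def orbitDisplacement (g : SchattenClass H p) : SchattenClass H p :=
  -- With V = 1 + g this is V ε V⁻¹ - ε = (V - 1) ε + V ε (V⁻¹ - 1), in which each summand has a
  -- Schatten factor.
  rmul H p Q₁.reflection g +
    lmul H p (Q₁.reflection + toCLM g * Q₁.reflection) (-rmul H p (Ring.inverse (1 + toCLM g)) g)

lemma orbitDisplacement_subOne (G : RestrictedGroup A p) :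
    Q₁.orbitDisplacement G.subOne = (2 : ℝ) • ((conj G Q₁).sub.1 - Q₁.sub.1) := by
  apply SchattenClass.toCLM_injective
  rw [orbitDisplacement, ← subOne_inv, map_add, toCLM_rmul, toCLM_lmul, toCLM_real_smul, map_sub,
    toCLM_sub, toCLM_sub, proj_conj, toCLM_subOne, toCLM_subOne, reflection, two_smul]
  have h := G.toCLM_mul_inv
  have h1 : (G.toCLM - 1) * (Q₁.proj + Q₁.proj - 1) + (Q₁.proj + Q₁.proj - 1 + (G.toCLM - 1) *
      (Q₁.proj + Q₁.proj - 1)) * ((G⁻¹).toCLM - 1) =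
      (G.toCLM * Q₁.proj * (G⁻¹).toCLM + G.toCLM * Q₁.proj * (G⁻¹).toCLM -
        G.toCLM * (G⁻¹).toCLM) - (Q₁.proj + Q₁.proj - 1) := by
    noncomm_ring
  rw [h1, h]
  abel

lemma contDiffOn_orbitDisplacement :
    ContDiffOn ℝ ∞ Q₁.orbitDisplacement {g | IsUnit (1 + toCLM g)} := by
  refine (rmul H p Q₁.reflection).contDiff.contDiffOn.add
    (contDiffOn_lmul ?_ contDiffOn_subOne_inv)
  exact (contDiff_const.add ((incl H p).contDiff.mul contDiff_const)).contDiffOn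

lemma hasFDerivAt_orbitDisplacement : HasFDerivAt Q₁.orbitDisplacement
    (rmul H p Q₁.reflection - lmul H p Q₁.reflection) 0 := by
  have h0 : IsUnit (1 + toCLM (0 : SchattenClass H p)) := by simp
  have hd : DifferentiableAt ℝ (fun g : SchattenClass H p => Ring.inverse (1 + toCLM g)) 0 := by
    have h1 : ContDiffOn ℝ ∞ (fun g : SchattenClass H p => Ring.inverse (1 + toCLM g))
        {g | IsUnit (1 + toCLM g)} :=
      contDiffOn_inverse.comp (contDiff_const.add (incl H p).contDiff).contDiffOn fun _ hx => hx
    exact (h1.contDiffAt ((isOpen_setOf_isUnit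
      (continuous_const.add (incl H p).continuous)).mem_nhds h0)).differentiableAt (by simp)
  have h1 : HasFDerivAt (fun g : SchattenClass H p => -rmul H p (Ring.inverse (1 + toCLM g)) g)
      (-ContinuousLinearMap.id ℝ (SchattenClass H p)) 0 := by
    refine (hasFDerivAt_rmul_zero hd (hasFDerivAt_id (0 : SchattenClass H p)) rfl).neg.congr_fderiv
      ?_
    ext v
    apply SchattenClass.toCLM_injective
    simp
  have h2 : HasFDerivAt (fun g : SchattenClass H p =>
      lmul H p (Q₁.reflection + toCLM g * Q₁.reflection))
      ((lmul H p).comp (fderiv ℝ (fun g : SchattenClass H p =>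
        Q₁.reflection + toCLM g * Q₁.reflection) 0)) 0 := by
    refine (lmul H p).hasFDerivAt.comp (0 : SchattenClass H p) (DifferentiableAt.hasFDerivAt ?_)
    exact (contDiff_const.add ((incl H p).contDiff.mul contDiff_const)).differentiable (n := ∞)
      (by simp) 0
  refine ((rmul H p Q₁.reflection).hasFDerivAt.add (h2.clm_apply h1)).congr_fderiv ?_
  ext v
  apply SchattenClass.toCLM_injective
  simp [sub_eq_add_neg]

end RestrictedGrassmannian

end Grassmannian

/-! ### Straightening the Grassmannian at a point -/

section Straightening

variable {H : Type u} [NormedAddCommGroup H] [InnerProductSpace ℂ H] [CompleteSpace H]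
  {A : H →L[ℂ] H} {p : ℝ≥0∞} [hp : Fact (1 ≤ p)] {Q₀ : CompatibleGrassmannian A}

omit [CompleteSpace H] in
lemma add_self_inj {B C : H →L[ℂ] H} : B + B = C + C ↔ B = C := by
  rw [← two_mul, ← two_mul]
  exact isUnit_two.mul_right_inj

omit [CompleteSpace H] in
/-- With `w = 2 X (1 - ε X)⁻¹` for an involution `ε`, the operator `ε + w` is an involution exactly
when `X` anticommutes with `ε`. -/
lemma add_mul_self_eq_one_iff {ε X w : H →L[ℂ] H} (hε : ε * ε = 1) (hX : IsUnit (1 - ε * X))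
    (hw : w * (1 - ε * X) = X + X) : (ε + w) * (ε + w) = 1 ↔ ε * X + X * ε = 0 := by
  have hε' : ∀ B : H →L[ℂ] H, ε * (ε * B) = B := fun B => by rw [← mul_assoc, hε, one_mul]
  have hX' : IsUnit (1 - X * ε) := by
    have hu : IsUnit ε := ⟨⟨ε, ε, hε, hε⟩, rfl⟩
    have h := (hu.mul hX).mul hu
    have h1 : ε * (1 - ε * X) * ε = 1 - X * ε := by
      rw [mul_sub, mul_one, hε', sub_mul, hε]
    rwa [h1] at h
  have h1 : (ε + w) * (1 - ε * X) = ε + X := by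
    rw [add_mul, hw, mul_sub, mul_one, hε']
    abel
  have h2 : (1 - X * ε) * w = X + X := by
    apply hX.mul_right_cancel
    rw [mul_assoc, hw]
    noncomm_ring
  have h3 : (1 - X * ε) * (ε + w) = ε + X := by
    rw [mul_add, h2, sub_mul, mul_assoc, hε]
    noncomm_ring
  -- The outer factors are invertible, so (ε + w)² = 1 becomes an equation between (ε + X)² and (1 -
  -- X ε) (1 - ε X). By ε² = 1 the quadratic terms agree, and twice the anticommutator is left.
  have h4 : (1 - X * ε) * ((ε + w) * (ε + w)) * (1 - ε * X) = (ε + X) * (ε + X) := by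
    calc _ = ((1 - X * ε) * (ε + w)) * ((ε + w) * (1 - ε * X)) := by simp only [mul_assoc]
      _ = _ := by rw [h1, h3]
  have h5 : (ε + X) * (ε + X) - (1 - X * ε) * 1 * (1 - ε * X) =
      (ε * X + X * ε) + (ε * X + X * ε) := by
    simp only [add_mul, mul_add, sub_mul, mul_sub, mul_one, one_mul, hε, mul_assoc, hε']
    abel
  constructor
  · intro h
    rw [h] at h4
    rw [h4, sub_self] at h5
    rw [← add_self_inj, ← h5, add_zero]
  · intro h
    rw [h, add_zero, sub_eq_zero] at h5
    rw [← h4] at h5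
    exact hX'.mul_left_cancel (hX.mul_right_cancel h5)

omit [CompleteSpace H] in
lemma mul_self_eq_self_iff (P : H →L[ℂ] H) :
    P * P = P ↔ (P + P - 1) * (P + P - 1) = 1 := by
  have h : (P + P - 1) * (P + P - 1) = ((P * P + P * P) + (P * P + P * P)) -
      ((P + P) + (P + P)) + 1 := by noncomm_ring
  rw [h, add_eq_right, sub_eq_zero, add_self_inj, add_self_inj]

namespace RestrictedGrassmannian

variable (Q₁ : RestrictedGrassmannian A p Q₀)

lemma lmul_reflection_lmul_reflection (X : SchattenClass H p) :
    lmul H p Q₁.reflection (lmul H p Q₁.reflection X) = X := by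
  apply SchattenClass.toCLM_injective
  simp

/-- The map `Z ↦ w (2 + ε w)⁻¹`, where `ε = 2 Q₁ - 1` and `w` is twice the displacement of `Z` from
`Q₁`. -/
def straighten (Z : symmSchatten A p) : symmSchatten A p :=
  ⟨lmul H p Q₁.reflection (cayleyInv (lmul H p Q₁.reflection ((2 : ℝ) • (Z - Q₁.sub)).1)), by
    change IsASymm A _
    rw [cayleyInv, toCLM_lmul, toCLM_rmul, toCLM_lmul, mul_assoc, reflection_mul_reflection_mul]
    exact isASymm_mul_inverse (isASymm_toCLM _) isASymm_two Q₁.isASymm_reflection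
      (Nat.cast_commute 2 _)⟩

/-- The inverse of `straighten`. -/
def unstraighten (X : symmSchatten A p) : symmSchatten A p :=
  Q₁.sub + (1 / 2 : ℝ) •
    ⟨lmul H p Q₁.reflection (cayley (lmul H p Q₁.reflection X.1)), by
      have h : lmul H p Q₁.reflection (cayley (lmul H p Q₁.reflection X.1)) =
          (2 : ℝ) • rmul H p (Ring.inverse (1 + -Q₁.reflection * toCLM X.1)) X.1 := by
        apply SchattenClass.toCLM_injective
        rw [cayley, toCLM_lmul, toCLM_rmul, toCLM_real_smul, toCLM_real_smul, toCLM_lmul,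
          toCLM_rmul, neg_mul, ← sub_eq_add_neg, smul_mul_assoc, mul_smul_comm, mul_assoc,
          reflection_mul_reflection_mul]
      rw [h]
      refine (symmSchatten A p).smul_mem _ ?_
      change IsASymm A _
      rw [toCLM_rmul]
      exact isASymm_mul_inverse (isASymm_toCLM _) isASymm_one Q₁.isASymm_reflection.neg
        (Commute.one_left _)⟩

lemma coe_straighten (Z : symmSchatten A p) : (Q₁.straighten Z : SchattenClass H p) =
    lmul H p Q₁.reflection (cayleyInv (lmul H p Q₁.reflection ((2 : ℝ) • (Z.1 - Q₁.sub.1)))) :=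
  rfl

lemma coe_unstraighten (X : symmSchatten A p) : (Q₁.unstraighten X : SchattenClass H p) =
    Q₁.sub.1 + (1 / 2 : ℝ) • lmul H p Q₁.reflection (cayley (lmul H p Q₁.reflection X.1)) := rfl

lemma two_smul_unstraighten_sub (X : symmSchatten A p) :
    lmul H p Q₁.reflection ((2 : ℝ) • ((Q₁.unstraighten X).1 - Q₁.sub.1)) =
      cayley (lmul H p Q₁.reflection X.1) := by
  rw [coe_unstraighten, add_sub_cancel_left, smul_smul]
  norm_num
  exact Q₁.lmul_reflection_lmul_reflection _

lemma isOpen_straighten_source : IsOpen {Z : symmSchatten A p |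
    IsUnit (2 + toCLM (lmul H p Q₁.reflection ((2 : ℝ) • (Z.1 - Q₁.sub.1))))} := by
  refine isOpen_cayleyInv_source.preimage (f := fun Z : symmSchatten A p =>
    lmul H p Q₁.reflection ((2 : ℝ) • (Z.1 - Q₁.sub.1))) ?_
  exact (lmul H p Q₁.reflection).continuous.comp
    ((continuous_subtype_val.sub continuous_const).const_smul _)

lemma isOpen_straighten_target : IsOpen {X : symmSchatten A p |
    IsUnit (1 - toCLM (lmul H p Q₁.reflection X.1))} :=
  isOpen_cayley_source.preimage (f := fun X : symmSchatten A p =>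
    lmul H p Q₁.reflection X.1) ((lmul H p Q₁.reflection).continuous.comp continuous_subtype_val)

lemma contDiffOn_straighten : ContDiffOn ℝ ∞ Q₁.straighten {Z : symmSchatten A p |
    IsUnit (2 + toCLM (lmul H p Q₁.reflection ((2 : ℝ) • (Z.1 - Q₁.sub.1))))} := by
  refine contDiffOn_of_linearIsometry_comp (symmSchatten A p).subtypeₗᵢ
    Q₁.isOpen_straighten_source ?_
  refine (lmul H p Q₁.reflection).contDiff.comp_contDiffOn (contDiffOn_cayleyInv.comp
    (f := fun Z : symmSchatten A p => lmul H p Q₁.reflection ((2 : ℝ) • (Z.1 - Q₁.sub.1)))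
    ?_ fun _ h => h)
  exact ((lmul H p Q₁.reflection).contDiff.comp
    (((symmSchatten A p).subtypeL.contDiff.sub contDiff_const).const_smul _)).contDiffOn

lemma contDiffOn_unstraighten : ContDiffOn ℝ ∞ Q₁.unstraighten {X : symmSchatten A p |
    IsUnit (1 - toCLM (lmul H p Q₁.reflection X.1))} := by
  refine contDiffOn_of_linearIsometry_comp (symmSchatten A p).subtypeₗᵢ
    Q₁.isOpen_straighten_target ?_
  refine contDiffOn_const.add (ContDiffOn.const_smul _ ?_)
  refine (lmul H p Q₁.reflection).contDiff.comp_contDiffOn (contDiffOn_cayley.comp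
    (f := fun X : symmSchatten A p => lmul H p Q₁.reflection X.1) ?_ fun _ h => h)
  exact ((lmul H p Q₁.reflection).contDiff.comp (symmSchatten A p).subtypeL.contDiff).contDiffOn

/-- The diffeomorphism of open subsets of `i 𝔤_p` that straightens the restricted Grassmannian at
`Q₁`. -/
def straightening : OpenPartialHomeomorph (symmSchatten A p) (symmSchatten A p) where
  toFun := Q₁.straighten
  invFun := Q₁.unstraighten
  source := {Z | IsUnit (2 + toCLM (lmul H p Q₁.reflection ((2 : ℝ) • (Z.1 - Q₁.sub.1))))}
  target := {X | IsUnit (1 - toCLM (lmul H p Q₁.reflection X.1))}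
  map_source' Z hZ := by
    rw [mem_ofPred, coe_straighten, lmul_reflection_lmul_reflection]
    exact isUnit_one_sub_cayleyInv hZ
  map_target' X hX := by
    rw [mem_ofPred, two_smul_unstraighten_sub]
    exact isUnit_two_add_cayley hX
  left_inv' Z hZ := by
    apply Subtype.ext
    rw [coe_unstraighten, coe_straighten, lmul_reflection_lmul_reflection, cayley_cayleyInv hZ,
      lmul_reflection_lmul_reflection, smul_smul]
    norm_num
  right_inv' X hX := by
    apply Subtype.ext
    rw [coe_straighten, two_smul_unstraighten_sub, cayleyInv_cayley hX,
      lmul_reflection_lmul_reflection]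
  open_source := Q₁.isOpen_straighten_source
  open_target := Q₁.isOpen_straighten_target
  continuousOn_toFun := Q₁.contDiffOn_straighten.continuousOn
  continuousOn_invFun := Q₁.contDiffOn_unstraighten.continuousOn

lemma sub_mem_straightening_source : Q₁.sub ∈ Q₁.straightening.source := by
  change IsUnit _
  simpa using isUnit_two

@[simp] lemma straightening_sub : Q₁.straightening Q₁.sub = 0 := by
  apply Subtype.ext
  change (Q₁.straighten Q₁.sub).1 = 0
  rw [coe_straighten]
  simp [cayleyInv]

/-- The operators of `i 𝔤_p` that anticommute with `2 Q₁ - 1`: the tangent space at `Q₁`. -/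
def codiagonal : Submodule ℝ (symmSchatten A p) where
  carrier := {X | Q₁.reflection * toCLM X.1 + toCLM X.1 * Q₁.reflection = 0}
  add_mem' {X Y} hX hY := by
    rw [mem_ofPred] at *
    rw [Submodule.coe_add, map_add, mul_add, add_mul, add_add_add_comm, hX, hY, add_zero]
  zero_mem' := by simp
  smul_mem' c X hX := by
    rw [mem_ofPred] at *
    rw [Submodule.coe_smul, toCLM_real_smul, smul_mul_assoc, mul_smul_comm, ← smul_add, hX,
      smul_zero]

lemma mem_codiagonal {X : symmSchatten A p} : X ∈ Q₁.codiagonal ↔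
    Q₁.reflection * toCLM X.1 + toCLM X.1 * Q₁.reflection = 0 := Iff.rfl

/-- Symmetry and the Schatten condition are built into i 𝔤_p, so only idempotency of Q₀ + Z is at
stake. Twice this operator minus 1 is ε + w with w (1 - ε X) = 2 X, which is the situation of
`add_mul_self_eq_one_iff`. -/
lemma exists_sub_eq_iff_straightening_mem {Z : symmSchatten A p}
    (hZ : Z ∈ Q₁.straightening.source) :
    (∃ Q : RestrictedGrassmannian A p Q₀, Q.sub = Z) ↔ Q₁.straightening Z ∈ Q₁.codiagonal := by
  have hX : IsUnit (1 - toCLM (lmul H p Q₁.reflection (Q₁.straightening Z).1)) :=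
    Q₁.straightening.map_source hZ
  have hw : lmul H p Q₁.reflection ((2 : ℝ) • (Z.1 - Q₁.sub.1)) =
      cayley (lmul H p Q₁.reflection (Q₁.straightening Z).1) := by
    rw [← two_smul_unstraighten_sub]
    congr 4
    exact (Q₁.straightening.left_inv hZ).symm
  set X := Q₁.straightening Z
  have hw' : toCLM ((2 : ℝ) • (Z.1 - Q₁.sub.1)) * (1 - Q₁.reflection * toCLM X.1) =
      toCLM X.1 + toCLM X.1 := by
    rw [← Q₁.lmul_reflection_lmul_reflection ((2 : ℝ) • (Z.1 - Q₁.sub.1)), hw, cayley, toCLM_lmul,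
      toCLM_rmul, ← toCLM_lmul, mul_assoc, mul_assoc, Ring.inverse_mul_cancel _ hX, mul_one,
      toCLM_real_smul, two_smul, toCLM_lmul, mul_add, reflection_mul_reflection_mul]
  rw [exists_sub_eq_iff, mul_self_eq_self_iff, mem_codiagonal,
    ← add_mul_self_eq_one_iff Q₁.reflection_mul_self (by simpa using hX) hw']
  have h : Q₀.proj + toCLM Z.1 + (Q₀.proj + toCLM Z.1) - 1 =
      Q₁.reflection + toCLM ((2 : ℝ) • (Z.1 - Q₁.sub.1)) := by
    rw [toCLM_real_smul, map_sub, toCLM_sub, two_smul, reflection]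
    abel
  rw [h]

omit hp in
lemma isASymm_reflection_mul_mul {B : H →L[ℂ] H} (hB : IsASymm A B) :
    IsASymm A (Q₁.reflection * (B * Q₁.reflection)) := by
  have h := Q₁.isASymm_reflection
  unfold IsASymm at *
  rw [← ContinuousLinearMap.star_eq_adjoint] at *
  rw [star_mul, star_mul, mul_assoc, h, ← mul_assoc, mul_assoc (star _), hB, ← mul_assoc, h]
  simp only [mul_assoc]

/-- The projection `X ↦ (X - ε X ε) / 2` of `i 𝔤_p` onto the tangent space. -/
def codiagonalProjection : symmSchatten A p →L[ℝ] Q₁.codiagonal :=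
  (((1 / 2 : ℝ) • ((symmSchatten A p).subtypeL -
    ((lmul H p Q₁.reflection).comp (rmul H p Q₁.reflection)).comp
      (symmSchatten A p).subtypeL)).codRestrict (symmSchatten A p) fun X => by
        refine (symmSchatten A p).smul_mem _ ((symmSchatten A p).sub_mem X.2 ?_)
        exact Q₁.isASymm_reflection_mul_mul (isASymm_toCLM X)).codRestrict Q₁.codiagonal
  fun X => by
    have h : toCLM ((1 / 2 : ℝ) • (X.1 - lmul H p Q₁.reflection (rmul H p Q₁.reflection X.1))) =
        (1 / 2 : ℝ) • (toCLM X.1 - Q₁.reflection * (toCLM X.1 * Q₁.reflection)) := by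
      rw [toCLM_real_smul, map_sub, toCLM_lmul, toCLM_rmul]
    change Q₁.reflection * toCLM ((1 / 2 : ℝ) • (X.1 - lmul H p Q₁.reflection
      (rmul H p Q₁.reflection X.1))) + toCLM ((1 / 2 : ℝ) • (X.1 - lmul H p Q₁.reflection
      (rmul H p Q₁.reflection X.1))) * Q₁.reflection = 0
    rw [h, smul_mul_assoc, mul_smul_comm, ← smul_add, mul_sub, sub_mul,
      reflection_mul_reflection_mul, ← mul_assoc, mul_reflection_mul_reflection]
    simp

lemma codiagonalProjection_apply (X : Q₁.codiagonal) : Q₁.codiagonalProjection X = X := by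
  apply Subtype.ext
  apply Subtype.ext
  apply SchattenClass.toCLM_injective
  have h : toCLM ((1 / 2 : ℝ) • (X.1.1 - lmul H p Q₁.reflection
      (rmul H p Q₁.reflection X.1.1))) = toCLM X.1.1 := by
    rw [toCLM_real_smul, map_sub, toCLM_lmul, toCLM_rmul,
      ← neg_eq_of_add_eq_zero_right (Q₁.mem_codiagonal.1 X.2), mul_neg,
      reflection_mul_reflection_mul, sub_neg_eq_add, ← two_smul ℝ, smul_smul]
    norm_num
  exact h

lemma closedComplemented_codiagonal : Q₁.codiagonal.ClosedComplemented :=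
  ⟨Q₁.codiagonalProjection, Q₁.codiagonalProjection_apply⟩

lemma isClosed_codiagonal : IsClosed (Q₁.codiagonal : Set (symmSchatten A p)) :=
  Q₁.closedComplemented_codiagonal.isClosed

instance : CompleteSpace Q₁.codiagonal := Q₁.isClosed_codiagonal.completeSpace_coe

lemma isAAntisymm_reflection_mul {X : symmSchatten A p} (hX : X ∈ Q₁.codiagonal) :
    IsAAntisymm A (Q₁.reflection * toCLM X.1) := by
  have h := Q₁.isASymm_reflection
  have h1 := isASymm_toCLM X
  have h2 : toCLM X.1 * Q₁.reflection = -(Q₁.reflection * toCLM X.1) :=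
    (neg_eq_of_add_eq_zero_right (Q₁.mem_codiagonal.1 hX)).symm
  unfold IsASymm IsAAntisymm at *
  rw [← ContinuousLinearMap.star_eq_adjoint] at *
  rw [star_mul, mul_assoc, h, ← mul_assoc, h1, mul_assoc, h2, mul_neg]

/-- An X that anticommutes with ε makes ε X anti-symmetric, so 1 - ε X is invertible. Hence the
chart of Gr_{res,p} at Q₁ has the whole tangent space as its range. -/
lemma mem_straightening_target (hA : A.IsPositive) (hinj : Function.Injective A)
    {X : symmSchatten A p} (hX : X ∈ Q₁.codiagonal) : X ∈ Q₁.straightening.target :=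
  isUnit_one_sub_of_isAAntisymm hA hinj
    (by rw [toCLM_lmul]; exact Q₁.isAAntisymm_reflection_mul hX) (isCompactOperator _)

/-- The parametrization of a neighbourhood of `Q₁` in `Gr_{res,p}` by its tangent space. -/
lemma exists_sub_eq_unstraighten (hA : A.IsPositive) (hinj : Function.Injective A)
    (X : Q₁.codiagonal) :
    ∃ Q : RestrictedGrassmannian A p Q₀, Q.sub = Q₁.straightening.symm X := by
  have hX := Q₁.mem_straightening_target hA hinj X.2
  rw [Q₁.exists_sub_eq_iff_straightening_mem (Q₁.straightening.map_target hX),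
    Q₁.straightening.right_inv hX]
  exact X.2

/-- The point of `Gr_{res,p}` with a given coordinate at `Q₁`. -/
def pointAt (hA : A.IsPositive) (hinj : Function.Injective A) (X : Q₁.codiagonal) :
    RestrictedGrassmannian A p Q₀ := (Q₁.exists_sub_eq_unstraighten hA hinj X).choose

variable (hA : A.IsPositive) (hinj : Function.Injective A)

lemma sub_pointAt (X : Q₁.codiagonal) :
    (Q₁.pointAt hA hinj X).sub = Q₁.straightening.symm X :=
  (Q₁.exists_sub_eq_unstraighten hA hinj X).choose_spec

lemma straightening_sub_pointAt (X : Q₁.codiagonal) :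
    Q₁.straightening (Q₁.pointAt hA hinj X).sub = X := by
  rw [sub_pointAt, Q₁.straightening.right_inv (Q₁.mem_straightening_target hA hinj X.2)]

lemma sub_pointAt_mem_source (X : Q₁.codiagonal) :
    (Q₁.pointAt hA hinj X).sub ∈ Q₁.straightening.source := by
  rw [sub_pointAt]
  exact Q₁.straightening.map_target (Q₁.mem_straightening_target hA hinj X.2)

lemma straightening_sub_mem {Q : RestrictedGrassmannian A p Q₀}
    (hQ : Q.sub ∈ Q₁.straightening.source) : Q₁.straightening Q.sub ∈ Q₁.codiagonal :=
  (Q₁.exists_sub_eq_iff_straightening_mem hQ).1 ⟨Q, rfl⟩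

/-- The coordinate at `Q₁` of a point of `Gr_{res,p}`. -/
def coordAt (Q : RestrictedGrassmannian A p Q₀) : Q₁.codiagonal :=
  -- On the chart domain the straightened point already lies in the tangent space and the projection
  -- does nothing; it only makes the coordinate a total function.
  Q₁.codiagonalProjection (Q₁.straightening Q.sub)

lemma coe_coordAt {Q : RestrictedGrassmannian A p Q₀}
    (hQ : Q.sub ∈ Q₁.straightening.source) :
    (Q₁.coordAt Q : symmSchatten A p) = Q₁.straightening Q.sub :=
  congrArg Subtype.val (Q₁.codiagonalProjection_apply ⟨_, Q₁.straightening_sub_mem hQ⟩)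

lemma coordAt_pointAt (X : Q₁.codiagonal) : Q₁.coordAt (Q₁.pointAt hA hinj X) = X := by
  apply Subtype.ext
  rw [Q₁.coe_coordAt (Q₁.sub_pointAt_mem_source hA hinj X), straightening_sub_pointAt]

lemma pointAt_coordAt {Q : RestrictedGrassmannian A p Q₀}
    (hQ : Q.sub ∈ Q₁.straightening.source) : Q₁.pointAt hA hinj (Q₁.coordAt Q) = Q := by
  apply sub_injective
  rw [sub_pointAt, Q₁.coe_coordAt hQ, Q₁.straightening.left_inv hQ]

lemma coordAt_self : Q₁.coordAt Q₁ = 0 := by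
  rw [coordAt, straightening_sub, map_zero]

lemma contDiff_sub_pointAt : ContDiff ℝ ∞ fun X => (Q₁.pointAt hA hinj X).sub := by
  have h := Q₁.contDiffOn_unstraighten.comp Q₁.codiagonal.subtypeL.contDiff.contDiffOn
    (s := univ) fun X _ => Q₁.mem_straightening_target hA hinj X.2
  exact contDiffOn_univ.1 (h.congr fun X _ => Q₁.sub_pointAt hA hinj X)

lemma continuous_pointAt : Continuous (Q₁.pointAt hA hinj) :=
  isInducing_sub.continuous_iff.2 (Q₁.contDiff_sub_pointAt hA hinj).continuous

lemma isOpen_coordAt_source :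
    IsOpen {Q : RestrictedGrassmannian A p Q₀ | Q.sub ∈ Q₁.straightening.source} :=
  Q₁.straightening.open_source.preimage isInducing_sub.continuous

lemma continuousOn_coordAt : ContinuousOn Q₁.coordAt
    {Q : RestrictedGrassmannian A p Q₀ | Q.sub ∈ Q₁.straightening.source} :=
  Q₁.codiagonalProjection.continuous.comp_continuousOn
    (Q₁.straightening.continuousOn.comp isInducing_sub.continuous.continuousOn fun _ h => h)

/-- The parametrization is a continuous image of a vector space and takes the value Q₁ at 0. -/
lemma pointAt_mem_connectedComponent (X : Q₁.codiagonal) :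
    Q₁.pointAt hA hinj X ∈ connectedComponent Q₁ := by
  have h := (isPreconnected_univ (α := Q₁.codiagonal)).image _
    (Q₁.continuous_pointAt hA hinj).continuousOn
  refine h.subset_connectedComponent ⟨0, mem_univ _, ?_⟩ ⟨X, mem_univ _, rfl⟩
  have h1 := Q₁.pointAt_coordAt hA hinj Q₁.sub_mem_straightening_source
  rwa [coordAt_self] at h1

include hA hinj in
lemma mem_connectedComponent_of_mem_source {Q : RestrictedGrassmannian A p Q₀}
    (hQ : Q.sub ∈ Q₁.straightening.source) : Q ∈ connectedComponent Q₁ := by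
  rw [← Q₁.pointAt_coordAt hA hinj hQ]
  exact Q₁.pointAt_mem_connectedComponent hA hinj _

include hA hinj in
-- Inside the straightening domain at a point Q of the component, every point of Gr_{res,p} belongs
-- to that component. So there the component and Gr_{res,p} coincide, and the straightening of the
-- latter serves.
lemma isComplementedSubmanifold_component :
    IsComplementedSubmanifold (sub '' connectedComponent Q₁) := by
  rintro _ ⟨Q, hQ, rfl⟩
  refine ⟨Q.codiagonal, Q.straightening, Q.closedComplemented_codiagonal,
    Q.sub_mem_straightening_source, Q.contDiffOn_straighten, Q.contDiffOn_unstraighten,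
    fun Z hZ => ?_⟩
  rw [← Q.exists_sub_eq_iff_straightening_mem hZ]
  constructor
  · rintro ⟨R, -, rfl⟩
    exact ⟨R, rfl⟩
  · rintro ⟨R, rfl⟩
    refine ⟨R, ?_, rfl⟩
    rw [connectedComponent_eq hQ]
    exact Q.mem_connectedComponent_of_mem_source hA hinj hZ

/-- The chart at `Q₁` of its component. -/
def componentChart : OpenPartialHomeomorph (connectedComponent Q₁) Q₁.codiagonal where
  toFun Q := Q₁.coordAt Q
  invFun X := ⟨Q₁.pointAt hA hinj X, Q₁.pointAt_mem_connectedComponent hA hinj X⟩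
  source := {Q | Q.1.sub ∈ Q₁.straightening.source}
  target := univ
  map_source' _ _ := mem_univ _
  map_target' X _ := Q₁.sub_pointAt_mem_source hA hinj X
  left_inv' _ hQ := Subtype.ext (Q₁.pointAt_coordAt hA hinj hQ)
  right_inv' X _ := Q₁.coordAt_pointAt hA hinj X
  open_source := Q₁.isOpen_coordAt_source.preimage continuous_subtype_val
  open_target := isOpen_univ
  continuousOn_toFun := Q₁.continuousOn_coordAt.comp continuous_subtype_val.continuousOn
    fun _ h => h
  continuousOn_invFun := ((Q₁.continuous_pointAt hA hinj).subtype_mk _).continuousOn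

lemma isEmbeddedChart_componentChart :
    IsEmbeddedChart (fun Q : connectedComponent Q₁ => Q.1.sub) Q₁.codiagonal
      (Q₁.componentChart hA hinj) where
  contDiffOn_symm := (Q₁.contDiff_sub_pointAt hA hinj).contDiffOn
  exists_ambient := ⟨Q₁.straightening, _, Q₁.straightening.open_source, Q₁.contDiffOn_straighten,
    fun _ hQ => ⟨hQ, Q₁.coe_coordAt hQ⟩⟩

end RestrictedGrassmannian

end Straightening

/-! ### The orbit map near 1, open orbits and transitivity on components -/

section Orbit

variable {H : Type u} [NormedAddCommGroup H] [InnerProductSpace ℂ H] [CompleteSpace H]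
  {A : H →L[ℂ] H} {p : ℝ≥0∞} [hp : Fact (1 ≤ p)] {Q₀ : CompatibleGrassmannian A}

namespace RestrictedGrassmannian

variable (Q₁ : RestrictedGrassmannian A p Q₀)

lemma isASymm_commutator (Y : antisymmSchatten A p) :
    IsASymm A (toCLM Y.1 * Q₁.reflection - Q₁.reflection * toCLM Y.1) := by
  have h := Q₁.isASymm_reflection
  have h1 := isAAntisymm Y
  unfold IsASymm IsAAntisymm at *
  rw [← ContinuousLinearMap.star_eq_adjoint] at *
  rw [star_sub, star_mul, star_mul, sub_mul, mul_assoc, h1, mul_assoc, h, mul_neg, ← mul_assoc,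
    ← mul_assoc, h, h1]
  noncomm_ring

/-- The differential `Y ↦ Y ε - ε Y` of the orbit map at `1`, with values in the tangent space. -/
def orbitDifferential : antisymmSchatten A p →L[ℝ] Q₁.codiagonal :=
  (((rmul H p Q₁.reflection - lmul H p Q₁.reflection).comp
    (antisymmSchatten A p).subtypeL).codRestrict (symmSchatten A p) fun Y => by
      change IsASymm A (toCLM (rmul H p Q₁.reflection Y.1 - lmul H p Q₁.reflection Y.1))
      rw [map_sub, toCLM_rmul, toCLM_lmul]
      exact Q₁.isASymm_commutator Y).codRestrict Q₁.codiagonal fun Y => by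
    change Q₁.reflection * toCLM (rmul H p Q₁.reflection Y.1 - lmul H p Q₁.reflection Y.1) +
      toCLM (rmul H p Q₁.reflection Y.1 - lmul H p Q₁.reflection Y.1) * Q₁.reflection = 0
    rw [map_sub, toCLM_rmul, toCLM_lmul, mul_sub, sub_mul, reflection_mul_reflection_mul,
      mul_reflection_mul_reflection, ← mul_assoc]
    abel

/-- The right inverse `X ↦ X ε / 2` of `orbitDifferential`. -/
def orbitSection : Q₁.codiagonal →L[ℝ] antisymmSchatten A p :=
  ((1 / 2 : ℝ) • ((rmul H p Q₁.reflection).comp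
    ((symmSchatten A p).subtypeL.comp Q₁.codiagonal.subtypeL))).codRestrict (antisymmSchatten A p)
  fun X => by
    refine (antisymmSchatten A p).smul_mem _ ?_
    change IsAAntisymm A (toCLM (rmul H p Q₁.reflection X.1.1))
    rw [toCLM_rmul, ← neg_eq_of_add_eq_zero_right (Q₁.mem_codiagonal.1 X.2)]
    exact (Q₁.isAAntisymm_reflection_mul X.2).neg

/-- Since ε² = 1 and ε X ε = -X, the value on X ε / 2 is (X ε ε - ε X ε) / 2 = X. -/
lemma orbitDifferential_orbitSection :
    Function.RightInverse Q₁.orbitSection Q₁.orbitDifferential := by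
  intro X
  apply Subtype.ext
  apply Subtype.ext
  apply SchattenClass.toCLM_injective
  have h : toCLM (rmul H p Q₁.reflection ((1 / 2 : ℝ) • rmul H p Q₁.reflection X.1.1) -
      lmul H p Q₁.reflection ((1 / 2 : ℝ) • rmul H p Q₁.reflection X.1.1)) = toCLM X.1.1 := by
    rw [map_sub, toCLM_rmul, toCLM_lmul, toCLM_real_smul, toCLM_rmul,
      ← neg_eq_of_add_eq_zero_right (Q₁.mem_codiagonal.1 X.2), smul_mul_assoc, mul_smul_comm,
      ← smul_sub, mul_neg, reflection_mul_reflection_mul,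
      neg_eq_of_add_eq_zero_right (Q₁.mem_codiagonal.1 X.2), mul_reflection_mul_reflection,
      sub_neg_eq_add, ← two_smul ℝ, smul_smul]
    norm_num
  exact h

/-- `𝔤_p` as the product of the tangent space at `Q₁` and the Lie algebra of the isotropy group. -/
def splitting : antisymmSchatten A p ≃L[ℝ] Q₁.codiagonal × Q₁.orbitDifferential.ker :=
  .equivOfRightInverse Q₁.orbitDifferential Q₁.orbitSection Q₁.orbitDifferential_orbitSection

variable (hA : A.IsPositive) (hinj : Function.Injective A)

lemma sub_conj_cayleyGroup (Y : antisymmSchatten A p) :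
    ((conj (cayleyGroup hA hinj Y) Q₁).sub : SchattenClass H p) =
      Q₁.sub.1 + (1 / 2 : ℝ) • Q₁.orbitDisplacement (cayley Y.1) := by
  rw [← subOne_cayleyGroup hA hinj, orbitDisplacement_subOne, smul_smul]
  norm_num

lemma isUnit_one_add_cayley (hA : A.IsPositive) (hinj : Function.Injective A)
    (Y : antisymmSchatten A p) : IsUnit (1 + toCLM (cayley Y.1)) := by
  rw [← subOne_cayleyGroup hA hinj]
  exact isUnit_one_add_subOne _

lemma contDiff_sub_conj_cayleyGroup :
    ContDiff ℝ ∞ fun Y => (conj (cayleyGroup hA hinj Y) Q₁).sub := by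
  rw [← contDiffOn_univ]
  refine contDiffOn_of_linearIsometry_comp (symmSchatten A p).subtypeₗᵢ isOpen_univ ?_
  refine ContDiffOn.congr ?_ fun Y _ => Q₁.sub_conj_cayleyGroup hA hinj Y
  refine contDiffOn_const.add (ContDiffOn.const_smul _ ?_)
  exact Q₁.contDiffOn_orbitDisplacement.comp (contDiffOn_cayley.comp
    (antisymmSchatten A p).subtypeL.contDiff.contDiffOn
      fun Y _ => isUnit_one_sub_toCLM hA hinj Y) fun Y _ => isUnit_one_add_cayley hA hinj Y

/-- The derivative 2 of the Cayley transform cancels the 1 / 2 that comes from ε = 2 Q₁ - 1. -/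
lemma hasFDerivAt_sub_conj_cayleyGroup :
    HasFDerivAt (fun Y => (conj (cayleyGroup hA hinj Y) Q₁).sub)
      (Q₁.codiagonal.subtypeL.comp Q₁.orbitDifferential) 0 := by
  refine hasFDerivAt_of_linearIsometry_comp (symmSchatten A p).subtypeₗᵢ ?_
  have h1 : HasFDerivAt (fun Y : antisymmSchatten A p => cayley Y.1)
      (((2 : ℝ) • ContinuousLinearMap.id ℝ _).comp (antisymmSchatten A p).subtypeL) 0 :=
    HasFDerivAt.comp (g := cayley) (f := fun Y : antisymmSchatten A p => (Y : SchattenClass H p))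
      (0 : antisymmSchatten A p) hasFDerivAt_cayley_zero (antisymmSchatten A p).subtypeL.hasFDerivAt
  have h2 : HasFDerivAt Q₁.orbitDisplacement (rmul H p Q₁.reflection - lmul H p Q₁.reflection)
      (cayley ((0 : antisymmSchatten A p) : SchattenClass H p)) := by
    have h0 : cayley ((0 : antisymmSchatten A p) : SchattenClass H p) = 0 := by simp [cayley]
    rw [h0]
    exact Q₁.hasFDerivAt_orbitDisplacement
  have h3 := ((h2.comp (0 : antisymmSchatten A p) h1).const_smul (1 / 2 : ℝ)).const_add Q₁.sub.1
  refine (h3.congr_fderiv ?_).congr_of_eventuallyEq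
    (Eventually.of_forall fun Y => Q₁.sub_conj_cayleyGroup hA hinj Y)
  ext Y
  change (1 / 2 : ℝ) • (rmul H p Q₁.reflection ((2 : ℝ) • Y.1) -
    lmul H p Q₁.reflection ((2 : ℝ) • Y.1)) = _ - _
  rw [map_smul, map_smul, ← smul_sub, smul_smul]
  norm_num

lemma hasFDerivAt_straighten : HasFDerivAt Q₁.straighten (.id ℝ _) Q₁.sub := by
  refine hasFDerivAt_of_linearIsometry_comp (symmSchatten A p).subtypeₗᵢ ?_
  have h1 : HasFDerivAt (fun Z : symmSchatten A p =>
      lmul H p Q₁.reflection ((2 : ℝ) • (Z.1 - Q₁.sub.1)))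
      ((lmul H p Q₁.reflection).comp ((2 : ℝ) • (symmSchatten A p).subtypeL)) Q₁.sub :=
    (lmul H p Q₁.reflection).hasFDerivAt.comp _
      (((symmSchatten A p).subtypeL.hasFDerivAt.sub_const _).const_smul _)
  have h2 : HasFDerivAt (cayleyInv : SchattenClass H p → _)
      ((1 / 2 : ℝ) • ContinuousLinearMap.id ℝ _)
      (lmul H p Q₁.reflection ((2 : ℝ) • (Q₁.sub.1 - Q₁.sub.1))) := by
    rw [sub_self, smul_zero, map_zero]
    exact hasFDerivAt_cayleyInv_zero
  refine ((lmul H p Q₁.reflection).hasFDerivAt.comp Q₁.sub (h2.comp Q₁.sub h1)).congr_fderiv ?_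
  ext Z
  change lmul H p Q₁.reflection ((1 / 2 : ℝ) • lmul H p Q₁.reflection ((2 : ℝ) • Z.1)) = Z.1
  rw [map_smul, lmul_reflection_lmul_reflection, smul_smul]
  norm_num

lemma hasFDerivAt_coordAt_conj_cayleyGroup :
    HasFDerivAt (fun Y => Q₁.coordAt (conj (cayleyGroup hA hinj Y) Q₁)) Q₁.orbitDifferential 0 := by
  have h : HasFDerivAt Q₁.straighten (.id ℝ _)
      (conj (cayleyGroup (p := p) hA hinj 0) Q₁).sub := by
    rw [cayleyGroup_zero, conj_one]
    exact Q₁.hasFDerivAt_straighten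
  have h1 : HasFDerivAt (fun Y => Q₁.straighten (conj (cayleyGroup hA hinj Y) Q₁).sub) _ 0 :=
    HasFDerivAt.comp (f := fun Y => (conj (cayleyGroup hA hinj Y) Q₁).sub)
      (0 : antisymmSchatten A p) h (Q₁.hasFDerivAt_sub_conj_cayleyGroup hA hinj)
  refine (Q₁.codiagonalProjection.hasFDerivAt.comp (0 : antisymmSchatten A p) h1).congr_fderiv ?_
  ext Y
  exact congrArg (fun X : Q₁.codiagonal => (X.1 : SchattenClass H p))
    (Q₁.codiagonalProjection_apply (Q₁.orbitDifferential Y))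

/-- A chart of `𝔤_p` at `0` in which the orbit map is a linear projection. -/
lemma exists_orbit_chart :
    ∃ ψ : OpenPartialHomeomorph (antisymmSchatten A p) (antisymmSchatten A p),
      0 ∈ ψ.source ∧ ψ 0 = 0 ∧
      (∀ Y ∈ ψ.source, (conj (cayleyGroup hA hinj Y) Q₁).sub ∈ Q₁.straightening.source) ∧
      (∀ Y, (Q₁.splitting (ψ Y)).1 = Q₁.coordAt (conj (cayleyGroup hA hinj Y) Q₁)) ∧
      ContDiffOn ℝ ∞ ψ ψ.source ∧ ContDiffOn ℝ ∞ ψ.symm ψ.target := by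
  -- With D the orbit differential and S its right inverse, f keeps the component Y - S D Y in ker D
  -- and replaces S D Y by S of the true coordinate of the orbit point. Then D (f Y) is that
  -- coordinate, and f has derivative S D + (1 - S D) = 1 at 0.
  let f : antisymmSchatten A p → antisymmSchatten A p := fun Y =>
    Q₁.orbitSection (Q₁.coordAt (conj (cayleyGroup hA hinj Y) Q₁)) +
      (Y - Q₁.orbitSection (Q₁.orbitDifferential Y))
  have hg := Q₁.contDiff_sub_conj_cayleyGroup hA hinj
  have hU : IsOpen {Y : antisymmSchatten A p |
      (conj (cayleyGroup hA hinj Y) Q₁).sub ∈ Q₁.straightening.source} :=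
    Q₁.straightening.open_source.preimage hg.continuous
  have h0 : (0 : antisymmSchatten A p) ∈ {Y : antisymmSchatten A p |
      (conj (cayleyGroup hA hinj Y) Q₁).sub ∈ Q₁.straightening.source} := by
    rw [mem_ofPred, cayleyGroup_zero, conj_one]
    exact Q₁.sub_mem_straightening_source
  have hf : ContDiffOn ℝ ∞ f {Y : antisymmSchatten A p |
      (conj (cayleyGroup hA hinj Y) Q₁).sub ∈ Q₁.straightening.source} := by
    refine ContDiffOn.add (Q₁.orbitSection.contDiff.comp_contDiffOn
      (Q₁.codiagonalProjection.contDiff.comp_contDiffOn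
        (Q₁.contDiffOn_straighten.comp hg.contDiffOn fun Y hY => hY))) (ContDiff.contDiffOn ?_)
    exact contDiff_id.sub (Q₁.orbitSection.contDiff.comp Q₁.orbitDifferential.contDiff)
  have hf' : HasFDerivAt f (ContinuousLinearEquiv.refl ℝ (antisymmSchatten A p) :
      antisymmSchatten A p →L[ℝ] antisymmSchatten A p) 0 := by
    refine ((Q₁.orbitSection.hasFDerivAt.comp (0 : antisymmSchatten A p)
      (Q₁.hasFDerivAt_coordAt_conj_cayleyGroup hA hinj)).add ((hasFDerivAt_id _).sub
        (Q₁.orbitSection.comp Q₁.orbitDifferential).hasFDerivAt)).congr_fderiv ?_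
    ext1 Y
    exact add_sub_cancel _ _
  obtain ⟨ψ, hψ0, hψU, hψ, hs, hs'⟩ := exists_smooth_openPartialHomeomorph hU h0 hf hf'
  refine ⟨ψ, hψ0, ?_, fun Y hY => hψU hY, fun Y => ?_, hs, hs'⟩
  · rw [hψ]
    simp [f, conj_one, coordAt_self]
  · rw [hψ]
    change Q₁.orbitDifferential (f Y) = _
    simp only [f, map_add, map_sub, Q₁.orbitDifferential_orbitSection _, sub_self, add_zero]

include hA hinj in
-- For Q near Q₁ the equation ψ Y = S (coordinate of Q) is solvable; the orbit point of the Cayley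
-- transform of Y then has the same coordinate as Q, and equals it.
lemma range_conj_mem_nhds : range (fun G : RestrictedGroup A p => conj G Q₁) ∈ 𝓝 Q₁ := by
  obtain ⟨ψ, hψ0, hψ00, hψU, hψ, -, -⟩ := Q₁.exists_orbit_chart hA hinj
  have hc : ContinuousAt (fun Q => Q₁.orbitSection (Q₁.coordAt Q)) Q₁ :=
    Q₁.orbitSection.continuous.continuousAt.comp (Q₁.continuousOn_coordAt.continuousAt
      (Q₁.isOpen_coordAt_source.mem_nhds Q₁.sub_mem_straightening_source))
  have ht : ψ.target ∈ 𝓝 (Q₁.orbitSection (Q₁.coordAt Q₁)) := by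
    refine ψ.open_target.mem_nhds ?_
    rw [coordAt_self, map_zero, ← hψ00]
    exact ψ.map_source hψ0
  filter_upwards [hc ht, Q₁.isOpen_coordAt_source.mem_nhds Q₁.sub_mem_straightening_source]
    with Q hQ hQ'
  have hY := ψ.map_target hQ
  refine ⟨cayleyGroup hA hinj (ψ.symm (Q₁.orbitSection (Q₁.coordAt Q))), ?_⟩
  have h1 := hψ (ψ.symm (Q₁.orbitSection (Q₁.coordAt Q)))
  rw [ψ.right_inv hQ] at h1
  have h2 : (Q₁.splitting (Q₁.orbitSection (Q₁.coordAt Q))).1 = Q₁.coordAt Q :=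
    Q₁.orbitDifferential_orbitSection _
  rw [h2] at h1
  have h3 := congrArg (Q₁.pointAt hA hinj) h1
  rw [Q₁.pointAt_coordAt hA hinj hQ', Q₁.pointAt_coordAt hA hinj (hψU _ hY)] at h3
  exact h3.symm

lemma continuous_conj_left : Continuous fun G : RestrictedGroup A p => conj G Q₁ := by
  rw [isInducing_sub.continuous_iff, IsInducing.subtypeVal.continuous_iff]
  have h : Continuous fun G : RestrictedGroup A p =>
      Q₁.sub.1 + (1 / 2 : ℝ) • Q₁.orbitDisplacement G.subOne :=
    continuous_const.add ((Q₁.contDiffOn_orbitDisplacement.continuousOn.comp_continuous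
      continuous_subOne isUnit_one_add_subOne).const_smul _)
  refine h.congr fun G => ?_
  rw [orbitDisplacement_subOne, smul_smul]
  norm_num

include hA hinj in
lemma conj_mem_connectedComponent (G : RestrictedGroup A p) :
    conj G Q₁ ∈ connectedComponent Q₁ := by
  have := preconnectedSpace_restrictedGroup (p := p) hA hinj
  exact (isPreconnected_range Q₁.continuous_conj_left).subset_connectedComponent
    ⟨1, conj_one Q₁⟩ ⟨G, rfl⟩

include hA hinj in
-- All orbits are open, and the complement of one is a union of others; so each orbit is clopen and
-- contains the component of each of its points.
lemma exists_conj_eq {Q : RestrictedGrassmannian A p Q₀} (hQ : Q ∈ connectedComponent Q₁) :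
    ∃ G : RestrictedGroup A p, conj G Q₁ = Q := by
  have key : ∀ R : RestrictedGrassmannian A p Q₀,
      IsOpen (range fun G : RestrictedGroup A p => conj G R) := by
    intro R
    rw [isOpen_iff_mem_nhds]
    rintro _ ⟨K, rfl⟩
    filter_upwards [(conj K R).range_conj_mem_nhds hA hinj]
    rintro _ ⟨G, rfl⟩
    exact ⟨G * K, conj_mul G K R⟩
  have hcl : IsClopen (range fun G : RestrictedGroup A p => conj G Q₁) := by
    refine ⟨⟨?_⟩, key Q₁⟩
    rw [isOpen_iff_mem_nhds]
    intro R hR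
    filter_upwards [R.range_conj_mem_nhds hA hinj]
    rintro _ ⟨G, rfl⟩ ⟨K, hK⟩
    refine hR ⟨G⁻¹ * K, ?_⟩
    change conj (G⁻¹ * K) Q₁ = R
    rw [conj_mul, show conj K Q₁ = conj G R from hK, conj_inv_conj]
  exact hcl.connectedComponent_subset ⟨1, conj_one Q₁⟩ hQ

end RestrictedGrassmannian

end Orbit

/-! ### Charts of a component, the embedding and the submersion -/

section Component

variable {H : Type u} [NormedAddCommGroup H] [InnerProductSpace ℂ H] [CompleteSpace H]
  {A : H →L[ℂ] H} {p : ℝ≥0∞} [hp : Fact (1 ≤ p)] {Q₀ : CompatibleGrassmannian A}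

namespace RestrictedGrassmannian

variable (hA : A.IsPositive) (hinj : Function.Injective A)
  (Q₁ : RestrictedGrassmannian A p Q₀) (G : RestrictedGroup A p)

include hA hinj in
lemma conj_mem_of_mem {Q : RestrictedGrassmannian A p Q₀} (hQ : Q ∈ connectedComponent Q₁) :
    conj G Q ∈ connectedComponent Q₁ := by
  rw [connectedComponent_eq hQ]
  exact Q.conj_mem_connectedComponent hA hinj G

/-- The action of an element of `𝒢_{p,A}` on a component of `Gr_{res,p}`. -/
def componentConj (hA : A.IsPositive) (hinj : Function.Injective A)
    (Q₁ : RestrictedGrassmannian A p Q₀) (G : RestrictedGroup A p) :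
    connectedComponent Q₁ ≃ₜ connectedComponent Q₁ where
  toFun Q := ⟨conj G Q, Q₁.conj_mem_of_mem hA hinj G Q.2⟩
  invFun Q := ⟨conj G⁻¹ Q, Q₁.conj_mem_of_mem hA hinj G⁻¹ Q.2⟩
  left_inv _ := Subtype.ext (conj_inv_conj _ _)
  right_inv _ := Subtype.ext (conj_conj_inv _ _)
  continuous_toFun := ((continuous_conj G).comp continuous_subtype_val).subtype_mk _
  continuous_invFun := ((continuous_conj G⁻¹).comp continuous_subtype_val).subtype_mk _

/-- The affine action of an element of `𝒢_{p,A}` on `Q₀ + i 𝔤_p`. -/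
def affineConj (Q₀ : CompatibleGrassmannian A) (G : RestrictedGroup A p) :
    symmSchatten A p ≃ₜ symmSchatten A p where
  toFun := conjAffine Q₀ G
  invFun := conjAffine Q₀ G⁻¹
  left_inv Z := conjAffine_inv_conjAffine G Z
  right_inv Z := by simpa using conjAffine_inv_conjAffine (Q₀ := Q₀) G⁻¹ Z
  continuous_toFun := (contDiff_conjAffine G).continuous
  continuous_invFun := (contDiff_conjAffine G⁻¹).continuous

/-- The translate by `G` of the chart at `Q₁` of its component. -/
def translatedComponentChart : OpenPartialHomeomorph (connectedComponent Q₁) Q₁.codiagonal :=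
  (Q₁.componentConj hA hinj G⁻¹).toOpenPartialHomeomorph.trans (Q₁.componentChart hA hinj)

lemma isEmbeddedChart_translatedComponentChart :
    IsEmbeddedChart (fun Q : connectedComponent Q₁ => Q.1.sub) Q₁.codiagonal
      (Q₁.translatedComponentChart hA hinj G) := by
  refine (Q₁.isEmbeddedChart_componentChart hA hinj).comp_homeomorph _
    (contDiff_conjAffine (Q₀ := Q₀) G⁻¹) (contDiff_conjAffine (Q₀ := Q₀) G)
    (fun Q => sub_conj G⁻¹ Q.1) (fun Q => ?_)
  have h := sub_conj G⁻¹⁻¹ Q.1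
  rw [inv_inv] at h
  exact h

lemma mem_translatedComponentChart_source {Q : connectedComponent Q₁} :
    Q ∈ (Q₁.translatedComponentChart hA hinj G).source ↔
      (conj G⁻¹ Q.1).sub ∈ Q₁.straightening.source := by
  simp [translatedComponentChart, componentChart, componentConj]

/-- Transitivity covers the component by translates of a single chart, so the tangent space at Q₁
models it everywhere. -/
lemma exists_mem_translatedComponentChart_source (Q : connectedComponent Q₁) :
    ∃ G : RestrictedGroup A p, Q ∈ (Q₁.translatedComponentChart hA hinj G).source := by
  obtain ⟨G, hG⟩ := Q₁.exists_conj_eq hA hinj Q.2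
  refine ⟨G, ?_⟩
  rw [mem_translatedComponentChart_source, ← hG, conj_inv_conj]
  exact Q₁.sub_mem_straightening_source

/-- The translate by `G` of the straightening at `Q₁`. -/
def translatedStraightening : OpenPartialHomeomorph (symmSchatten A p) (symmSchatten A p) :=
  (affineConj Q₀ G⁻¹).toOpenPartialHomeomorph.trans Q₁.straightening

lemma translatedStraightening_mem_maximalAtlas :
    Q₁.translatedStraightening G ∈
      IsManifold.maximalAtlas 𝓘(ℝ, symmSchatten A p) ∞ (symmSchatten A p) := by
  refine StructureGroupoid.mem_maximalAtlas_of_mem_groupoid _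
    (mem_contDiffGroupoid_of_contDiffOn ?_ ?_)
  · exact Q₁.contDiffOn_straighten.comp (contDiff_conjAffine (Q₀ := Q₀) G⁻¹).contDiffOn
      fun Z hZ => hZ.2
  · exact (contDiff_conjAffine (Q₀ := Q₀) G⁻¹⁻¹).comp_contDiffOn
      (Q₁.contDiffOn_unstraighten.mono fun X hX => hX.1)

lemma isEmbedding_sub_component :
    IsEmbedding fun Q : connectedComponent Q₁ => Q.1.sub :=
  (⟨isInducing_sub, sub_injective⟩ : IsEmbedding sub).comp IsEmbedding.subtypeVal

include hA hinj in
-- When the chart of the component and the straightening are translated by the same G, the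
-- translations cancel. The inclusion is then X ↦ (X, 0) for the splitting of i 𝔤_p into the tangent
-- space and a complement D.
lemma isSmoothEmbedding_sub [ChartedSpace Q₁.codiagonal (connectedComponent Q₁)]
    (hat : ∀ c ∈ atlas Q₁.codiagonal (connectedComponent Q₁),
      IsEmbeddedChart (fun Q : connectedComponent Q₁ => Q.1.sub) Q₁.codiagonal c) :
    Manifold.IsSmoothEmbedding 𝓘(ℝ, Q₁.codiagonal) 𝓘(ℝ, symmSchatten A p) ∞
      (fun Q : connectedComponent Q₁ => Q.1.sub) := by
  obtain ⟨D, e, -, -, he⟩ := Q₁.closedComplemented_codiagonal.exists_submodule_equiv_prod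
  refine ⟨Manifold.IsImmersionOfComplement.isImmersion (F := D) fun Q => ?_,
    Q₁.isEmbedding_sub_component⟩
  obtain ⟨G, hG⟩ := Q₁.exists_mem_translatedComponentChart_source hA hinj Q
  refine Manifold.IsImmersionAtOfComplement.mk_of_continuousAt
    Q₁.isEmbedding_sub_component.continuous.continuousAt e.symm
    (Q₁.translatedComponentChart hA hinj G) (Q₁.translatedStraightening G) hG ?_
    ((Q₁.isEmbeddedChart_translatedComponentChart hA hinj G).mem_maximalAtlas hat)
    (Q₁.translatedStraightening_mem_maximalAtlas G) fun X _ => ?_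
  · refine ⟨mem_univ _, ?_⟩
    rw [mem_translatedComponentChart_source, sub_conj] at hG
    exact hG
  · have h1 : e.symm (X, 0) = X := by simp [he]
    have h2 : (conj G⁻¹⁻¹ (Q₁.pointAt hA hinj X)).sub =
        conjAffine Q₀ G (Q₁.pointAt hA hinj X).sub := by rw [sub_conj, inv_inv]
    change Q₁.straightening (conjAffine Q₀ G⁻¹ (conj G⁻¹⁻¹ (Q₁.pointAt hA hinj X)).sub) =
      e.symm (X, 0)
    rw [h1, h2, conjAffine_inv_conjAffine, straightening_sub_pointAt]

/-- The orbit map of `𝒢_{p,A}` at `Q₁`. -/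
def orbitMap (G : RestrictedGroup A p) : connectedComponent Q₁ :=
  ⟨conj G Q₁, Q₁.conj_mem_connectedComponent hA hinj G⟩

lemma continuous_orbitMap : Continuous (Q₁.orbitMap hA hinj) :=
  Q₁.continuous_conj_left.subtype_mk _

/-- Equivariance reduces the claim at G to the one at 1: charts translated by G on both sides turn
the orbit map into its local form at 1, which ψ makes the projection of 𝔤_p along ker D. -/
lemma isSubmersion_orbitMap [ChartedSpace (antisymmSchatten A p) (RestrictedGroup A p)]
    (hatG : ∀ c ∈ atlas (antisymmSchatten A p) (RestrictedGroup A p),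
      IsEmbeddedChart subOne (antisymmSchatten A p) c)
    [ChartedSpace Q₁.codiagonal (connectedComponent Q₁)]
    (hat : ∀ c ∈ atlas Q₁.codiagonal (connectedComponent Q₁),
      IsEmbeddedChart (fun Q : connectedComponent Q₁ => Q.1.sub) Q₁.codiagonal c) :
    Manifold.IsSubmersion 𝓘(ℝ, antisymmSchatten A p) 𝓘(ℝ, Q₁.codiagonal) ∞
      (Q₁.orbitMap hA hinj) := by
  obtain ⟨ψ, hψ0, -, -, hψ, hs, hs'⟩ := Q₁.exists_orbit_chart hA hinj
  refine Manifold.IsSubmersionOfComplement.isSubmersion (F := Q₁.orbitDifferential.ker)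
    fun G => ?_
  refine Manifold.IsSubmersionAtOfComplement.mk_of_continuousAt
    (Q₁.continuous_orbitMap hA hinj).continuousAt Q₁.splitting
    ((translatedChart hA hinj G).trans ψ) (Q₁.translatedComponentChart hA hinj G) ?_ ?_
    (trans_mem_maximalAtlas ((isEmbeddedChart_translatedChart hA hinj G).mem_maximalAtlas hatG)
      hs hs')
    ((Q₁.isEmbeddedChart_translatedComponentChart hA hinj G).mem_maximalAtlas hat) fun Y hY => ?_
  · refine ⟨mem_translatedChart_source hA hinj G, ?_⟩
    have h : translatedChart hA hinj G G = 0 := by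
      change (G⁻¹ * G).toLie = 0
      rw [inv_mul_cancel, ← cayleyGroup_zero hA hinj, toLie_cayleyGroup]
    change translatedChart hA hinj G G ∈ ψ.source
    rw [h]
    exact hψ0
  · rw [mem_translatedComponentChart_source]
    change (conj G⁻¹ (conj G Q₁)).sub ∈ _
    rw [conj_inv_conj]
    exact Q₁.sub_mem_straightening_source
  · have hY' : Y ∈ ψ.target := by
      simp only [OpenPartialHomeomorph.extend_target, OpenPartialHomeomorph.trans_target] at hY
      exact hY.1.1
    change Q₁.coordAt (conj G⁻¹ (conj (G⁻¹⁻¹ * cayleyGroup hA hinj (ψ.symm Y)) Q₁)) =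
      (Q₁.splitting Y).1
    rw [inv_inv, conj_mul, conj_inv_conj, ← hψ, ψ.right_inv hY']

end RestrictedGrassmannian

end Component

end

end CompGr

open CompGr in
theorem corollary6p5 {H : Type*} [NormedAddCommGroup H] [InnerProductSpace ℂ H] [CompleteSpace H]
    (A : H →L[ℂ] H) (hA : A.IsPositive) (hinj : Function.Injective A)
    (p : ENNReal) [Fact (1 ≤ p)] (Q₀ : CompGr.CompatibleGrassmannian A) :
    ∃ _ : ChartedSpace (CompGr.antisymmSchatten A p) (CompGr.RestrictedGroup A p),
      LieGroup 𝓘(ℝ, CompGr.antisymmSchatten A p) ∞ (CompGr.RestrictedGroup A p) ∧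
      (∃ e : CompGr.antisymmSchatten A p → CompGr.RestrictedGroup A p,
        (∀ X, (e X).toCLM = NormedSpace.exp (CompGr.SchattenClass.toCLM X.1)) ∧
        IsLocalDiffeomorphAt 𝓘(ℝ, CompGr.antisymmSchatten A p)
          𝓘(ℝ, CompGr.antisymmSchatten A p) ∞ e 0) ∧
      ∀ Q₁ : CompGr.RestrictedGrassmannian A p Q₀,
        CompGr.IsComplementedSubmanifold
          (CompGr.RestrictedGrassmannian.sub '' connectedComponent Q₁) ∧
        ∃ (F : Submodule ℝ (CompGr.symmSchatten A p)) (_ : F.ClosedComplemented)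
          (_ : ChartedSpace F (connectedComponent Q₁)),
          IsManifold 𝓘(ℝ, F) ∞ (connectedComponent Q₁) ∧
          Manifold.IsSmoothEmbedding 𝓘(ℝ, F) 𝓘(ℝ, CompGr.symmSchatten A p) ∞
            (fun Q : connectedComponent Q₁ => (Q : CompGr.RestrictedGrassmannian A p Q₀).sub) ∧
          ∃ π : CompGr.RestrictedGroup A p → connectedComponent Q₁,
            (∀ G, (π G : CompGr.RestrictedGrassmannian A p Q₀).proj =
              G.toCLM * Q₁.proj * (G⁻¹).toCLM) ∧
            Manifold.IsSubmersion 𝓘(ℝ, CompGr.antisymmSchatten A p) 𝓘(ℝ, F) ∞ π := by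
  -- The atlas is taken to be the set of all embedded charts, so `hatG` below holds by definition;
  -- likewise `hat` for the component.
  let _ : ChartedSpace (antisymmSchatten A p) (RestrictedGroup A p) :=
    chartedSpaceOfEmbeddedCharts RestrictedGroup.subOne (antisymmSchatten A p) fun G =>
      ⟨translatedChart hA hinj G, mem_translatedChart_source hA hinj G,
        isEmbeddedChart_translatedChart hA hinj G⟩
  have hatG : ∀ c ∈ atlas (antisymmSchatten A p) (RestrictedGroup A p),
      IsEmbeddedChart RestrictedGroup.subOne (antisymmSchatten A p) c := fun _ hc => hc
  refine ⟨inferInstance, lieGroup_of_isEmbeddedChart hatG,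
    ⟨expGroup, fun X => toCLM_expGroup X, isLocalDiffeomorphAt_expGroup hA hinj hatG⟩,
    fun Q₁ => ⟨Q₁.isComplementedSubmanifold_component hA hinj, ?_⟩⟩
  let _ : ChartedSpace Q₁.codiagonal (connectedComponent Q₁) :=
    chartedSpaceOfEmbeddedCharts (fun Q : connectedComponent Q₁ => Q.1.sub) Q₁.codiagonal
      fun Q =>
        have h := Q₁.exists_mem_translatedComponentChart_source hA hinj Q
        ⟨_, h.choose_spec, Q₁.isEmbeddedChart_translatedComponentChart hA hinj h.choose⟩
  have hat : ∀ c ∈ atlas Q₁.codiagonal (connectedComponent Q₁),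
      IsEmbeddedChart (fun Q : connectedComponent Q₁ => Q.1.sub) Q₁.codiagonal c :=
    fun _ hc => hc
  exact ⟨Q₁.codiagonal, Q₁.closedComplemented_codiagonal, inferInstance,
    isManifold_of_isEmbeddedChart hat, Q₁.isSmoothEmbedding_sub hA hinj hat,
    Q₁.orbitMap hA hinj, fun _ => rfl, Q₁.isSubmersion_orbitMap hA hinj hatG hat⟩
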